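/- Let $d\ge 1$, $\omega>0$, and let $\rho=(\rho_1,\dots,\rho_d)\in C^\infty(\mathbb R^3;\mathbb R^d)$ be real-valued with $\rho(-x)=\rho(x)$ and $\rho(x)=0$ for $|x|\ge R_\rho$ (condition A2). Put $\hat\rho_n(k)=\int e^{ik\cdot x}\rho_n(x)\,dx$ and assume $\hat\rho_n(k)\neq 0$ for all $n=1,\dots,d$ and all $k\in\mathbb R^3\setminus\{0\}$ (condition A3), and that the $3\times3$ matrix $\omega^2 I-K$ is positive definite, where $$K_{ij}=\sum_{n=1}^d\frac1{(2\pi)^3}\int_{\mathbb R^3}\frac{k_ik_j|\hat\rho_n(k)|^2}{|k|^2}\,dk$$ (condition A1 with $m=0$). Let $\mathcal E$ be the space of states $Y=(\varphi,q,\pi,p)$ with $\varphi\in H^1_{loc}(\mathbb R^3;\mathbb R^d)$, $\pi\in L^2_{loc}(\mathbb R^3;\mathbb R^d)$, $q,p\in\mathbb R^3$, with the seminorms $$\|Y\|_{\mathcal E,R}^2=\int_{|x|<R}\big(|\varphi|^2+|\nabla\varphi|^2+|\pi|^2\big)\,dx+|q|^2+|p|^2,\qquad R>0.$$ Consider solutions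 $Y(t)=(\varphi(t),q(t),\pi(t),p(t))\in C(\mathbb R,\mathcal E)$ of the massless coupled system $$\dot\varphi_n=\pi_n,\quad \dot\pi_n=\Delta\varphi_n-q\cdot\nabla\rho_n\quad(n=1,\dots,d),\qquad \dot q=p,\quad \dot p=-\omega^2q-\sum_{n=1}^d\int\varphi_n\nabla\rho_n\,dx,\qquad Y(0)=Y_0,$$ the field equations being understood in the sense of distributions. Then there exists $\delta>0$, depending only on $\omega$ and $\rho$, such that for every $R_1>0$ there is a constant $C>0$, depending only on $\omega$, $\rho$ and $R_1$, with the following property: for every $Y_0=(\varphi^0,q^0,\pi^0,p^0)\in\mathcal E$ with $\varphi^0(x)=\pi^0(x)=0$ for (almost all) $|x|>R_1$, and every solution $Y(t)$ with initial state $Y_0$, $$|q(t)|+|p(t)|\le C e^{-\delta t}\,\|Y_0\|_{\mathcal E,R_1}\qquad\text{for all } t\ge0.$$ -/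

import Mathlib

open MeasureTheory
open scoped Topology

noncomputable section

namespace FieldParticle

/-- Physical (and momentum) space `ℝ³` with its Euclidean norm. -/
abbrev E3 : Type := EuclideanSpace ℝ (Fin 3)

/-- `f` is square integrable on every ball, `f ∈ L²_loc(ℝ³)`. -/
def MemL2Loc {F : Type} [NormedAddCommGroup F] (f : E3 → F) : Prop :=
  ∀ R : ℝ, MemLp f 2 (volume.restrict (Metric.ball (0 : E3) R))

/-- Real test functions, `ψ ∈ C₀^∞(ℝ³)`. -/
def IsTestFunction (ψ : E3 → ℝ) : Prop :=
  ContDiff ℝ ((⊤ : ℕ∞) : WithTop ℕ∞) ψ ∧ HasCompactSupport ψ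

/-- `G` is the weak gradient of `f`: `∫ f ∇ψ = - ∫ ψ G` for all test functions `ψ`. -/
def IsWeakGradient (f : E3 → ℝ) (G : E3 → E3) : Prop :=
  ∀ ψ : E3 → ℝ, IsTestFunction ψ →
    ∫ x, f x • gradient ψ x = - ∫ x, ψ x • G x

/-- A state of finite local energy: `φ ∈ H¹_loc(ℝ³; ℝᵈ)` (carried together with a representative
`gradφ` of its weak gradient, which is unique almost everywhere), `π ∈ L²_loc(ℝ³; ℝᵈ)`,
and the position `q` and momentum `p` of the particle. -/
@[ext]
structure State (d : ℕ) where
  φ : Fin d → E3 → ℝ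
  gradφ : Fin d → E3 → E3
  π : Fin d → E3 → ℝ
  q : E3
  p : E3
  φ_mem : ∀ n, MemL2Loc (φ n)
  gradφ_mem : ∀ n, MemL2Loc (gradφ n)
  π_mem : ∀ n, MemL2Loc (π n)
  weakGrad : ∀ n, IsWeakGradient (φ n) (gradφ n)

theorem MemL2Loc.sub {F : Type} [NormedAddCommGroup F] {f g : E3 → F}
    (hf : MemL2Loc f) (hg : MemL2Loc g) : MemL2Loc (f - g) :=
  fun R => (hf R).sub (hg R)

theorem MemL2Loc.locallyIntegrable {F : Type} [NormedAddCommGroup F] {f : E3 → F}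
    (hf : MemL2Loc f) : LocallyIntegrable f volume := by
  intro x
  refine ⟨Metric.ball 0 (‖x‖ + 1), Metric.isOpen_ball.mem_nhds (by simp), ?_⟩
  have : IsFiniteMeasure (volume.restrict (Metric.ball (0 : E3) (‖x‖ + 1))) :=
    ⟨by simpa using (measure_ball_lt_top (μ := (volume : Measure E3)) (x := 0) (r := ‖x‖ + 1))⟩
  exact (hf (‖x‖ + 1)).integrable (by norm_num)

theorem IsTestFunction.gradient_continuous {ψ : E3 → ℝ} (hψ : IsTestFunction ψ) :
    Continuous (gradient ψ) :=
  (InnerProductSpace.toDual ℝ E3).symm.continuous.comp (hψ.1.continuous_fderiv (by simp))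

theorem IsTestFunction.gradient_hasCompactSupport {ψ : E3 → ℝ} (hψ : IsTestFunction ψ) :
    HasCompactSupport (gradient ψ) :=
  (hψ.2.fderiv (𝕜 := ℝ)).comp_left (g := (InnerProductSpace.toDual ℝ E3).symm) (map_zero _)

theorem IsWeakGradient.sub {f g : E3 → ℝ} {F G : E3 → E3}
    (hf : IsWeakGradient f F) (hg : IsWeakGradient g G)
    (hf2 : MemL2Loc f) (hg2 : MemL2Loc g) (hF2 : MemL2Loc F) (hG2 : MemL2Loc G) :
    IsWeakGradient (f - g) (F - G) := by
  intro ψ hψ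
  have h1 : Integrable (fun x => f x • gradient ψ x) volume :=
    hf2.locallyIntegrable.integrable_smul_right_of_hasCompactSupport
      hψ.gradient_continuous hψ.gradient_hasCompactSupport
  have h2 : Integrable (fun x => g x • gradient ψ x) volume :=
    hg2.locallyIntegrable.integrable_smul_right_of_hasCompactSupport
      hψ.gradient_continuous hψ.gradient_hasCompactSupport
  have h3 : Integrable (fun x => ψ x • F x) volume :=
    hF2.locallyIntegrable.integrable_smul_left_of_hasCompactSupport hψ.1.continuous hψ.2
  have h4 : Integrable (fun x => ψ x • G x) volume :=
    hG2.locallyIntegrable.integrable_smul_left_of_hasCompactSupport hψ.1.continuous hψ.2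
  simp only [Pi.sub_apply, sub_smul, smul_sub]
  rw [integral_sub h1 h2, integral_sub h3 h4, hf ψ hψ, hg ψ hψ]
  abel

instance (d : ℕ) : Sub (State d) where
  sub Y Z :=
    { φ := fun n => Y.φ n - Z.φ n
      gradφ := fun n => Y.gradφ n - Z.gradφ n
      π := fun n => Y.π n - Z.π n
      q := Y.q - Z.q
      p := Y.p - Z.p
      φ_mem := fun n => (Y.φ_mem n).sub (Z.φ_mem n)
      gradφ_mem := fun n => (Y.gradφ_mem n).sub (Z.gradφ_mem n)
      π_mem := fun n => (Y.π_mem n).sub (Z.π_mem n)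
      weakGrad := fun n => (Y.weakGrad n).sub (Z.weakGrad n) (Y.φ_mem n) (Z.φ_mem n)
        (Y.gradφ_mem n) (Z.gradφ_mem n) }

/-- The local energy seminorm `‖Y‖_{ℰ,R}`. -/
def State.seminorm {d : ℕ} (R : ℝ) (Y : State d) : ℝ :=
  Real.sqrt ((∑ n, ∫ x in Metric.ball (0 : E3) R,
      ((Y.φ n x) ^ 2 + ‖Y.gradφ n x‖ ^ 2 + (Y.π n x) ^ 2)) + ‖Y.q‖ ^ 2 + ‖Y.p‖ ^ 2)

/-- The field part of `Y` vanishes (almost everywhere) for `|x| > R`. -/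
def State.FieldSupportedIn {d : ℕ} (Y : State d) (R : ℝ) : Prop :=
  ∀ n, ∀ᵐ x : E3, R < ‖x‖ → Y.φ n x = 0 ∧ Y.π n x = 0

/-- `Y ∈ C(ℝ; ℰ)`: continuity in time with respect to every local energy seminorm. -/
def ContinuousInEnergy {d : ℕ} (Y : ℝ → State d) : Prop :=
  ∀ R : ℝ, 0 < R → ∀ s : ℝ,
    Filter.Tendsto (fun t => (Y t - Y s).seminorm R) (𝓝 s) (𝓝 0)

/-- `Y ∈ C(ℝ; ℰ)` solves the Cauchy problem with initial state `Y₀` for the massless coupled system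
`φ̇ₙ = πₙ`, `π̇ₙ = Δφₙ - q · ∇ρₙ`, `q̇ = p`, `ṗ = -ω² q - ∑ₙ ∫ φₙ ∇ρₙ dx`,
the field equations being understood in the sense of distributions in `x`. -/
structure IsSolution {d : ℕ} (ω : ℝ) (ρ : Fin d → E3 → ℝ) (Y₀ : State d)
    (Y : ℝ → State d) : Prop where
  continuous : ContinuousInEnergy Y
  initial : Y 0 = Y₀
  field : ∀ n, ∀ ψ : E3 → ℝ, IsTestFunction ψ → ∀ t : ℝ,
    HasDerivAt (fun s => ∫ x, (Y s).φ n x * ψ x) (∫ x, (Y t).π n x * ψ x) t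
  momentum : ∀ n, ∀ ψ : E3 → ℝ, IsTestFunction ψ → ∀ t : ℝ,
    HasDerivAt (fun s => ∫ x, (Y s).π n x * ψ x)
      ((∫ x, (Y t).φ n x * Laplacian.laplacian ψ x)
        - ∫ x, inner ℝ (Y t).q (gradient (ρ n) x) * ψ x) t
  position : ∀ t : ℝ, HasDerivAt (fun s => (Y s).q) (Y t).p t
  force : ∀ t : ℝ, HasDerivAt (fun s => (Y s).p)
    (-(ω ^ 2 • (Y t).q) - ∑ n, ∫ x, (Y t).φ n x • gradient (ρ n) x) t

/-- The Fourier transform `f̂(k) = ∫ e^{i k·x} f(x) dx`. -/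
def fourierHat (f : E3 → ℝ) (k : E3) : ℂ :=
  ∫ x, Complex.exp (Complex.I * ((inner ℝ k x : ℝ) : ℂ)) * ((f x : ℝ) : ℂ)

/-- The `3 × 3` matrix `K_{ij} = ∑ₙ (2π)⁻³ ∫ k_i k_j |ρ̂ₙ(k)|² / |k|² dk`. -/
def couplingMatrix {d : ℕ} (ρ : Fin d → E3 → ℝ) : Matrix (Fin 3) (Fin 3) ℝ :=
  Matrix.of fun i j => ∑ n, 1 / (2 * Real.pi) ^ 3 *
    ∫ k : E3, k i * k j * ‖fourierHat (ρ n) k‖ ^ 2 / ‖k‖ ^ 2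

end FieldParticle

end

/-! The field can be eliminated. Testing the weak wave equation against backward free waves
(Duhamel) turns the particle equations into q'' = -ω² q + ∫₀ᵗ Γ(s) q(t - s) ds + F(t). Here Γ(s) is
the 3×3 matrix of responses of the observables ∂ⱼρₙ to impulses ∂ᵢρₙ given to the free field, and F
is the force of the free field with the initial data of the problem.

The dimension enters through the strong Huygens principle (`waveSin_eq_zero`, `waveCos_eq_zero`),
read off from Kirchhoff's formula. A wave emitted inside a ball leaves it completely after a finite
time, so Γ has compact support and F vanishes for large times. What remains is a linear delay
equation with finite memory and a compactly supported force (`IsSolution.isDelaySolution`).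

Its characteristic operator z² + ω² - Γ̂(z) is therefore entire. Suppose it is invertible for Re z ≥
0. Openness of the set of units on a compact piece of the imaginary axis, together with domination
by z² at high frequency, extends invertibility to a strip Re z ≥ -δ with an inverse of size C/(1 +
|Im z|²) (`exists_strip_bound`). Inverting the Laplace transform and moving the contour to Re z = -δ
gives decay like e^{-δt} (`IsForcedSolution.norm_le`, `IsDelaySolution.exists_decay`). The rate
depends only on ω and Γ; the radius R₁ enters only through the time after which F vanishes.

Invertibility (`isUnit_charOp`) is where the assumptions on the form factor act. By the spectral
representation of Γ, a kernel vector v would make the scalar function Q(z) = (z² + ω²)|v|² - ∫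
h(ξ)/(z² + |2πξ|²) dξ vanish, with h(ξ) = |ξ·v|² times the spectral density of ρ. Off the real axis
with Re z > 0 the imaginary part of Q is nonzero. On the real half-line z ≥ 0, positivity of ω² - K
makes Re Q positive. At z = ib with b ≠ 0 the boundary value of Im Q is fed by the mass of h on the
resonant sphere |2πξ| = |b|, which is positive because no ρ̂ₙ vanishes there: the particle radiates
at every nonzero frequency (`exists_le_integral_shell`, `dispersion_ne_zero`). -/

noncomputable section

namespace FieldParticle

/-! ### Plane waves averaged over the unit sphere -/

section

open Set Real

/-- The surface measure of the unit sphere in `ℝ³`. -/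
abbrev sphereMeasure : Measure (Metric.sphere (0 : E3) 1) := (volume : Measure E3).toSphere

/-- The measure `r² dr` on the half-line. -/
abbrev radialMeasure : Measure (Ioi (0 : ℝ)) := Measure.volumeIoiPow 2

theorem measurePreserving_polar :
    MeasurePreserving (homeomorphUnitSphereProd E3) ((volume : Measure E3).comap (↑))
      (sphereMeasure.prod radialMeasure) := by
  have h := (volume : Measure E3).measurePreserving_homeomorphUnitSphereProd
  simpa using h

theorem integral_polar {G : Type*} [NormedAddCommGroup G] [NormedSpace ℝ G] (F : E3 → G) :
    ∫ x, F x = ∫ z : Metric.sphere (0 : E3) 1 × Ioi (0 : ℝ), F (z.2.1 • z.1.1)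
      ∂(sphereMeasure.prod radialMeasure) := by
  have h1 : ∫ x, F x = ∫ x : ({(0)}ᶜ : Set E3), F x.1 ∂((volume : Measure E3).comap (↑)) := by
    rw [integral_subtype_comap (measurableSet_singleton _).compl F, restrict_compl_singleton]
  rw [h1, ← measurePreserving_polar.integral_comp (Homeomorph.measurableEmbedding _)]
  refine integral_congr_ae (Filter.Eventually.of_forall fun x => ?_)
  have hx : ‖x.1‖ ≠ 0 := norm_ne_zero_iff.2 x.2
  simp [homeomorphUnitSphereProd, smul_smul, hx]

theorem integral_radialMeasure (h : ℝ → ℝ) :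
    ∫ r : Ioi (0 : ℝ), h r.1 ∂radialMeasure = ∫ r in Ioi (0 : ℝ), r ^ 2 * h r := by
  simp only [Measure.volumeIoiPow, ENNReal.ofReal]
  rw [integral_withDensity_eq_integral_smul,
    integral_subtype_comap measurableSet_Ioi fun a ↦ Real.toNNReal (a ^ 2) • h a]
  · refine setIntegral_congr_fun measurableSet_Ioi fun x hx ↦ ?_
    simp only [NNReal.smul_def, Real.coe_toNNReal _ (pow_nonneg (le_of_lt hx) 2), smul_eq_mul]
  · exact (measurable_subtype_coe.pow_const _).real_toNNReal

theorem integral_polar_mul (F : E3 → ℝ) (g : E3 → ℝ) (h : ℝ → ℝ)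
    (hF : ∀ (θ : Metric.sphere (0 : E3) 1) (r : ℝ), 0 < r → F (r • θ.1) = g θ.1 * h r) :
    ∫ x, F x = (∫ θ, g θ.1 ∂sphereMeasure) * ∫ r in Ioi (0 : ℝ), r ^ 2 * h r := by
  rw [integral_polar, ← integral_radialMeasure, ← integral_prod_mul]
  exact integral_congr_ae (Filter.Eventually.of_forall fun z => hF z.1 z.2.1 z.2.2)

theorem integral_pow_mul_exp_neg_sq_Ioi (n : ℕ) :
    ∫ r in Ioi (0 : ℝ), r ^ n * rexp (-r ^ 2) = 1 / 2 * Real.Gamma ((n + 1) / 2) := by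
  have h := integral_rpow_mul_exp_neg_rpow (p := 2) (q := n) (by norm_num)
    (by have : (0 : ℝ) ≤ n := n.cast_nonneg
        linarith)
  simpa using h

theorem integral_even_pow_mul_exp_neg_sq (j : ℕ) :
    ∫ r : ℝ, r ^ (2 * j) * rexp (-r ^ 2) = Real.Gamma (j + 1 / 2) := by
  have h := integral_comp_abs (f := fun r : ℝ => r ^ (2 * j) * rexp (-r ^ 2))
  simp only [sq_abs, Even.pow_abs (even_two_mul j)] at h
  rw [h, integral_pow_mul_exp_neg_sq_Ioi]
  push_cast
  rw [← mul_assoc, mul_one_div_cancel (by norm_num), one_mul]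
  congr 1
  ring

theorem exists_isometry_map_eq (v w : E3) (h : ‖v‖ = ‖w‖) : ∃ L : E3 ≃ₗᵢ[ℝ] E3, L v = w :=
  ⟨(ℝ ∙ (v - w))ᗮ.reflection, Submodule.reflection_sub h⟩

/-- An isometry carries k to the first coordinate axis; there the Gaussian factors into three
one-dimensional integrals, two of them equal to √π. -/
theorem gaussian_moment (k : E3) (j : ℕ) :
    ∫ x : E3, (inner ℝ k x) ^ (2 * j) * rexp (-‖x‖ ^ 2) =
      ‖k‖ ^ (2 * j) * (π * Real.Gamma (j + 1 / 2)) := by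
  obtain ⟨L, hL⟩ := exists_isometry_map_eq (EuclideanSpace.single 0 ‖k‖) k (by simp)
  rw [← L.measurePreserving.integral_comp L.toHomeomorph.measurableEmbedding]
  have h1 : ∀ x : E3, inner ℝ k (L x) = ‖k‖ * x 0 := by
    intro x
    conv_lhs => rw [← hL]
    rw [L.inner_map_map, EuclideanSpace.inner_single_left]
    simp
  simp only [h1, L.norm_map, mul_pow, mul_assoc]
  rw [integral_const_mul]
  congr 1
  rw [← (EuclideanSpace.volume_preserving_symm_measurableEquiv_toLp (Fin 3)).symm.integral_comp
    (MeasurableEquiv.measurableEmbedding _)]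
  let f : Fin 3 → ℝ → ℝ := fun i s => if i = 0 then s ^ (2 * j) * rexp (-s ^ 2) else rexp (-s ^ 2)
  have h2 := integral_fintype_prod_volume_eq_prod (𝕜 := ℝ) f
  have hg : ∫ s : ℝ, rexp (-s ^ 2) = √π := by simpa using integral_gaussian 1
  simp only [Fin.prod_univ_three, f, if_true, Fin.one_eq_zero_iff, Fin.reduceEq, if_false, hg,
    integral_even_pow_mul_exp_neg_sq] at h2
  simp only [OfNat.ofNat_ne_one, if_false, hg] at h2
  rw [mul_assoc, mul_self_sqrt pi_pos.le] at h2
  rw [mul_comm π, ← h2]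
  refine integral_congr_ae (Filter.Eventually.of_forall fun x => ?_)
  simp only [EuclideanSpace.norm_sq_eq, Fin.sum_univ_three, neg_add, Real.exp_add]
  simp [mul_assoc]

/-- The Gaussian moment, computed in polar coordinates, is the spherical moment times a radial
integral. The radial integral is (j + 1/2) times the Gamma factor of the Cartesian value, up to a
constant, so the Gamma factors cancel. -/
theorem sphere_moment (k : E3) (j : ℕ) :
    ∫ θ, (inner ℝ k θ.1) ^ (2 * j) ∂sphereMeasure = 4 * π * ‖k‖ ^ (2 * j) / (2 * j + 1) := by
  have h := integral_polar_mul (fun x : E3 => (inner ℝ k x) ^ (2 * j) * rexp (-‖x‖ ^ 2))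
    (fun x => (inner ℝ k x) ^ (2 * j)) (fun r => r ^ (2 * j) * rexp (-r ^ 2)) (by
      intro θ r hr
      rw [norm_smul, norm_eq_of_mem_sphere, inner_smul_right, mul_pow]
      simp
      ring)
  rw [gaussian_moment] at h
  have h2 : ∫ r in Ioi (0 : ℝ), r ^ 2 * (r ^ (2 * j) * rexp (-r ^ 2)) =
      1 / 2 * ((j + 1 / 2) * Real.Gamma (j + 1 / 2)) := by
    rw [← Real.Gamma_add_one (by positivity)]
    have := integral_pow_mul_exp_neg_sq_Ioi (2 + 2 * j)
    simp only [pow_add, mul_assoc] at this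
    rw [this]
    congr 2
    push_cast
    ring
  rw [h2] at h
  have hG : 0 < Real.Gamma ((j : ℝ) + 1 / 2) := Real.Gamma_pos_of_pos (by positivity)
  rw [eq_div_iff (by positivity)]
  apply mul_right_cancel₀ hG.ne'
  linear_combination (-4 : ℝ) * h

/-- The cosine series is integrated term by term. The factor 1/(2n + 1) of the spherical moment
turns (2n)! into (2n + 1)!, which is the series of sinc. -/
theorem integral_sphere_cos (k : E3) :
    ∫ θ, Real.cos (inner ℝ k θ.1) ∂sphereMeasure = 4 * π * Real.sinc ‖k‖ := by
  have hb : ∀ θ : Metric.sphere (0 : E3) 1, |inner ℝ k θ.1| ≤ ‖k‖ := fun θ => by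
    simpa using abs_real_inner_le_norm k θ.1
  have hcont : ∀ n : ℕ, Continuous fun θ : Metric.sphere (0 : E3) 1 =>
      (-1 : ℝ) ^ n * (inner ℝ k θ.1) ^ (2 * n) / (2 * n).factorial := fun n => by fun_prop
  have h1 := hasSum_integral_of_dominated_convergence (μ := sphereMeasure)
    (F := fun (n : ℕ) (θ : Metric.sphere (0 : E3) 1) =>
      (-1 : ℝ) ^ n * (inner ℝ k θ.1) ^ (2 * n) / (2 * n).factorial)
    (f := fun θ => Real.cos (inner ℝ k θ.1))
    (fun n _ => ‖k‖ ^ (2 * n) / (2 * n).factorial)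
    (fun n => (hcont n).aestronglyMeasurable)
    (fun n => Filter.Eventually.of_forall fun θ => by
      rw [norm_div, norm_mul, norm_pow, norm_pow]
      simp only [norm_neg, norm_one, one_pow, one_mul, Real.norm_eq_abs, Nat.abs_cast]
      gcongr
      exact hb θ)
    (Filter.Eventually.of_forall fun _ =>
      (Real.summable_pow_div_factorial ‖k‖).comp_injective (i := fun n => 2 * n)
        fun a b h => by simpa using h)
    (integrable_const _)
    (Filter.Eventually.of_forall fun θ => Real.hasSum_cos _)
  have h2 : ∀ n : ℕ, ∫ θ, (-1 : ℝ) ^ n * (inner ℝ k θ.1) ^ (2 * n) / (2 * n).factorial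
      ∂sphereMeasure = 4 * π * ((-1 : ℝ) ^ n * ‖k‖ ^ (2 * n) / (2 * n + 1).factorial) := by
    intro n
    rw [integral_div, integral_const_mul, sphere_moment, Nat.factorial_succ]
    push_cast
    field_simp
  simp only [h2] at h1
  refine h1.unique (HasSum.mul_left _ ?_)
  rcases eq_or_ne ‖k‖ 0 with hk | hk
  · rw [hk]
    have := hasSum_ite_eq (0 : ℕ) (1 : ℝ)
    simp only [Real.sinc_zero]
    convert! this using 1
    ext n
    rcases Nat.eq_zero_or_pos n with rfl | hn
    · simp
    · simp [hn.ne']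
  · rw [Real.sinc_of_ne_zero hk]
    have := (Real.hasSum_sin ‖k‖).div_const ‖k‖
    convert! this using 1
    ext n
    rw [pow_succ]
    field_simp

/-- Oddness. The integrand is extended to space as a function of direction times a Gaussian, so that
the symmetry of Lebesgue measure under x ↦ -x can be used; the radial factor is positive. -/
theorem integral_sphere_sin (k : E3) : ∫ θ, Real.sin (inner ℝ k θ.1) ∂sphereMeasure = 0 := by
  have h := integral_polar_mul (fun x : E3 => Real.sin (inner ℝ k (‖x‖⁻¹ • x)) * rexp (-‖x‖ ^ 2))
    (fun x => Real.sin (inner ℝ k x)) (fun r => rexp (-r ^ 2)) (by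
      intro θ r hr
      rw [norm_smul, norm_eq_of_mem_sphere, smul_smul]
      simp [abs_of_pos hr, hr.ne'])
  have h0 : ∫ x : E3, Real.sin (inner ℝ k (‖x‖⁻¹ • x)) * rexp (-‖x‖ ^ 2) = 0 := by
    have := integral_neg_eq_self
      (fun x : E3 => Real.sin (inner ℝ k (‖x‖⁻¹ • x)) * rexp (-‖x‖ ^ 2)) volume
    simp only [norm_neg, smul_neg, inner_neg_right, Real.sin_neg, neg_mul, integral_neg] at this
    linarith
  rw [h0, integral_pow_mul_exp_neg_sq_Ioi] at h
  have : 0 < Real.Gamma (((2 : ℕ) + 1 : ℝ) / 2) := Real.Gamma_pos_of_pos (by positivity)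
  exact (mul_eq_zero.1 h.symm).resolve_right (by positivity)

theorem integral_sphere_cexp (k : E3) :
    ∫ θ, Complex.exp (((inner ℝ k θ.1 : ℝ) : ℂ) * Complex.I) ∂sphereMeasure =
      ((4 * π * Real.sinc ‖k‖ : ℝ) : ℂ) := by
  have hc : Integrable (fun θ => ((Real.cos (inner ℝ k θ.1) : ℝ) : ℂ)) sphereMeasure :=
    (Continuous.integrable_of_hasCompactSupport (by fun_prop) (HasCompactSupport.of_compactSpace _))
  have hs : Integrable (fun θ => ((Real.sin (inner ℝ k θ.1) : ℝ) : ℂ) * Complex.I)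
      sphereMeasure :=
    (Continuous.integrable_of_hasCompactSupport (by fun_prop) (HasCompactSupport.of_compactSpace _))
  simp only [Complex.exp_mul_I, ← Complex.ofReal_cos, ← Complex.ofReal_sin]
  rw [integral_add hc hs, integral_mul_const, integral_complex_ofReal, integral_complex_ofReal,
    integral_sphere_cos, integral_sphere_sin]
  simp

end

/-! ### Fourier multipliers acting on test functions -/

section

open Set Real FourierTransform Laplacian

/-- The inverse Fourier transform of a real function, in Mathlib's normalization. -/
def invHat (f : E3 → ℝ) : E3 → ℂ := 𝓕⁻ (fun x => (f x : ℂ))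

/-- A test function, as a complex Schwartz function. -/
def IsTestFunction.toSchwartz {f : E3 → ℝ} (hf : IsTestFunction f) : SchwartzMap E3 ℂ :=
  HasCompactSupport.toSchwartzMap (f := fun x => (f x : ℂ))
    (hf.2.comp_left (g := Complex.ofReal) Complex.ofReal_zero)
    (Complex.ofRealCLM.contDiff.comp hf.1)

theorem IsTestFunction.toSchwartz_coe {f : E3 → ℝ} (hf : IsTestFunction f) :
    (hf.toSchwartz : E3 → ℂ) = fun x => (f x : ℂ) := rfl

theorem IsTestFunction.invHat_eq {f : E3 → ℝ} (hf : IsTestFunction f) :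
    invHat f = (𝓕⁻ hf.toSchwartz : SchwartzMap E3 ℂ) := by
  rw [SchwartzMap.fourierInv_coe]; rfl

theorem IsTestFunction.integrable_pow_mul_invHat {f : E3 → ℝ} (hf : IsTestFunction f) (n : ℕ) :
    Integrable fun ξ => ‖ξ‖ ^ n * ‖invHat f ξ‖ := by
  rw [hf.invHat_eq]
  exact SchwartzMap.integrable_pow_mul volume _ n

theorem IsTestFunction.continuous_invHat {f : E3 → ℝ} (hf : IsTestFunction f) :
    Continuous (invHat f) := by
  rw [hf.invHat_eq]
  exact SchwartzMap.continuous _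

theorem IsTestFunction.integrable_invHat {f : E3 → ℝ} (hf : IsTestFunction f) :
    Integrable (invHat f) := by
  rw [hf.invHat_eq]
  exact SchwartzMap.integrable _

theorem IsTestFunction.fourier_invHat {f : E3 → ℝ} (hf : IsTestFunction f) :
    𝓕 (invHat f) = fun x => (f x : ℂ) := by
  rw [hf.invHat_eq, ← SchwartzMap.fourier_coe, FourierTransform.fourier_fourierInv_eq]
  rfl

theorem IsTestFunction.continuous {f : E3 → ℝ} (hf : IsTestFunction f) : Continuous f :=
  hf.1.continuous

theorem IsTestFunction.integrable {f : E3 → ℝ} (hf : IsTestFunction f) : Integrable f :=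
  hf.continuous.integrable_of_hasCompactSupport hf.2

/-- A continuous symbol of at most quadratic growth. -/
def QuadraticGrowth (m : E3 → ℝ) : Prop :=
  Continuous m ∧ ∃ C, ∀ ξ, |m ξ| ≤ C * (1 + ‖ξ‖ ^ 2)

theorem QuadraticGrowth.integrable_pow {m : E3 → ℝ} (hm : QuadraticGrowth m) {f : E3 → ℝ}
    (hf : IsTestFunction f) (n : ℕ) :
    Integrable fun ξ => ‖ξ‖ ^ n * ‖(m ξ : ℂ) * invHat f ξ‖ := by
  obtain ⟨hc, C, hC⟩ := hm
  have hci := hf.continuous_invHat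
  refine (((hf.integrable_pow_mul_invHat n).add
    (hf.integrable_pow_mul_invHat (n + 2))).const_mul C).mono' (by fun_prop)
    (Filter.Eventually.of_forall fun ξ => ?_)
  simp only [norm_mul, norm_pow, Complex.norm_real, Pi.add_apply, Real.norm_eq_abs,
    abs_norm, abs_abs]
  calc ‖ξ‖ ^ n * (|m ξ| * ‖invHat f ξ‖) ≤ ‖ξ‖ ^ n * (C * (1 + ‖ξ‖ ^ 2) * ‖invHat f ξ‖) := by
        gcongr; exact hC ξ
    _ = _ := by ring

theorem QuadraticGrowth.integrable {m : E3 → ℝ} (hm : QuadraticGrowth m) {f : E3 → ℝ}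
    (hf : IsTestFunction f) : Integrable fun ξ => (m ξ : ℂ) * invHat f ξ := by
  have h := hm.integrable_pow hf 0
  have hci := hf.continuous_invHat
  have hc := hm.1
  simp only [pow_zero, one_mul] at h
  exact (integrable_norm_iff (by fun_prop)).1 h

/-- The Fourier multiplier with (even) symbol `m` applied to `f`. -/
def multiplier (m : E3 → ℝ) (f : E3 → ℝ) (x : E3) : ℝ :=
  (𝓕 (fun ξ => (m ξ : ℂ) * invHat f ξ) x).re

theorem multiplier_one {f : E3 → ℝ} (hf : IsTestFunction f) :
    multiplier (fun _ => 1) f = f := by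
  ext x
  simp [multiplier, hf.fourier_invHat]

theorem multiplier_zero (f : E3 → ℝ) : multiplier (fun _ => 0) f = 0 := by
  ext x
  simp [multiplier, Real.fourier_eq]

theorem QuadraticGrowth.contDiff {m : E3 → ℝ} (hm : QuadraticGrowth m) {f : E3 → ℝ}
    (hf : IsTestFunction f) : ContDiff ℝ ((⊤ : ℕ∞) : WithTop ℕ∞) (multiplier m f) :=
  Complex.reCLM.contDiff.comp (Real.contDiff_fourier fun n _ => hm.integrable_pow hf n)

/-- Differentiation under the Fourier integral, allowed because all moments of the symbol times
`invHat f` are integrable; the second derivatives along an orthonormal basis sum to -(2π|ξ|)². -/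
theorem QuadraticGrowth.laplacian {m : E3 → ℝ} (hm : QuadraticGrowth m) {f : E3 → ℝ}
    (hf : IsTestFunction f) :
    Laplacian.laplacian (multiplier m f) =
      multiplier (fun ξ => -(2 * π * ‖ξ‖) ^ 2 * m ξ) f := by
  ext x
  have hcd : ContDiff ℝ ((⊤ : ℕ∞) : WithTop ℕ∞) (𝓕 (fun ξ => (m ξ : ℂ) * invHat f ξ)) :=
    Real.contDiff_fourier fun n _ => hm.integrable_pow hf n
  have h1 : multiplier m f = Complex.reCLM ∘ 𝓕 (fun ξ => (m ξ : ℂ) * invHat f ξ) := rfl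
  have hint : ∀ n, Integrable fun v =>
      VectorFourier.fourierPowSMulRight (innerSL ℝ) (fun ξ => (m ξ : ℂ) * invHat f ξ) v n :=
    fun n => VectorFourier.integrable_fourierPowSMulRight _ (hm.integrable_pow hf n)
      (hm.integrable hf).1
  rw [h1, ContDiffAt.laplacian_CLM_comp_left (hcd.contDiffAt.of_le (by norm_cast)),
    InnerProductSpace.laplacian_eq_iteratedFDeriv_orthonormalBasis _
      (EuclideanSpace.basisFun (Fin 3) ℝ)]
  simp only [Function.comp_apply, multiplier, Complex.reCLM_apply]
  congr 1
  have h4 : ∀ w : Fin 2 → E3, iteratedFDeriv ℝ 2 (𝓕 (fun ξ => (m ξ : ℂ) * invHat f ξ)) x w =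
      ∫ v, 𝐞 (-inner ℝ v x) • (VectorFourier.fourierPowSMulRight (innerSL ℝ)
        (fun ξ => (m ξ : ℂ) * invHat f ξ) v 2 w) := by
    intro w
    rw [Real.iteratedFDeriv_fourier (N := ⊤) (fun n _ => hm.integrable_pow hf n)
      (hm.integrable hf).1 (by simp)]
    exact Real.fourier_continuousMultilinearMap_apply (hint 2)
  simp only [h4, Real.fourier_eq]
  rw [← integral_finsetSum]
  · refine integral_congr_ae (Filter.Eventually.of_forall fun v => ?_)
    simp only [← Finset.smul_sum]
    congr 1
    have h3 : ((‖v‖ : ℂ)) ^ 2 = (v 0 : ℂ) ^ 2 + (v 1 : ℂ) ^ 2 + (v 2 : ℂ) ^ 2 := by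
      have := EuclideanSpace.real_norm_sq_eq v
      rw [Fin.sum_univ_three] at this
      exact_mod_cast this
    have h5 : ∀ i : Fin 3, innerSL ℝ v (EuclideanSpace.single i 1) = v i := fun i => by
      simp [innerSL_apply_apply, EuclideanSpace.inner_single_right]
    simp [Fin.sum_univ_three, Fin.prod_univ_two, mul_pow, h3, h5]
    ring
  · intro i _
    have := (ContinuousMultilinearMap.apply ℝ (fun _ : Fin 2 => E3) ℂ
      ![EuclideanSpace.basisFun (Fin 3) ℝ i, EuclideanSpace.basisFun (Fin 3) ℝ i]).integrable_comp
        (hint 2)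
    exact (Real.fourierIntegral_convergent_iff x).2 this

theorem QuadraticGrowth.abs_multiplier_le {m : E3 → ℝ} (f : E3 → ℝ) (x : E3) :
    |multiplier m f x| ≤ ∫ ξ, |m ξ| * ‖invHat f ξ‖ := by
  refine (Complex.abs_re_le_norm _).trans ?_
  rw [Real.fourier_eq]
  refine (norm_integral_le_integral_norm _).trans (le_of_eq ?_)
  refine integral_congr_ae (Filter.Eventually.of_forall fun v => ?_)
  simp [Circle.norm_smul]

theorem multiplier_sub {m₁ m₂ : E3 → ℝ} (h₁ : QuadraticGrowth m₁) (h₂ : QuadraticGrowth m₂)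
    {f : E3 → ℝ} (hf : IsTestFunction f) (x : E3) :
    multiplier (fun ξ => m₁ ξ - m₂ ξ) f x = multiplier m₁ f x - multiplier m₂ f x := by
  simp only [multiplier, ← Complex.sub_re, Real.fourier_eq]
  rw [← integral_sub]
  · congr 2
    ext ξ
    rw [← smul_sub]
    push_cast
    ring_nf
  · exact (Real.fourierIntegral_convergent_iff x).2 (h₁.integrable hf)
  · exact (Real.fourierIntegral_convergent_iff x).2 (h₂.integrable hf)

theorem multiplier_const_mul (c : ℝ) (m : E3 → ℝ) (f : E3 → ℝ) (x : E3) :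
    multiplier (fun ξ => c * m ξ) f x = c * multiplier m f x := by
  simp only [multiplier, Real.fourier_eq]
  rw [← Complex.re_ofReal_mul, ← integral_const_mul]
  congr 2
  ext ξ
  simp only [Circle.smul_def, smul_eq_mul]
  push_cast
  ring

end

/-! ### Wave propagators, Kirchhoff's formula and Huygens' principle -/

section

open Set Real FourierTransform Laplacian

/-- The symbol `sin(t√-Δ)/√-Δ`. -/
def sinSymbol (t : ℝ) (ξ : E3) : ℝ := t * Real.sinc (2 * π * ‖ξ‖ * t)

/-- The symbol `cos(t√-Δ)`. -/
def cosSymbol (t : ℝ) (ξ : E3) : ℝ := Real.cos (2 * π * ‖ξ‖ * t)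

theorem abs_sinSymbol_le (t : ℝ) (ξ : E3) : |sinSymbol t ξ| ≤ |t| := by
  rw [sinSymbol, abs_mul]
  exact mul_le_of_le_one_right (abs_nonneg t) (abs_sinc_le_one _)

theorem abs_cosSymbol_le (t : ℝ) (ξ : E3) : |cosSymbol t ξ| ≤ 1 := abs_cos_le_one _

theorem freq_mul_sinSymbol (t : ℝ) (ξ : E3) :
    (2 * π * ‖ξ‖) * sinSymbol t ξ = Real.sin (2 * π * ‖ξ‖ * t) := by
  rw [sinSymbol]
  rcases eq_or_ne (2 * π * ‖ξ‖ * t) 0 with h | h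
  · simp only [h, sinc_zero, sin_zero]
    linarith
  · rw [sinc_of_ne_zero h, ← mul_assoc, mul_div_cancel₀ _ h]

theorem continuous_sinSymbol (t : ℝ) : Continuous (sinSymbol t) := by
  unfold sinSymbol
  have := continuous_sinc
  fun_prop

theorem continuous_cosSymbol (t : ℝ) : Continuous (cosSymbol t) := by
  unfold cosSymbol
  fun_prop

theorem quadraticGrowth_sinSymbol (t : ℝ) : QuadraticGrowth (sinSymbol t) :=
  ⟨continuous_sinSymbol t, |t|, fun ξ => (abs_sinSymbol_le t ξ).trans
    (le_mul_of_one_le_right (abs_nonneg t) (by nlinarith [norm_nonneg ξ]))⟩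

theorem quadraticGrowth_cosSymbol (t : ℝ) : QuadraticGrowth (cosSymbol t) :=
  ⟨continuous_cosSymbol t, 1, fun ξ => (abs_cosSymbol_le t ξ).trans
    (by nlinarith [norm_nonneg ξ])⟩

theorem quadraticGrowth_sq_mul_sinSymbol (t : ℝ) :
    QuadraticGrowth fun ξ => -(2 * π * ‖ξ‖) ^ 2 * sinSymbol t ξ := by
  refine ⟨by have := continuous_sinSymbol t; fun_prop, (2 * π) ^ 2 * |t|, fun ξ => ?_⟩
  rw [abs_mul, abs_neg, abs_of_nonneg (by positivity), mul_pow, mul_assoc, mul_assoc]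
  refine mul_le_mul_of_nonneg_left ?_ (by positivity)
  nlinarith [mul_le_mul_of_nonneg_left (abs_sinSymbol_le t ξ) (sq_nonneg ‖ξ‖), abs_nonneg t]

theorem hasDerivAt_sinSymbol (ξ : E3) (t : ℝ) :
    HasDerivAt (fun s => sinSymbol s ξ) (cosSymbol t ξ) t := by
  rcases eq_or_ne ‖ξ‖ 0 with h | h
  · simpa [sinSymbol, cosSymbol, h] using hasDerivAt_id' t
  · have h2 : 2 * π * ‖ξ‖ ≠ 0 := by positivity
    have h3 : (fun s => sinSymbol s ξ) = fun s => Real.sin (2 * π * ‖ξ‖ * s) / (2 * π * ‖ξ‖) := by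
      ext s
      rw [eq_div_iff h2, mul_comm, freq_mul_sinSymbol]
    rw [h3]
    have := ((hasDerivAt_id t).const_mul (2 * π * ‖ξ‖)).sin.div_const (2 * π * ‖ξ‖)
    simpa [h2, cosSymbol] using this

theorem hasDerivAt_cosSymbol (ξ : E3) (t : ℝ) :
    HasDerivAt (fun s => cosSymbol s ξ) (-(2 * π * ‖ξ‖) ^ 2 * sinSymbol t ξ) t := by
  have := ((hasDerivAt_id t).const_mul (2 * π * ‖ξ‖)).cos
  convert! this using 1
  rw [neg_mul, sq, mul_assoc, freq_mul_sinSymbol]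
  simp
  ring

/-- First order Taylor bound for a function with Lipschitz derivative. -/
theorem abs_taylor_le {u u' : ℝ → ℝ} {K : ℝ} (hu : ∀ t, HasDerivAt u (u' t) t)
    (hK : ∀ s t, |u' s - u' t| ≤ K * |s - t|) (t h : ℝ) :
    |u (t + h) - u t - h * u' t| ≤ K * h ^ 2 := by
  have hK0 : 0 ≤ K := by
    have := (abs_nonneg _).trans (hK 1 0)
    simpa using this
  have key := (convex_uIcc t (t + h)).norm_image_sub_le_of_norm_hasDerivWithin_le
    (f := fun s => u s - s * u' t) (f' := fun s => u' s - u' t) (C := K * |h|)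
    (x := t) (y := t + h)
    (fun s _ => ((hu s).sub (by simpa using (hasDerivAt_id s).mul_const (u' t))).hasDerivWithinAt)
    (fun s hs => by
      refine (hK s t).trans (mul_le_mul_of_nonneg_left ?_ hK0)
      simpa using abs_sub_left_of_mem_uIcc hs)
    left_mem_uIcc right_mem_uIcc
  simp only [add_sub_cancel_left, Real.norm_eq_abs] at key
  rw [mul_assoc, ← sq, sq_abs] at key
  convert! key using 2
  ring

theorem taylor_sinSymbol (ξ : E3) (t h : ℝ) :
    |sinSymbol (t + h) ξ - sinSymbol t ξ - h * cosSymbol t ξ| ≤ 2 * π * ‖ξ‖ * h ^ 2 := by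
  refine abs_taylor_le (fun t => hasDerivAt_sinSymbol ξ t) (fun s t => ?_) t h
  refine (Real.abs_cos_sub_cos_le _ _).trans (le_of_eq ?_)
  rw [← mul_sub, abs_mul, abs_of_nonneg (by positivity)]

theorem taylor_cosSymbol (ξ : E3) (t h : ℝ) :
    |cosSymbol (t + h) ξ - cosSymbol t ξ - h * (-(2 * π * ‖ξ‖) ^ 2 * sinSymbol t ξ)| ≤
      (2 * π * ‖ξ‖) ^ 2 * h ^ 2 := by
  refine abs_taylor_le (fun t => hasDerivAt_cosSymbol ξ t) (fun s t => ?_) t h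
  have h1 : ∀ s, -(2 * π * ‖ξ‖) ^ 2 * sinSymbol s ξ =
      -(2 * π * ‖ξ‖) * Real.sin (2 * π * ‖ξ‖ * s) := fun s => by
    rw [← freq_mul_sinSymbol]; ring
  have h2 : 0 ≤ 2 * π * ‖ξ‖ := by positivity
  rw [h1, h1, ← mul_sub, abs_mul, abs_neg, abs_of_nonneg h2]
  refine (mul_le_mul_of_nonneg_left (Real.abs_sin_sub_sin_le _ _) h2).trans (le_of_eq ?_)
  rw [← mul_sub, abs_mul, abs_of_nonneg h2]
  ring

/-- `waveSin t f` solves the wave equation with data `(0, f)`. -/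
def waveSin (t : ℝ) (f : E3 → ℝ) : E3 → ℝ := multiplier (sinSymbol t) f

/-- `waveCos t f` solves the wave equation with data `(f, 0)`. -/
def waveCos (t : ℝ) (f : E3 → ℝ) : E3 → ℝ := multiplier (cosSymbol t) f

theorem waveSin_zero (f : E3 → ℝ) : waveSin 0 f = 0 := by
  have : sinSymbol 0 = fun _ => 0 := by ext; simp [sinSymbol]
  rw [waveSin, this, multiplier_zero]

theorem waveCos_zero {f : E3 → ℝ} (hf : IsTestFunction f) : waveCos 0 f = f := by
  have : cosSymbol 0 = fun _ => 1 := by ext; simp [cosSymbol]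
  rw [waveCos, this, multiplier_one hf]

/-- A uniform-in-space bound on a multiplier from a pointwise bound on its symbol. -/
theorem abs_multiplier_le_of_symbol_le {m : E3 → ℝ} {f : E3 → ℝ} (hf : IsTestFunction f) {c : ℝ}
    {n : ℕ} (hm : ∀ ξ, |m ξ| ≤ c * ‖ξ‖ ^ n) (x : E3) :
    |multiplier m f x| ≤ c * ∫ ξ, ‖ξ‖ ^ n * ‖invHat f ξ‖ := by
  refine (QuadraticGrowth.abs_multiplier_le f x).trans ?_
  rw [← integral_const_mul]
  refine integral_mono_of_nonneg (Filter.Eventually.of_forall fun ξ => by positivity)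
    ((hf.integrable_pow_mul_invHat n).const_mul c) (Filter.Eventually.of_forall fun ξ => ?_)
  simp only [← mul_assoc]
  gcongr
  exact hm ξ

theorem abs_waveSin_le {f : E3 → ℝ} (hf : IsTestFunction f) (t : ℝ) (x : E3) :
    |waveSin t f x| ≤ |t| * ∫ ξ, ‖invHat f ξ‖ := by
  simpa [waveSin, waveCos] using abs_multiplier_le_of_symbol_le hf (n := 0) (c := |t|)
    (fun ξ => by simpa using abs_sinSymbol_le t ξ) x

theorem abs_waveCos_le {f : E3 → ℝ} (hf : IsTestFunction f) (t : ℝ) (x : E3) :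
    |waveCos t f x| ≤ ∫ ξ, ‖invHat f ξ‖ := by
  simpa [waveSin, waveCos] using abs_multiplier_le_of_symbol_le hf (n := 0) (c := 1)
    (fun ξ => by simpa using abs_cosSymbol_le t ξ) x

/-- The symbol obeys the Taylor bound with constant 2π|ξ|, and |ξ| times `invHat f` is integrable.
Uniformity in x is what lets pairings with merely locally integrable fields be differentiated in
time. -/
theorem exists_taylor_waveSin {f : E3 → ℝ} (hf : IsTestFunction f) :
    ∃ C, ∀ t h x, |waveSin (t + h) f x - waveSin t f x - h * waveCos t f x| ≤ C * h ^ 2 := by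
  refine ⟨2 * π * ∫ ξ, ‖ξ‖ ^ 1 * ‖invHat f ξ‖, fun t h x => ?_⟩
  have hq : QuadraticGrowth fun ξ => h * cosSymbol t ξ := by
    refine ⟨(continuous_cosSymbol t).const_mul h, |h|, fun ξ => ?_⟩
    rw [abs_mul]
    gcongr
    exact (abs_cosSymbol_le t ξ).trans (by nlinarith [norm_nonneg ξ])
  have hq2 : QuadraticGrowth fun ξ => sinSymbol (t + h) ξ - sinSymbol t ξ := by
    refine ⟨(continuous_sinSymbol _).sub (continuous_sinSymbol t), |t + h| + |t|, fun ξ => ?_⟩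
    refine (abs_sub _ _).trans ?_
    have := abs_sinSymbol_le (t + h) ξ
    have := abs_sinSymbol_le t ξ
    refine le_trans (by linarith) (le_mul_of_one_le_right (by positivity)
      (by nlinarith [norm_nonneg ξ] : 1 ≤ 1 + ‖ξ‖ ^ 2))
  rw [waveSin, waveSin, waveCos, ← multiplier_const_mul, ← multiplier_sub
    (quadraticGrowth_sinSymbol _) (quadraticGrowth_sinSymbol _) hf, ← multiplier_sub hq2 hq hf]
  refine (abs_multiplier_le_of_symbol_le hf (n := 1) (c := 2 * π * h ^ 2) (fun ξ => ?_) x).trans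
    (le_of_eq (by ring))
  exact (taylor_sinSymbol ξ t h).trans (le_of_eq (by ring))

theorem laplacian_waveSin {f : E3 → ℝ} (hf : IsTestFunction f) (t : ℝ) :
    Laplacian.laplacian (waveSin t f) =
      multiplier (fun ξ => -(2 * π * ‖ξ‖) ^ 2 * sinSymbol t ξ) f :=
  (quadraticGrowth_sinSymbol t).laplacian hf

theorem exists_taylor_waveCos {f : E3 → ℝ} (hf : IsTestFunction f) :
    ∃ C, ∀ t h x, |waveCos (t + h) f x - waveCos t f x -
      h * Laplacian.laplacian (waveSin t f) x| ≤ C * h ^ 2 := by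
  refine ⟨(2 * π) ^ 2 * ∫ ξ, ‖ξ‖ ^ 2 * ‖invHat f ξ‖, fun t h x => ?_⟩
  have hq : QuadraticGrowth fun ξ => h * (-(2 * π * ‖ξ‖) ^ 2 * sinSymbol t ξ) := by
    obtain ⟨hc, C, hC⟩ := quadraticGrowth_sq_mul_sinSymbol t
    refine ⟨hc.const_mul h, |h| * C, fun ξ => ?_⟩
    rw [abs_mul]
    exact (mul_le_mul_of_nonneg_left (hC ξ) (abs_nonneg h)).trans_eq (mul_assoc _ _ _).symm
  have hq2 : QuadraticGrowth fun ξ => cosSymbol (t + h) ξ - cosSymbol t ξ := by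
    refine ⟨(continuous_cosSymbol _).sub (continuous_cosSymbol t), 2, fun ξ => ?_⟩
    refine (abs_sub _ _).trans ?_
    have := abs_cosSymbol_le (t + h) ξ
    have := abs_cosSymbol_le t ξ
    nlinarith [norm_nonneg ξ]
  rw [laplacian_waveSin hf, waveCos, waveCos, ← multiplier_const_mul, ← multiplier_sub
    (quadraticGrowth_cosSymbol _) (quadraticGrowth_cosSymbol _) hf, ← multiplier_sub hq2 hq hf]
  refine (abs_multiplier_le_of_symbol_le hf (n := 2) (c := (2 * π) ^ 2 * h ^ 2)
    (fun ξ => ?_) x).trans (le_of_eq (by ring))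
  exact (taylor_cosSymbol ξ t h).trans (le_of_eq (by ring))

/-- Kirchhoff's formula. -/
theorem waveSin_eq_sphere_integral {f : E3 → ℝ} (hf : IsTestFunction f) (t : ℝ) (x : E3) :
    waveSin t f x = t / (4 * π) * ∫ θ, f (x + t • θ.1) ∂sphereMeasure := by
  have hcont := hf.continuous_invHat
  -- Fourier inversion writes f(x + tθ) as a superposition of plane waves in θ. After Fubini each
  -- one is averaged over the sphere to 4π sinc(2π|ξ|t), which is the symbol of `waveSin` up to
  -- t/(4π).
  have h1 : ∀ θ : Metric.sphere (0 : E3) 1, ((f (x + t • θ.1) : ℝ) : ℂ) =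
      ∫ ξ, Complex.exp (((inner ℝ (-(2 * π * t) • ξ) θ.1 : ℝ) : ℂ) * Complex.I) *
        (𝐞 (-inner ℝ ξ x) • invHat f ξ) := by
    intro θ
    rw [← congrFun hf.fourier_invHat, Real.fourier_eq]
    refine integral_congr_ae (Filter.Eventually.of_forall fun ξ => ?_)
    simp only [Circle.smul_def, smul_eq_mul, Real.fourierChar_apply, ← mul_assoc, ← Complex.exp_add]
    congr 2
    rw [inner_add_right, inner_smul_right, inner_smul_left]
    simp
    ring
  have h2 : ∫ θ, ((f (x + t • θ.1) : ℝ) : ℂ) ∂sphereMeasure =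
      ∫ ξ, ∫ θ, Complex.exp (((inner ℝ (-(2 * π * t) • ξ) θ.1 : ℝ) : ℂ) * Complex.I) *
        (𝐞 (-inner ℝ ξ x) • invHat f ξ) ∂sphereMeasure := by
    simp only [h1]
    rw [integral_integral_swap]
    have hi : Integrable (fun z : Metric.sphere (0 : E3) 1 × E3 => (1 : ℂ) * invHat f z.2)
        (sphereMeasure.prod volume) := Integrable.mul_prod (integrable_const 1) hf.integrable_invHat
    refine hi.mono ?_ (Filter.Eventually.of_forall fun z => ?_)
    · refine Continuous.aestronglyMeasurable ?_
      simp only [Function.uncurry_def, Circle.smul_def, Real.fourierChar_apply, smul_eq_mul]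
      fun_prop
    · simp only [Function.uncurry_def, norm_mul, Complex.norm_exp_ofReal_mul_I, Circle.norm_smul,
        norm_one, le_refl]
  simp only [integral_mul_const, integral_sphere_cexp] at h2
  rw [integral_complex_ofReal] at h2
  have h3 : ((∫ θ, f (x + t • θ.1) ∂sphereMeasure : ℝ) : ℂ) * ((t / (4 * π) : ℝ) : ℂ) =
      𝓕 (fun ξ => (sinSymbol t ξ : ℂ) * invHat f ξ) x := by
    rw [h2, ← integral_mul_const, Real.fourier_eq]
    refine integral_congr_ae (Filter.Eventually.of_forall fun ξ => ?_)
    have h4 : Real.sinc ‖-(2 * π * t) • ξ‖ = Real.sinc (2 * π * ‖ξ‖ * t) := by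
      rw [norm_smul, norm_neg, Real.norm_eq_abs]
      rcases abs_choice (2 * π * t) with h | h
      · rw [h]; congr 1; ring
      · rw [h, ← sinc_neg]; congr 1; ring
    simp only [h4, sinSymbol, Circle.smul_def, smul_eq_mul]
    push_cast
    field_simp
  rw [waveSin, multiplier, ← h3, ← Complex.ofReal_mul, Complex.ofReal_re, mul_comm]

/-- The strong Huygens principle for data `(0, f)`. -/
theorem waveSin_eq_zero {f : E3 → ℝ} (hf : IsTestFunction f) {R : ℝ}
    (hR : ∀ x, R < ‖x‖ → f x = 0) {t : ℝ} {x : E3} (h : R < |‖x‖ - (|t|)|) :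
    waveSin t f x = 0 := by
  rw [waveSin_eq_sphere_integral hf]
  have : ∀ θ : Metric.sphere (0 : E3) 1, f (x + t • θ.1) = 0 := by
    intro θ
    refine hR _ (h.trans_le ?_)
    have h1 := abs_norm_sub_norm_le x (-(t • θ.1))
    simpa [norm_smul, norm_eq_of_mem_sphere] using h1
  simp [this]

theorem hasDerivAt_of_taylor {u : ℝ → ℝ} {t u' C : ℝ}
    (h : ∀ s, |u (t + s) - u t - s * u'| ≤ C * s ^ 2) : HasDerivAt u u' t := by
  rw [hasDerivAt_iff_isLittleO_nhds_zero]
  refine Asymptotics.IsBigO.trans_isLittleO (g := fun s : ℝ => s ^ 2)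
    (Asymptotics.IsBigO.of_bound C (Filter.Eventually.of_forall fun s => ?_)) ?_
  · simpa using h s
  · exact Asymptotics.isLittleO_pow_id one_lt_two

theorem hasDerivAt_waveSin {f : E3 → ℝ} (hf : IsTestFunction f) (t : ℝ) (x : E3) :
    HasDerivAt (fun s => waveSin s f x) (waveCos t f x) t := by
  obtain ⟨C, hC⟩ := exists_taylor_waveSin hf
  exact hasDerivAt_of_taylor fun s => hC t s x

/-- The strong Huygens principle for data `(f, 0)`. -/
theorem waveCos_eq_zero {f : E3 → ℝ} (hf : IsTestFunction f) {R : ℝ}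
    (hR : ∀ x, R < ‖x‖ → f x = 0) {t : ℝ} {x : E3} (h : R < |‖x‖ - (|t|)|) :
    waveCos t f x = 0 := by
  -- The condition is open in time, so `waveSin` vanishes at x for all times near t, and so does its
  -- time derivative `waveCos`.
  have h1 : ∀ᶠ s in 𝓝 t, R < |‖x‖ - (|s|)| :=
    (by fun_prop : Continuous fun s : ℝ => |‖x‖ - (|s|)|).continuousAt.tendsto.eventually_const_lt h
  have h2 : (fun s => waveSin s f x) =ᶠ[𝓝 t] fun _ => 0 := by
    filter_upwards [h1] with s hs using waveSin_eq_zero hf hR hs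
  exact (hasDerivAt_waveSin hf t x).unique ((hasDerivAt_const t 0).congr_of_eventuallyEq h2)

theorem hasCompactSupport_of_forall_norm {g : E3 → ℝ} {R : ℝ} (h : ∀ x, R < ‖x‖ → g x = 0) :
    HasCompactSupport g := by
  refine HasCompactSupport.intro (isCompact_closedBall (0 : E3) R) fun x hx => h x ?_
  simpa using hx

/-- Smoothness comes from the multiplier, compact support from finite propagation speed. Propagated
test functions can thus be inserted in the weak form of the field equations. -/
theorem isTestFunction_waveSin {f : E3 → ℝ} (hf : IsTestFunction f) {R : ℝ}
    (hR : ∀ x, R < ‖x‖ → f x = 0) (t : ℝ) : IsTestFunction (waveSin t f) :=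
  ⟨(quadraticGrowth_sinSymbol t).contDiff hf,
    hasCompactSupport_of_forall_norm (R := R + |t|) fun _ hx =>
      waveSin_eq_zero hf hR ((lt_sub_iff_add_lt.2 hx).trans_le (le_abs_self _))⟩

theorem isTestFunction_waveCos {f : E3 → ℝ} (hf : IsTestFunction f) {R : ℝ}
    (hR : ∀ x, R < ‖x‖ → f x = 0) (t : ℝ) : IsTestFunction (waveCos t f) :=
  ⟨(quadraticGrowth_cosSymbol t).contDiff hf,
    hasCompactSupport_of_forall_norm (R := R + |t|) fun _ hx =>
      waveCos_eq_zero hf hR ((lt_sub_iff_add_lt.2 hx).trans_le (le_abs_self _))⟩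

end

/-! ### Local energy bounds and time-dependent pairings -/

section

open Set Real FourierTransform Laplacian Filter

theorem MemL2Loc.integrableOn_ball {F : Type} [NormedAddCommGroup F] {f : E3 → F}
    (hf : MemL2Loc f) (A : ℝ) : IntegrableOn f (Metric.ball 0 A) := by
  have : IsFiniteMeasure (volume.restrict (Metric.ball (0 : E3) A)) :=
    ⟨by simpa using (measure_ball_lt_top (μ := (volume : Measure E3)) (x := 0) (r := A))⟩
  exact (hf A).integrable (by norm_num)

theorem MemL2Loc.integrable_mul {f g : E3 → ℝ} (hf : MemL2Loc f) (hg : Continuous g)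
    (hg' : HasCompactSupport g) : Integrable fun x => f x * g x :=
  hf.locallyIntegrable.integrable_smul_right_of_hasCompactSupport hg hg'

/-- Cauchy–Schwarz, in the form that the variance of |f| over the ball, the integral of (|f| -
I/V)², is nonnegative. -/
theorem MemL2Loc.sq_integral_abs_le {f : E3 → ℝ} (hf : MemL2Loc f) {A : ℝ} (hA : 0 < A) :
    (∫ x in Metric.ball 0 A, |f x|) ^ 2 ≤
      volume.real (Metric.ball (0 : E3) A) * ∫ x in Metric.ball 0 A, f x ^ 2 := by
  have hfin : IsFiniteMeasure (volume.restrict (Metric.ball (0 : E3) A)) :=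
    ⟨by simpa using (measure_ball_lt_top (μ := (volume : Measure E3)) (x := 0) (r := A))⟩
  set V := volume.real (Metric.ball (0 : E3) A) with hV
  have hV0 : 0 < V := ENNReal.toReal_pos (Metric.measure_ball_pos _ _ hA).ne'
    measure_ball_lt_top.ne
  have h1 : Integrable (fun x => |f x|) (volume.restrict (Metric.ball 0 A)) :=
    (hf.integrableOn_ball A).abs
  have h2 : Integrable (fun x => f x ^ 2) (volume.restrict (Metric.ball 0 A)) :=
    (hf A).integrable_sq
  set I := ∫ x in Metric.ball 0 A, |f x| with hI
  have h3 : 0 ≤ ∫ x in Metric.ball 0 A, (f x ^ 2 - 2 * (I / V) * |f x| + (I / V) ^ 2) := by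
    refine integral_nonneg fun x => ?_
    have : f x ^ 2 - 2 * (I / V) * |f x| + (I / V) ^ 2 = (|f x| - I / V) ^ 2 := by
      rw [← sq_abs (f x)]; ring
    simp only [Pi.zero_apply, this]
    positivity
  have h6 : Integrable (fun x => f x ^ 2 - 2 * (I / V) * |f x|)
      (volume.restrict (Metric.ball 0 A)) := h2.sub (h1.const_mul _)
  rw [integral_add h6 (integrable_const _), integral_sub h2 (h1.const_mul _), integral_const_mul, ← hI, setIntegral_const, ← hV] at h3
  have h4 : V • (I / V) ^ 2 = I ^ 2 / V := by rw [smul_eq_mul]; field_simp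
  rw [h4] at h3
  have h5 : I ^ 2 / V ≤ ∫ x in Metric.ball 0 A, f x ^ 2 := by
    have : 2 * (I / V) * I = 2 * (I ^ 2 / V) := by ring
    linarith
  rw [div_le_iff₀ hV0] at h5
  linarith

theorem State.integrand_integrable {d : ℕ} (Y : State d) (A : ℝ) (n : Fin d) :
    Integrable (fun x => (Y.φ n x) ^ 2 + ‖Y.gradφ n x‖ ^ 2 + (Y.π n x) ^ 2)
      (volume.restrict (Metric.ball 0 A)) :=
  ((Y.φ_mem n A).integrable_sq.add ((Y.gradφ_mem n A).integrable_norm_pow (by norm_num))).add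
    (Y.π_mem n A).integrable_sq

theorem State.seminorm_sq {d : ℕ} (Y : State d) (A : ℝ) :
    Y.seminorm A ^ 2 = (∑ n, ∫ x in Metric.ball (0 : E3) A,
      ((Y.φ n x) ^ 2 + ‖Y.gradφ n x‖ ^ 2 + (Y.π n x) ^ 2)) + ‖Y.q‖ ^ 2 + ‖Y.p‖ ^ 2 := by
  refine Real.sq_sqrt ?_
  have : 0 ≤ ∑ n, ∫ x in Metric.ball (0 : E3) A,
      ((Y.φ n x) ^ 2 + ‖Y.gradφ n x‖ ^ 2 + (Y.π n x) ^ 2) :=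
    Finset.sum_nonneg fun n _ => integral_nonneg fun x => by positivity
  positivity

theorem State.seminorm_nonneg {d : ℕ} (Y : State d) (A : ℝ) : 0 ≤ Y.seminorm A := sqrt_nonneg _

theorem State.integral_le_seminorm_sq {d : ℕ} (Y : State d) (A : ℝ) (n : Fin d) :
    ∫ x in Metric.ball (0 : E3) A, ((Y.φ n x) ^ 2 + ‖Y.gradφ n x‖ ^ 2 + (Y.π n x) ^ 2) ≤
      Y.seminorm A ^ 2 := by
  rw [Y.seminorm_sq]
  have := Finset.single_le_sum (f := fun n => ∫ x in Metric.ball (0 : E3) A,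
      ((Y.φ n x) ^ 2 + ‖Y.gradφ n x‖ ^ 2 + (Y.π n x) ^ 2))
    (fun n _ => integral_nonneg fun x => by positivity) (Finset.mem_univ n)
  have h1 := sq_nonneg ‖Y.q‖
  have h2 := sq_nonneg ‖Y.p‖
  linarith

theorem State.norm_q_le {d : ℕ} (Y : State d) (A : ℝ) : ‖Y.q‖ ≤ Y.seminorm A := by
  refine abs_le_of_sq_le_sq' ?_ (Y.seminorm_nonneg A) |>.2
  rw [Y.seminorm_sq]
  have : 0 ≤ ∑ n, ∫ x in Metric.ball (0 : E3) A,
      ((Y.φ n x) ^ 2 + ‖Y.gradφ n x‖ ^ 2 + (Y.π n x) ^ 2) :=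
    Finset.sum_nonneg fun n _ => integral_nonneg fun x => by positivity
  nlinarith [sq_nonneg ‖Y.p‖]

theorem State.norm_p_le {d : ℕ} (Y : State d) (A : ℝ) : ‖Y.p‖ ≤ Y.seminorm A := by
  refine abs_le_of_sq_le_sq' ?_ (Y.seminorm_nonneg A) |>.2
  rw [Y.seminorm_sq]
  have : 0 ≤ ∑ n, ∫ x in Metric.ball (0 : E3) A,
      ((Y.φ n x) ^ 2 + ‖Y.gradφ n x‖ ^ 2 + (Y.π n x) ^ 2) :=
    Finset.sum_nonneg fun n _ => integral_nonneg fun x => by positivity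
  nlinarith [sq_nonneg ‖Y.q‖]

theorem State.integral_abs_φ_le {d : ℕ} (Y : State d) {A : ℝ} (hA : 0 < A) (n : Fin d) :
    ∫ x in Metric.ball (0 : E3) A, |Y.φ n x| ≤
      √(volume.real (Metric.ball (0 : E3) A)) * Y.seminorm A := by
  refine abs_le_of_sq_le_sq' ?_ (mul_nonneg (sqrt_nonneg _) (Y.seminorm_nonneg A)) |>.2
  rw [mul_pow, Real.sq_sqrt measureReal_nonneg]
  refine ((Y.φ_mem n).sq_integral_abs_le hA).trans
    (mul_le_mul_of_nonneg_left ?_ measureReal_nonneg)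
  refine (integral_mono (Y.φ_mem n A).integrable_sq (Y.integrand_integrable A n)
    fun x => ?_).trans (Y.integral_le_seminorm_sq A n)
  simp only
  nlinarith [sq_nonneg ‖Y.gradφ n x‖, sq_nonneg (Y.π n x)]

theorem State.integral_abs_π_le {d : ℕ} (Y : State d) {A : ℝ} (hA : 0 < A) (n : Fin d) :
    ∫ x in Metric.ball (0 : E3) A, |Y.π n x| ≤
      √(volume.real (Metric.ball (0 : E3) A)) * Y.seminorm A := by
  refine abs_le_of_sq_le_sq' ?_ (mul_nonneg (sqrt_nonneg _) (Y.seminorm_nonneg A)) |>.2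
  rw [mul_pow, Real.sq_sqrt measureReal_nonneg]
  refine ((Y.π_mem n).sq_integral_abs_le hA).trans
    (mul_le_mul_of_nonneg_left ?_ measureReal_nonneg)
  refine (integral_mono (Y.π_mem n A).integrable_sq (Y.integrand_integrable A n)
    fun x => ?_).trans (Y.integral_le_seminorm_sq A n)
  simp only
  nlinarith [sq_nonneg ‖Y.gradφ n x‖, sq_nonneg (Y.φ n x)]

/-- The energy seminorm of a ball controls the L¹ norm there, and L¹ is the topology in which fields
are paired with bounded test functions. -/
theorem ContinuousInEnergy.tendsto_φ {d : ℕ} {Y : ℝ → State d} (hY : ContinuousInEnergy Y)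
    (n : Fin d) {A : ℝ} (hA : 0 < A) (s : ℝ) :
    Tendsto (fun t => ∫ x in Metric.ball (0 : E3) A, |(Y t).φ n x - (Y s).φ n x|) (𝓝 s) (𝓝 0) := by
  refine squeeze_zero (fun t => integral_nonneg fun x => abs_nonneg _)
    (fun t => (Y t - Y s).integral_abs_φ_le hA n) ?_
  simpa using (hY A hA s).const_mul (√(volume.real (Metric.ball (0 : E3) A)))

theorem ContinuousInEnergy.tendsto_π {d : ℕ} {Y : ℝ → State d} (hY : ContinuousInEnergy Y)
    (n : Fin d) {A : ℝ} (hA : 0 < A) (s : ℝ) :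
    Tendsto (fun t => ∫ x in Metric.ball (0 : E3) A, |(Y t).π n x - (Y s).π n x|) (𝓝 s) (𝓝 0) := by
  refine squeeze_zero (fun t => integral_nonneg fun x => abs_nonneg _)
    (fun t => (Y t - Y s).integral_abs_π_le hA n) ?_
  simpa using (hY A hA s).const_mul (√(volume.real (Metric.ball (0 : E3) A)))

/-- Hölder bound `L¹–L^∞` for a function supported in a ball. -/
theorem abs_integral_mul_le {f g : E3 → ℝ} {A M : ℝ} (hf : IntegrableOn f (Metric.ball 0 A))
    (hg : ∀ x, |g x| ≤ M) (hsupp : ∀ x, A ≤ ‖x‖ → f x * g x = 0) :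
    |∫ x, f x * g x| ≤ M * ∫ x in Metric.ball 0 A, |f x| := by
  have h1 : ∫ x, f x * g x = ∫ x in Metric.ball 0 A, f x * g x := by
    rw [setIntegral_eq_integral_of_forall_compl_eq_zero]
    intro x hx
    exact hsupp x (by simpa using hx)
  rw [h1, ← integral_const_mul]
  refine (norm_integral_le_integral_norm _).trans
    (integral_mono_of_nonneg (Eventually.of_forall fun x => norm_nonneg (f x * g x))
      (hf.abs.const_mul M) (Eventually.of_forall fun x => ?_))
  simp only [norm_mul, Real.norm_eq_abs]
  rw [mul_comm]
  gcongr
  exact hg x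

/-- Product rule for the pairing of a locally integrable function with a test function, both
depending on time. -/
theorem hasDerivAt_pairing {u : ℝ → E3 → ℝ} (hu : ∀ s, MemL2Loc (u s)) {s₀ A C a : ℝ}
    (hcont : Tendsto (fun s => ∫ x in Metric.ball (0 : E3) A, |u s x - u s₀ x|) (𝓝 s₀) (𝓝 0))
    {χ : ℝ → E3 → ℝ} {χ' : E3 → ℝ} (hχ : ∀ s, IsTestFunction (χ s)) (hχ' : Continuous χ')
    (hsupp : ∀ᶠ s in 𝓝 s₀, ∀ x, A ≤ ‖x‖ → χ s x = 0) (hsupp' : ∀ x, A ≤ ‖x‖ → χ' x = 0)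
    (htaylor : ∀ s x, |χ s x - χ s₀ x - (s - s₀) * χ' x| ≤ C * (s - s₀) ^ 2)
    (hd : HasDerivAt (fun s => ∫ x, u s x * χ s₀ x) a s₀) :
    HasDerivAt (fun s => ∫ x, u s x * χ s x) (a + ∫ x, u s₀ x * χ' x) s₀ := by
  have hcs' : HasCompactSupport χ' :=
    hasCompactSupport_of_forall_norm fun x hx => hsupp' x hx.le
  obtain ⟨M, hM⟩ := hχ'.bounded_above_of_compact_support hcs'
  have hsupp0 := hsupp.self_of_nhds
  set N : ℝ → ℝ := fun s => ∫ x in Metric.ball (0 : E3) A, |u s x - u s₀ x| with hN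
  set N₀ : ℝ := ∫ x in Metric.ball (0 : E3) A, |u s₀ x| with hN₀
  have hNs : ∀ s, ∫ x in Metric.ball (0 : E3) A, |u s x| ≤ N s + N₀ := by
    intro s
    have j1 : Integrable (fun x => |u s x - u s₀ x|) (volume.restrict (Metric.ball 0 A)) :=
      (((hu s).integrableOn_ball A).sub ((hu s₀).integrableOn_ball A)).abs
    have j2 : Integrable (fun x => |u s₀ x|) (volume.restrict (Metric.ball 0 A)) :=
      ((hu s₀).integrableOn_ball A).abs
    simp only [hN, hN₀]
    rw [← integral_add j1 j2]
    refine integral_mono ((hu s).integrableOn_ball A).abs (j1.add j2) fun x => ?_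
    simpa using abs_add_le (u s x - u s₀ x) (u s₀ x)
  have i0 : ∀ s, Integrable fun x => u s x * (χ s x - χ s₀ x) := fun s =>
    (hu s).integrable_mul ((hχ s).continuous.sub (hχ s₀).continuous) ((hχ s).2.sub (hχ s₀).2)
  have hsplit : (fun s => ∫ x, u s x * χ s x) =
      (fun s => ∫ x, u s x * χ s₀ x) + fun s => ∫ x, u s x * (χ s x - χ s₀ x) := by
    ext s
    simp only [Pi.add_apply]
    rw [← integral_add ((hu s).integrable_mul (hχ s₀).continuous (hχ s₀).2) (i0 s)]
    congr 1
    ext x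
    ring
  rw [hsplit]
  refine hd.add ?_
  rw [hasDerivAt_iff_isLittleO, Asymptotics.isLittleO_iff]
  intro c hc
  have hε : Tendsto (fun s => M * N s + C * |s - s₀| * (N s + N₀)) (𝓝 s₀) (𝓝 0) := by
    have h1 : Tendsto (fun s => C * |s - s₀|) (𝓝 s₀) (𝓝 0) := by
      have : Continuous fun s => C * |s - s₀| := by fun_prop
      simpa using this.tendsto s₀
    have := (hcont.const_mul M).add (h1.mul (hcont.add_const N₀))
    simpa using this
  filter_upwards [hε.eventually_le_const hc, hsupp] with s hs hss
  have hC0 : 0 ≤ C * (s - s₀) ^ 2 := (abs_nonneg _).trans (htaylor s 0)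
  have i2 := (hu s).integrable_mul hχ' hcs'
  have i3 := (hu s₀).integrable_mul hχ' hcs'
  -- The error splits into the L¹ variation of u against χ' and the Taylor remainder of χ against
  -- u(s). Both are o(s - s₀), the first by continuity of u in L¹ of the ball, the second being
  -- quadratic.
  have key : (∫ x, u s x * (χ s x - χ s₀ x)) - (s - s₀) * ∫ x, u s₀ x * χ' x =
      (s - s₀) * (∫ x, (u s x - u s₀ x) * χ' x) +
        ∫ x, u s x * (χ s x - χ s₀ x - (s - s₀) * χ' x) := by
    have e1 : ∫ x, (u s x - u s₀ x) * χ' x = (∫ x, u s x * χ' x) - ∫ x, u s₀ x * χ' x := by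
      rw [← integral_sub i2 i3]
      congr 1; ext x; ring
    have e2 : ∫ x, u s x * (χ s x - χ s₀ x - (s - s₀) * χ' x) =
        (∫ x, u s x * (χ s x - χ s₀ x)) - (s - s₀) * ∫ x, u s x * χ' x := by
      rw [← integral_const_mul, ← integral_sub (i0 s) (i2.const_mul _)]
      congr 1; ext x; ring
    rw [e1, e2]; ring
  have b1 : |∫ x, (u s x - u s₀ x) * χ' x| ≤ M * N s :=
    abs_integral_mul_le (((hu s).integrableOn_ball A).sub ((hu s₀).integrableOn_ball A)) hM
      fun x hx => by rw [hsupp' x hx, mul_zero]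
  have b2 : |∫ x, u s x * (χ s x - χ s₀ x - (s - s₀) * χ' x)| ≤ C * (s - s₀) ^ 2 * (N s + N₀) := by
    refine (abs_integral_mul_le ((hu s).integrableOn_ball A) (htaylor s)
      fun x hx => by rw [hsupp' x hx, hss x hx, hsupp0 x hx]; ring).trans ?_
    exact mul_le_mul_of_nonneg_left (hNs s) hC0
  simp only [sub_self, mul_zero, integral_zero, sub_zero, smul_eq_mul, key, Real.norm_eq_abs]
  calc _ ≤ |s - s₀| * (M * N s) + C * (s - s₀) ^ 2 * (N s + N₀) := by
        refine (abs_add_le _ _).trans (add_le_add ?_ b2)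
        rw [abs_mul]
        gcongr
    _ = (M * N s + C * |s - s₀| * (N s + N₀)) * |s - s₀| := by
        rw [← sq_abs (s - s₀)]; ring
    _ ≤ c * |s - s₀| := by gcongr

end

/-! ### Memory kernel and Duhamel's formula -/

section

open Set Real FourierTransform Laplacian Filter

/-- The `i`-th partial derivative. -/
def partialDeriv (i : Fin 3) (f : E3 → ℝ) (x : E3) : ℝ := gradient f x i

theorem partialDeriv_eq_fderiv (i : Fin 3) (f : E3 → ℝ) (x : E3) :
    partialDeriv i f x = fderiv ℝ f x (EuclideanSpace.single i 1) := by
  rw [partialDeriv, gradient, ← InnerProductSpace.toDual_symm_apply (𝕜 := ℝ),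
    EuclideanSpace.inner_single_right]
  simp

theorem IsTestFunction.partialDeriv {f : E3 → ℝ} (hf : IsTestFunction f) (i : Fin 3) :
    IsTestFunction (partialDeriv i f) := by
  have h : FieldParticle.partialDeriv i f = fun x => fderiv ℝ f x (EuclideanSpace.single i 1) :=
    funext (partialDeriv_eq_fderiv i f)
  rw [h]
  refine ⟨(hf.1.fderiv_right (m := ((⊤ : ℕ∞) : WithTop ℕ∞)) (by simp)).clm_apply contDiff_const, ?_⟩
  exact (hf.2.fderiv (𝕜 := ℝ)).comp_left
    (g := fun L : E3 →L[ℝ] ℝ => L (EuclideanSpace.single i 1)) (by simp)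

theorem partialDeriv_eq_zero {f : E3 → ℝ} {R : ℝ} (hR : ∀ x, R < ‖x‖ → f x = 0) (i : Fin 3) (x : E3)
    (hx : R < ‖x‖) : partialDeriv i f x = 0 := by
  have : f =ᶠ[𝓝 x] fun _ => 0 := by
    filter_upwards [continuous_norm.continuousAt.eventually_const_lt hx] with y hy using hR y hy
  rw [partialDeriv_eq_fderiv, this.fderiv_eq]
  simp

/-- The response at time `t` of the observable `g` to an impulse `f` given to the free field. -/
def memoryKernel (g f : E3 → ℝ) (t : ℝ) : ℝ := ∫ x, g x * waveSin t f x

/-- By Huygens' principle an impulse emitted in the ball of radius R has left that ball once |t| >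
2R. This gives the delay equation its finite memory. -/
theorem memoryKernel_eq_zero {f g : E3 → ℝ} (hf : IsTestFunction f) {R : ℝ}
    (hRf : ∀ x, R < ‖x‖ → f x = 0) (hRg : ∀ x, R < ‖x‖ → g x = 0) {t : ℝ} (ht : 2 * R < |t|) :
    memoryKernel g f t = 0 := by
  refine integral_eq_zero_of_ae (Eventually.of_forall fun x => ?_)
  rcases lt_or_ge R ‖x‖ with h | h
  · simp [hRg x h]
  · have : waveSin t f x = 0 := waveSin_eq_zero hf hRf (by
      rw [abs_sub_comm]
      exact lt_of_lt_of_le (by linarith) (le_abs_self _))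
    simp [this]

theorem memoryKernel_zero (g f : E3 → ℝ) : memoryKernel g f 0 = 0 := by
  simp [memoryKernel, waveSin_zero]

theorem differentiable_memoryKernel {f g : E3 → ℝ} (hf : IsTestFunction f) {R : ℝ}
    (hRf : ∀ x, R < ‖x‖ → f x = 0) (hg : IsTestFunction g) :
    Differentiable ℝ (memoryKernel g f) := by
  intro t
  obtain ⟨C, hC⟩ := exists_taylor_waveSin hf
  have hW := fun t => isTestFunction_waveSin hf hRf t
  have hV := isTestFunction_waveCos hf hRf t
  have i1 : ∀ s, Integrable fun x => g x * waveSin s f x := fun s =>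
    (hg.continuous.mul (hW s).continuous).integrable_of_hasCompactSupport hg.2.mul_right
  have i2 : Integrable fun x => g x * waveCos t f x :=
    (hg.continuous.mul hV.continuous).integrable_of_hasCompactSupport hg.2.mul_right
  refine (hasDerivAt_of_taylor (u' := ∫ x, g x * waveCos t f x) (C := C * ∫ x, |g x|)
    fun s => ?_).differentiableAt
  have : memoryKernel g f (t + s) - memoryKernel g f t - s * ∫ x, g x * waveCos t f x =
      ∫ x, g x * (waveSin (t + s) f x - waveSin t f x - s * waveCos t f x) := by
    have i3 : Integrable fun x => g x * waveSin (t + s) f x - g x * waveSin t f x :=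
      (i1 _).sub (i1 _)
    rw [memoryKernel, memoryKernel, ← integral_const_mul, ← integral_sub (i1 _) (i1 _),
      ← integral_sub i3 (i2.const_mul s)]
    congr 1; ext x; ring
  rw [this, mul_right_comm, ← integral_const_mul]
  refine (norm_integral_le_integral_norm _).trans (integral_mono_of_nonneg
    (Eventually.of_forall fun x => norm_nonneg (g x *
      (waveSin (t + s) f x - waveSin t f x - s * waveCos t f x)))
    (hg.integrable.abs.const_mul _) (Eventually.of_forall fun x => ?_))
  simp only [norm_mul, Real.norm_eq_abs]
  rw [mul_comm]
  gcongr
  exact hC t s x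

theorem inner_gradient_eq_sum (q : E3) (f : E3 → ℝ) (x : E3) :
    inner ℝ q (gradient f x) = ∑ j, q j * partialDeriv j f x := by
  rw [PiLp.inner_apply]
  simp [partialDeriv, mul_comm]

section Duhamel

variable {d : ℕ} {ω : ℝ} {ρ : Fin d → E3 → ℝ} {Y₀ : State d} {Y : ℝ → State d}

/-- The solution is paired with the free wave running backward from f at time T. Being adjoint to
each other, the two free evolutions cancel in the derivative and only the source q·∇ρₙ survives. -/
theorem IsSolution.hasDerivAt_energyPairing (hY : IsSolution ω ρ Y₀ Y)
    (n : Fin d) {f : E3 → ℝ} (hf : IsTestFunction f) {R : ℝ} (hR : ∀ x, R < ‖x‖ → f x = 0)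
    (T s : ℝ) :
    HasDerivAt (fun s => (∫ x, (Y s).φ n x * waveCos (T - s) f x) +
        ∫ x, (Y s).π n x * waveSin (T - s) f x)
      (-∫ x, inner ℝ (Y s).q (gradient (ρ n) x) * waveSin (T - s) f x) s := by
  have hW := fun t => isTestFunction_waveSin hf hR t
  have hV := fun t => isTestFunction_waveCos hf hR t
  -- A single ball containing the supports of the propagated test functions for all times near s;
  -- the 1 is the room left for s to vary.
  set A : ℝ := |R| + |T - s| + 1 with hA
  have hA0 : 0 < A := by positivity
  have hnear : ∀ᶠ s' in 𝓝 s, |T - s'| < |T - s| + 1 :=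
    (by fun_prop : Continuous fun s' : ℝ => |T - s'|).continuousAt.eventually_lt_const
      (lt_add_one _)
  have hsuppW : ∀ t, |t| < |T - s| + 1 → ∀ x, A ≤ ‖x‖ → waveSin t f x = 0 := by
    intro t ht x hx
    refine waveSin_eq_zero hf hR (lt_of_lt_of_le ?_ (le_abs_self _))
    have := le_abs_self R
    linarith
  have hsuppV : ∀ t, |t| < |T - s| + 1 → ∀ x, A ≤ ‖x‖ → waveCos t f x = 0 := by
    intro t ht x hx
    refine waveCos_eq_zero hf hR (lt_of_lt_of_le ?_ (le_abs_self _))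
    have := le_abs_self R
    linarith
  have hLap : Continuous (Laplacian.laplacian (waveSin (T - s) f)) := by
    rw [laplacian_waveSin hf]
    exact ((quadraticGrowth_sq_mul_sinSymbol (T - s)).contDiff hf).continuous
  have hLapsupp : ∀ x, A ≤ ‖x‖ → Laplacian.laplacian (waveSin (T - s) f) x = 0 := by
    intro x hx
    have h1 : ∀ᶠ y in 𝓝 x, |R| + |T - s| < ‖y‖ :=
      continuous_norm.continuousAt.eventually_const_lt (by linarith)
    have : waveSin (T - s) f =ᶠ[𝓝 x] fun _ => (0 : ℝ) := by
      filter_upwards [h1] with y hy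
      refine waveSin_eq_zero hf hR (lt_of_lt_of_le ?_ (le_abs_self _))
      have := le_abs_self R
      linarith
    rw [(InnerProductSpace.laplacian_congr_nhds this).self_of_nhds]
    simp
  obtain ⟨C₁, hC₁⟩ := exists_taylor_waveCos hf
  obtain ⟨C₂, hC₂⟩ := exists_taylor_waveSin hf
  have d1 := hasDerivAt_pairing (u := fun s => (Y s).φ n) (fun s => (Y s).φ_mem n)
    (hY.continuous.tendsto_φ n hA0 s) (χ := fun s => waveCos (T - s) f)
    (χ' := fun x => -Laplacian.laplacian (waveSin (T - s) f) x) (C := C₁)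
    (fun s => hV _) hLap.neg (hnear.mono fun s' hs' => hsuppV _ hs')
    (fun x hx => by rw [hLapsupp x hx, neg_zero])
    (fun s' x => by
      have := hC₁ (T - s) (s - s') x
      rw [show T - s + (s - s') = T - s' by ring] at this
      convert! this using 1
      · congr 1; ring
      · ring)
    (hY.field n _ (hV _) s)
  have d2 := hasDerivAt_pairing (u := fun s => (Y s).π n) (fun s => (Y s).π_mem n)
    (hY.continuous.tendsto_π n hA0 s) (χ := fun s => waveSin (T - s) f)
    (χ' := fun x => -waveCos (T - s) f x) (C := C₂)
    (fun s => hW _) (hV _).continuous.neg (hnear.mono fun s' hs' => hsuppW _ hs')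
    (fun x hx => by rw [hsuppV _ (lt_add_one _) x hx, neg_zero])
    (fun s' x => by
      have := hC₂ (T - s) (s - s') x
      rw [show T - s + (s - s') = T - s' by ring] at this
      convert! this using 1
      · congr 1; ring
      · ring)
    (hY.momentum n _ (hW _) s)
  convert! d1.add d2 using 1
  simp only [mul_neg, integral_neg]
  ring

theorem integral_inner_gradient_mul_waveSin {g f : E3 → ℝ} (hg : IsTestFunction g)
    (hf : IsTestFunction f) (q : E3) (t : ℝ) :
    ∫ x, inner ℝ q (gradient g x) * waveSin t f x =
      ∑ j, q j * memoryKernel (partialDeriv j g) f t := by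
  have hW := ((quadraticGrowth_sinSymbol t).contDiff hf).continuous
  simp only [inner_gradient_eq_sum, Finset.sum_mul, mul_assoc]
  rw [integral_finsetSum]
  · simp only [integral_const_mul, memoryKernel, waveSin]
  · intro j _
    refine Integrable.const_mul ?_ _
    exact ((hg.partialDeriv j).continuous.mul hW).integrable_of_hasCompactSupport
      (hg.partialDeriv j).2.mul_right

/-- Duhamel's formula for the field tested against `f`. -/
theorem IsSolution.integral_φ_mul_eq (hY : IsSolution ω ρ Y₀ Y)
    (hρ : ∀ n, IsTestFunction (ρ n)) (n : Fin d) {f : E3 → ℝ} (hf : IsTestFunction f) {R : ℝ}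
    (hR : ∀ x, R < ‖x‖ → f x = 0) (T : ℝ) :
    ∫ x, (Y T).φ n x * f x =
      (∫ x, Y₀.φ n x * waveCos T f x) + (∫ x, Y₀.π n x * waveSin T f x) -
        ∫ s in (0 : ℝ)..T, ∑ j, (Y s).q j * memoryKernel (partialDeriv j (ρ n)) f (T - s) := by
  have hd := fun s (_ : s ∈ uIcc 0 T) => hY.hasDerivAt_energyPairing n hf hR T s
  simp only [integral_inner_gradient_mul_waveSin (hρ n) hf] at hd
  have hq : Continuous fun s => (Y s).q := continuous_iff_continuousAt.2 fun s =>
    (hY.position s).continuousAt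
  have hc : Continuous fun s =>
      ∑ j, (Y s).q j * memoryKernel (partialDeriv j (ρ n)) f (T - s) := by
    refine continuous_finsetSum _ fun j _ => ?_
    refine Continuous.mul ?_ ((differentiable_memoryKernel hf hR
      ((hρ n).partialDeriv j)).continuous.comp (continuous_const.sub continuous_id))
    exact (EuclideanSpace.proj j).continuous.comp hq
  -- At s = T the propagators reduce to 0 and the identity, so the pairing becomes the field tested
  -- against f; at s = 0 it sees only the initial data.
  have h := intervalIntegral.integral_eq_sub_of_hasDerivAt hd (hc.neg.intervalIntegrable _ _)
  simp only [sub_self, waveSin_zero, waveCos_zero hf, hY.initial, sub_zero, Pi.zero_apply,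
    mul_zero, integral_zero, add_zero, intervalIntegral.integral_neg] at h
  linarith

theorem force_apply (ω : ℝ) (Y : ℝ → State d)
    (hρ : ∀ n, IsTestFunction (ρ n)) (i : Fin 3) (t : ℝ) :
    (-(ω ^ 2 • (Y t).q) - ∑ n, ∫ x, (Y t).φ n x • gradient (ρ n) x) i =
      -(ω ^ 2 * (Y t).q i) - ∑ n, ∫ x, (Y t).φ n x * partialDeriv i (ρ n) x := by
  have : ∀ n, (∫ x, (Y t).φ n x • gradient (ρ n) x) i =
      ∫ x, (Y t).φ n x * partialDeriv i (ρ n) x := by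
    intro n
    have h1 : Integrable (fun x => (Y t).φ n x • gradient (ρ n) x) volume :=
      ((Y t).φ_mem n).locallyIntegrable.integrable_smul_right_of_hasCompactSupport
        (hρ n).gradient_continuous (hρ n).gradient_hasCompactSupport
    exact ((EuclideanSpace.proj (𝕜 := ℝ) i).integral_comp_comm h1).symm
  simp [this]

end Duhamel

end

/-! ### Laplace transform, contour shift and the characteristic operator -/

section

open Set Filter

theorem hasCompactSupport_of_Icc {G : Type*} [Zero G] {g : ℝ → G} {T : ℝ} (h0 : ∀ t ≤ 0, g t = 0)
    (hT : ∀ t, T ≤ t → g t = 0) : HasCompactSupport g := by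
  refine HasCompactSupport.intro (isCompact_Icc (a := 0) (b := T)) fun x hx => ?_
  rw [mem_Icc, not_and_or, not_le, not_le] at hx
  exact hx.elim (fun h => h0 x h.le) (fun h => hT x h.le)

section Laplace

variable {G : Type*} [NormedAddCommGroup G] [NormedSpace ℂ G]

/-- The (two-sided) Laplace transform. -/
def laplaceTransform (g : ℝ → G) (z : ℂ) : G := ∫ t : ℝ, Complex.exp (-z * t) • g t

theorem norm_cexp_neg_mul_ofReal (z : ℂ) (t : ℝ) :
    ‖Complex.exp (-z * t)‖ = Real.exp (-z.re * t) := by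
  rw [Complex.norm_exp]
  simp

theorem differentiable_laplaceTransform {g : ℝ → G} (hg : Continuous g)
    (hc : HasCompactSupport g) : Differentiable ℂ (laplaceTransform g) := by
  intro z
  have key := hasDerivAt_integral_of_dominated_loc_of_deriv_le (μ := (volume : Measure ℝ))
    (F := fun (z : ℂ) (t : ℝ) => Complex.exp (-z * t) • g t)
    (F' := fun (z : ℂ) (t : ℝ) => (Complex.exp (-z * t) * -t) • g t)
    (bound := fun t => (Real.exp ((|z.re| + 1) * |t|) * |t|) * ‖g t‖) (x₀ := z)
    (Metric.ball_mem_nhds z one_pos)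
    (Eventually.of_forall fun w => Continuous.aestronglyMeasurable (by fun_prop))
    (Continuous.integrable_of_hasCompactSupport (by fun_prop) hc.smul_left)
    (Continuous.aestronglyMeasurable (by fun_prop))
    (Eventually.of_forall fun t w hw => by
      rw [norm_smul, norm_mul, norm_cexp_neg_mul_ofReal, norm_neg, Complex.norm_real,
        Real.norm_eq_abs]
      have h1 : |w.re| ≤ |z.re| + 1 := by
        have h2 := (Complex.abs_re_le_norm (w - z)).trans (mem_ball_iff_norm.1 hw).le
        rw [Complex.sub_re] at h2
        have := abs_add_le (w.re - z.re) z.re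
        rw [sub_add_cancel] at this
        linarith
      have h3 : -w.re * t ≤ (|z.re| + 1) * |t| := by
        refine (le_abs_self _).trans ?_
        rw [abs_mul, abs_neg]
        gcongr
      gcongr)
    (Continuous.integrable_of_hasCompactSupport (by fun_prop) hc.norm.mul_left)
    (Eventually.of_forall fun t w _ => by
      have h1 : HasDerivAt (fun w : ℂ => -w * (t : ℂ)) (-1 * (t : ℂ)) w :=
        (hasDerivAt_id w).neg.mul_const (t : ℂ)
      have := h1.cexp.smul_const (g t)
      simpa using this)
  exact key.2.differentiableAt

/-- On the support 0 ≤ t ≤ T the weight |e^{-zt}| is at most e^T as long as Re z ≥ -1. The abscissa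
-1 is a fixed left limit for all strips used later. -/
theorem norm_laplaceTransform_le {g : ℝ → G} (hg : Continuous g) {T : ℝ} (h0 : ∀ t ≤ 0, g t = 0)
    (hT : ∀ t, T ≤ t → g t = 0) {z : ℂ} (hz : -1 ≤ z.re) :
    ‖laplaceTransform g z‖ ≤ Real.exp T * ∫ t, ‖g t‖ := by
  have hc := hasCompactSupport_of_Icc h0 hT
  rw [laplaceTransform, ← integral_const_mul]
  refine (norm_integral_le_integral_norm _).trans (integral_mono_of_nonneg
    (Eventually.of_forall fun t => norm_nonneg (Complex.exp (-z * t) • g t))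
    ((hg.integrable_of_hasCompactSupport hc).norm.const_mul _) (Eventually.of_forall fun t => ?_))
  simp only [norm_smul, norm_cexp_neg_mul_ofReal]
  rcases le_total t 0 with h | h
  · simp [h0 t h]
  rcases le_total T t with h' | h'
  · simp [hT t h']
  gcongr
  nlinarith

/-- Shift of the contour of integration between two vertical lines. -/
theorem integral_vertical_line_eq [CompleteSpace G] {E : ℂ → G} {a b C : ℝ} (hab : b ≤ a)
    (hE : ∀ z : ℂ, b ≤ z.re → z.re ≤ a → DifferentiableAt ℂ E z)
    (hC : ∀ z : ℂ, b ≤ z.re → z.re ≤ a → ‖E z‖ ≤ C / (1 + z.im ^ 2)) :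
    ∫ y : ℝ, E (a + y * Complex.I) = ∫ y : ℝ, E (b + y * Complex.I) := by
  have hint : ∀ c : ℝ, b ≤ c → c ≤ a → Integrable fun y : ℝ => E (c + y * Complex.I) := by
    intro c hbc hca
    have hcont : Continuous fun y : ℝ => E (c + y * Complex.I) := by
      refine continuous_iff_continuousAt.2 fun y => ?_
      have h1 : ContinuousAt E (c + y * Complex.I) :=
        (hE _ (by simpa using hbc) (by simpa using hca)).continuousAt
      exact h1.comp (f := fun y : ℝ => (c + y * Complex.I : ℂ)) (by fun_prop)
    refine (integrable_inv_one_add_sq.const_mul C).mono' hcont.aestronglyMeasurable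
      (Eventually.of_forall fun y => ?_)
    have := hC (c + y * Complex.I) (by simpa using hbc) (by simpa using hca)
    simpa [div_eq_mul_inv] using this
  -- The sign s treats the top and bottom sides of the rectangle together; both contribute O(1/M²).
  have hside : ∀ s : ℝ, s = 1 ∨ s = -1 → Tendsto
      (fun M : ℝ => ∫ x in b..a, E (x + ((s * M : ℝ) : ℂ) * Complex.I)) atTop (𝓝 0) := by
    intro s hs
    have hs2 : s ^ 2 = 1 := by rcases hs with h | h <;> simp [h]
    refine squeeze_zero_norm (a := fun M => C / (1 + M ^ 2) * |a - b|) (fun M => ?_) ?_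
    · refine intervalIntegral.norm_integral_le_of_norm_le_const fun x hx => ?_
      rw [uIoc_of_le hab] at hx
      have := hC (x + ((s * M : ℝ) : ℂ) * Complex.I) (by simpa using hx.1.le) (by simpa using hx.2)
      simpa [mul_pow, hs2] using this
    · have h1 : Tendsto (fun M : ℝ => 1 + M ^ 2) atTop atTop :=
        tendsto_atTop_add_const_left _ _ (tendsto_pow_atTop two_ne_zero)
      simpa using (h1.const_div_atTop C).mul_const |a - b|
  have hline : ∀ c : ℝ, b ≤ c → c ≤ a → Tendsto
      (fun M : ℝ => ∫ y in (-M)..M, E (c + y * Complex.I)) atTop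
      (𝓝 (∫ y : ℝ, E (c + y * Complex.I))) := fun c h1 h2 =>
    intervalIntegral_tendsto_integral (hint c h1 h2) tendsto_neg_atTop_atBot tendsto_id
  have hrect : ∀ M : ℝ, (∫ x in b..a, E (x + ((-1 * M : ℝ) : ℂ) * Complex.I)) -
      (∫ x in b..a, E (x + ((1 * M : ℝ) : ℂ) * Complex.I)) +
      Complex.I • (∫ y in (-M)..M, E (a + y * Complex.I)) -
      Complex.I • (∫ y in (-M)..M, E (b + y * Complex.I)) = 0 := by
    intro M
    have := Complex.integral_boundary_rect_eq_zero_of_differentiableOn E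
      (b + (-M : ℝ) * Complex.I) (a + M * Complex.I) (by
        intro z hz
        rw [Complex.mem_reProdIm] at hz
        have h1 := hz.1
        simp only [Complex.add_re, Complex.ofReal_re, Complex.mul_re, Complex.I_re, mul_zero,
          Complex.ofReal_im, Complex.I_im, mul_one, sub_self, add_zero, uIcc_of_le hab] at h1
        exact (hE z h1.1 h1.2).differentiableWithinAt)
    simpa using this
  have hlim := (((hside (-1) (Or.inr rfl)).sub (hside 1 (Or.inl rfl))).add
    ((hline a hab le_rfl).const_smul Complex.I)).sub ((hline b le_rfl hab).const_smul Complex.I)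
  simp only [hrect] at hlim
  have h0 := tendsto_nhds_unique hlim tendsto_const_nhds
  rw [sub_zero, zero_add, ← smul_sub, smul_eq_zero] at h0
  exact sub_eq_zero.1 (h0.resolve_left Complex.I_ne_zero)

end Laplace

section Symbol

variable {V : Type*} [NormedAddCommGroup V] [NormedSpace ℂ V]

/-- The characteristic operator `λ² + ω² - Γ̂(λ)` of the equation `q'' + ω² q = Γ * q`. -/
def charOp (ω : ℝ) (Γ : ℝ → V →L[ℂ] V) (z : ℂ) : V →L[ℂ] V :=
  (z ^ 2 + (ω : ℂ) ^ 2) • (1 : V →L[ℂ] V) - laplaceTransform Γ z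

variable {ω h : ℝ} {Γ : ℝ → V →L[ℂ] V}

theorem differentiable_charOp (hΓ : Continuous Γ) (h0 : ∀ t ≤ 0, Γ t = 0)
    (hh : ∀ t, h ≤ t → Γ t = 0) : Differentiable ℂ (charOp ω Γ) := by
  have := differentiable_laplaceTransform hΓ (hasCompactSupport_of_Icc h0 hh)
  unfold charOp
  fun_prop

/-- Neumann series for z(1 - z⁻¹L). The bound on the inverse X follows from zX = 1 + XL, whose last
term is absorbed in the left side because ‖L‖ ≤ ‖z‖/2. -/
theorem norm_inverse_smul_one_sub_le [CompleteSpace V] {z : ℂ} {L : V →L[ℂ] V} (hz : z ≠ 0) (hL : 2 * ‖L‖ ≤ ‖z‖) :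
    IsUnit (z • (1 : V →L[ℂ] V) - L) ∧ ‖Ring.inverse (z • (1 : V →L[ℂ] V) - L)‖ ≤ 2 / ‖z‖ := by
  have hz0 : 0 < ‖z‖ := norm_pos_iff.2 hz
  have h1 : ‖z⁻¹ • L‖ < 1 := by
    rw [norm_smul, norm_inv, inv_mul_lt_iff₀ hz0]
    linarith [norm_nonneg L]
  have h2 : z • (1 : V →L[ℂ] V) - L = z • (1 - z⁻¹ • L) := by
    rw [smul_sub, smul_smul, mul_inv_cancel₀ hz, one_smul]
  have hu : IsUnit (z • (1 : V →L[ℂ] V) - L) := by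
    rw [h2]
    exact (isUnit_one_sub_of_norm_lt_one h1).smul (Units.mk0 z hz)
  refine ⟨hu, ?_⟩
  set X := Ring.inverse (z • (1 : V →L[ℂ] V) - L) with hX
  have h3 : X * (z • (1 : V →L[ℂ] V) - L) = 1 := Ring.inverse_mul_cancel _ hu
  have h4 : z • X = 1 + X * L := by
    rw [mul_sub, mul_smul_comm, mul_one] at h3
    rw [← h3]; abel
  have h5 : ‖z‖ * ‖X‖ ≤ 1 + ‖X‖ * ‖L‖ := by
    rw [← norm_smul, h4]
    refine (norm_add_le _ _).trans (add_le_add ContinuousLinearMap.norm_id_le (norm_mul_le _ _))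
  rw [le_div_iff₀ hz0]
  nlinarith [mul_le_mul_of_nonneg_left hL (norm_nonneg X)]

/-- If the characteristic operator is invertible in the closed right half plane, then its inverse
is controlled in a slightly larger strip. -/
theorem exists_strip_bound [CompleteSpace V] (hΓ : Continuous Γ) (h0 : ∀ t ≤ 0, Γ t = 0)
    (hh : ∀ t, h ≤ t → Γ t = 0) (hA : ∀ z : ℂ, 0 ≤ z.re → IsUnit (charOp ω Γ z)) (a : ℝ) :
    ∃ δ : ℝ, 0 < δ ∧ ∃ C : ℝ, 0 ≤ C ∧ ∀ z : ℂ, -δ ≤ z.re → z.re ≤ a →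
      IsUnit (charOp ω Γ z) ∧ ‖Ring.inverse (charOp ω Γ z)‖ ≤ C / (1 + z.im ^ 2) := by
  have hcont : Continuous (charOp ω Γ) := (differentiable_charOp hΓ h0 hh).continuous
  set g := Real.exp h * ∫ t, ‖Γ t‖ with hg
  have hg0 : 0 ≤ g := mul_nonneg (Real.exp_pos _).le (integral_nonneg fun t => norm_nonneg _)
  -- For |Im z| ≥ M one has (Im z)² ≥ M: the term 2ω² gives |z² + ω²| ≥ (Im z)²/2, the term 4g makes
  -- this at least 2‖Γ̂(z)‖, and the 1 turns (Im z)² into 1 + (Im z)² in the final bound.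
  set M : ℝ := 1 + 2 * ω ^ 2 + 4 * g with hM
  have hM1 : 1 ≤ M := by nlinarith [sq_nonneg ω]
  have hlarge : ∀ z : ℂ, -1 ≤ z.re → M ≤ |z.im| → IsUnit (charOp ω Γ z) ∧
      ‖Ring.inverse (charOp ω Γ z)‖ ≤ 8 / (1 + z.im ^ 2) := by
    intro z hz hzM
    have h1 : M ≤ z.im ^ 2 := by
      rw [← sq_abs]; nlinarith
    have h2 : z.im ^ 2 / 2 ≤ ‖z ^ 2 + (ω : ℂ) ^ 2‖ := by
      have h3 := norm_sub_norm_le (z ^ 2) (-(ω : ℂ) ^ 2)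
      rw [sub_neg_eq_add, norm_neg, norm_pow, norm_pow, Complex.norm_real, Real.norm_eq_abs,
        sq_abs] at h3
      have h4 : z.im ^ 2 ≤ ‖z‖ ^ 2 := by
        rw [← sq_abs]
        exact pow_le_pow_left₀ (abs_nonneg _) (Complex.abs_im_le_norm z) 2
      linarith
    have h5 : 0 < ‖z ^ 2 + (ω : ℂ) ^ 2‖ := lt_of_lt_of_le (by linarith) h2
    have h6 := norm_laplaceTransform_le hΓ h0 hh hz
    obtain ⟨hu, hb⟩ := norm_inverse_smul_one_sub_le (L := laplaceTransform Γ z)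
      (norm_pos_iff.1 h5) (by linarith [sq_nonneg ω])
    refine ⟨hu, hb.trans ?_⟩
    rw [div_le_div_iff₀ h5 (by positivity)]
    linarith
  -- Units form an open set, so invertibility on this compact rectangle, whose left side lies on the
  -- imaginary axis, spreads to a neighbourhood of uniform width. Using |a| keeps the left side in
  -- the rectangle when a < 0.
  have hKc : IsCompact (Icc (0 : ℝ) |a| ×ℂ Icc (-M) M) := isCompact_Icc.reProdIm isCompact_Icc
  have hU : IsOpen {z : ℂ | IsUnit (charOp ω Γ z)} := Units.isOpen.preimage hcont
  obtain ⟨δ, hδ, hsub⟩ := hKc.exists_cthickening_subset_open hU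
    (fun z hz => hA z (Complex.mem_reProdIm.1 hz).1.1)
  set δ' := min δ 1 with hδ'
  have hδ'0 : 0 < δ' := lt_min hδ one_pos
  have hrect : ∀ z : ℂ, -δ' ≤ z.re → z.re ≤ a → |z.im| ≤ M → IsUnit (charOp ω Γ z) := by
    intro z h1 h2 h3
    rcases le_total 0 z.re with h4 | h4
    · exact hA z h4
    refine hsub (Metric.mem_cthickening_of_dist_le z (z.im * Complex.I) δ _ ?_ ?_)
    · rw [Complex.mem_reProdIm]
      simpa using abs_le.1 h3
    · rw [Complex.dist_eq]
      have : z - z.im * Complex.I = (z.re : ℂ) := by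
        rw [sub_eq_iff_eq_add]; exact (Complex.re_add_im z).symm
      rw [this, Complex.norm_real, Real.norm_eq_abs, abs_of_nonpos h4]
      linarith [min_le_left δ 1]
  have hKc2 : IsCompact (Icc (-δ') a ×ℂ Icc (-M) M) := isCompact_Icc.reProdIm isCompact_Icc
  have hinv : ContinuousOn (fun z => Ring.inverse (charOp ω Γ z)) (Icc (-δ') a ×ℂ Icc (-M) M) := by
    intro z hz
    rw [Complex.mem_reProdIm] at hz
    obtain ⟨u, hu⟩ := hrect z hz.1.1 hz.1.2 (abs_le.2 hz.2)
    refine ContinuousAt.continuousWithinAt ?_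
    refine ContinuousAt.comp (g := Ring.inverse) (f := charOp ω Γ) ?_ hcont.continuousAt
    rw [← hu]
    exact NormedRing.inverse_continuousAt u
  obtain ⟨C, hC⟩ := hKc2.exists_bound_of_continuousOn hinv
  refine ⟨δ', hδ'0, max 8 (|C| * (1 + M ^ 2)), by positivity, fun z h1 h2 => ?_⟩
  rcases le_total M |z.im| with h3 | h3
  · obtain ⟨hu, hb⟩ := hlarge z (by linarith [min_le_right δ 1]) h3
    refine ⟨hu, hb.trans ?_⟩
    gcongr
    exact le_max_left _ _
  · refine ⟨hrect z h1 h2 h3, ?_⟩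
    have h4 := hC z (Complex.mem_reProdIm.2 ⟨⟨h1, h2⟩, abs_le.1 h3⟩)
    rw [le_div_iff₀ (by positivity)]
    have h5 : z.im ^ 2 ≤ M ^ 2 := by
      rw [← sq_abs]; exact pow_le_pow_left₀ (abs_nonneg _) h3 2
    calc _ ≤ |C| * (1 + M ^ 2) := by
          gcongr
          exact h4.trans (le_abs_self C)
      _ ≤ _ := le_max_right _ _

end Symbol

end

/-! ### The delay equation: a priori growth and a smooth cutoff -/

section

open Set Filter

section Delay

variable {V : Type*} [NormedAddCommGroup V] [NormedSpace ℂ V]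

/-- Solutions of `q'' = -ω² q + ∫₀ᵗ Γ(s) q(t - s) ds + F` for `t ≥ 0`, with `p = q'`, `P = q''`. -/
structure IsDelaySolution (ω : ℝ) (Γ : ℝ → V →L[ℂ] V) (F q p P : ℝ → V) : Prop where
  deriv_q : ∀ t, HasDerivAt q (p t) t
  deriv_p : ∀ t, HasDerivAt p (P t) t
  continuous_P : Continuous P
  eq : ∀ t, 0 ≤ t → P t = -(ω ^ 2 • q t) + (∫ s in (0 : ℝ)..t, Γ s (q (t - s))) + F t

variable {ω h : ℝ} {Γ : ℝ → V →L[ℂ] V} {F q p P : ℝ → V}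

theorem IsDelaySolution.continuous_q (H : IsDelaySolution ω Γ F q p P) : Continuous q :=
  continuous_iff_continuousAt.2 fun t => (H.deriv_q t).continuousAt

theorem IsDelaySolution.continuous_p (H : IsDelaySolution ω Γ F q p P) : Continuous p :=
  continuous_iff_continuousAt.2 fun t => (H.deriv_p t).continuousAt

/-- The bound on q is required only where Γ is nonzero, so that with finite memory a bound on the
recent past suffices. -/
theorem norm_delay_integral_le (hΓi : Integrable fun t => ‖Γ t‖) {M t : ℝ} (ht : 0 ≤ t)
    (hM : 0 ≤ M) (hq : ∀ s, 0 ≤ s → s ≤ t → Γ s ≠ 0 → ‖q (t - s)‖ ≤ M) :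
    ‖∫ s in (0 : ℝ)..t, Γ s (q (t - s))‖ ≤ (∫ s, ‖Γ s‖) * M := by
  have h1 : ‖∫ s in (0 : ℝ)..t, Γ s (q (t - s))‖ ≤ ∫ s in (0 : ℝ)..t, ‖Γ s‖ * M := by
    refine intervalIntegral.norm_integral_le_of_norm_le ht (Eventually.of_forall fun s hs => ?_)
      ((hΓi.mul_const M).intervalIntegrable)
    rcases eq_or_ne (Γ s) 0 with h | h
    · simp [h]
    · exact ((Γ s).le_opNorm _).trans
        (mul_le_mul_of_nonneg_left (hq s hs.1.le hs.2 h) (norm_nonneg _))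
  refine h1.trans ?_
  rw [intervalIntegral.integral_mul_const, intervalIntegral.integral_of_le ht]
  refine mul_le_mul_of_nonneg_right ?_ hM
  exact setIntegral_le_integral hΓi (Eventually.of_forall fun s => norm_nonneg _)

/-- The exponential rate in the a priori bound. -/
def growthRate (ω : ℝ) (Γ : ℝ → V →L[ℂ] V) : ℝ := 2 * (1 + ω ^ 2 + ∫ s, ‖Γ s‖)

theorem one_le_growthRate (ω : ℝ) (Γ : ℝ → V →L[ℂ] V) : 1 ≤ growthRate ω Γ := by
  have : 0 ≤ ∫ s, ‖Γ s‖ := integral_nonneg fun s => norm_nonneg _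
  unfold growthRate
  nlinarith [sq_nonneg ω]

/-- A priori exponential bound. -/
theorem IsDelaySolution.norm_le_exp (H : IsDelaySolution ω Γ F q p P)
    (hΓi : Integrable fun t => ‖Γ t‖) {B : ℝ} (hB : 0 ≤ B)
    (hF : ∀ t, 0 ≤ t → ‖F t‖ ≤ B) {T : ℝ} (hT : 0 ≤ T) :
    ‖q T‖ + ‖p T‖ ≤ 2 * (‖q 0‖ + ‖p 0‖ + B) * Real.exp (growthRate ω Γ * T) := by
  set α := growthRate ω Γ with hα
  set g := ∫ s, ‖Γ s‖ with hg
  have hα1 : 1 ≤ α := one_le_growthRate ω Γ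
  have hα0 : 0 < α := by linarith
  have hαeq : α = 2 * (1 + ω ^ 2 + g) := rfl
  have hg0 : 0 ≤ g := integral_nonneg fun s => norm_nonneg _
  -- Weighted maximum principle: the equation is integrated up to the time t₀ where e^{-αt}(‖q‖ +
  -- ‖p‖) attains its maximum S, and S is then absorbed.
  obtain ⟨t₀, ht₀, hmax⟩ := isCompact_Icc.exists_isMaxOn (nonempty_Icc.2 hT)
    (f := fun t => Real.exp (-α * t) * (‖q t‖ + ‖p t‖))
    (by have := H.continuous_q; have := H.continuous_p; fun_prop)
  set S := Real.exp (-α * t₀) * (‖q t₀‖ + ‖p t₀‖) with hS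
  have hS0 : 0 ≤ S := by positivity
  have hb : ∀ t ∈ Icc 0 T, ‖q t‖ + ‖p t‖ ≤ S * Real.exp (α * t) := by
    intro t ht
    have : Real.exp (-α * t) * (‖q t‖ + ‖p t‖) ≤ S := hmax ht
    calc ‖q t‖ + ‖p t‖ = Real.exp (-α * t) * (‖q t‖ + ‖p t‖) * Real.exp (α * t) := by
          rw [mul_right_comm, ← Real.exp_add]; simp
      _ ≤ S * Real.exp (α * t) := by gcongr
  have hexp : ∀ c t : ℝ, HasDerivAt (fun t => c * Real.exp (α * t) / α) (c * Real.exp (α * t)) t := by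
    intro c t
    have h1 := (((hasDerivAt_id t).const_mul α).exp.const_mul c).div_const α
    convert! h1 using 1
    simp
    field_simp
  have hq : ∀ t ∈ Icc 0 T, ‖q t‖ ≤ ‖q 0‖ + S * Real.exp (α * t) / α :=
    image_norm_le_of_norm_deriv_right_le_deriv_boundary H.continuous_q.continuousOn
      (fun t _ => (H.deriv_q t).hasDerivWithinAt)
      (le_add_of_nonneg_right (by positivity)) (fun t => (hexp S t).const_add _)
      (fun t ht => by
        have := hb t (Ico_subset_Icc_self ht)
        linarith [norm_nonneg (q t)])
  have hP : ∀ t ∈ Icc 0 T, ‖P t‖ ≤ (ω ^ 2 + g) * S * Real.exp (α * t) + B := by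
    intro t ht
    rw [H.eq t ht.1]
    have h1 : ‖∫ s in (0 : ℝ)..t, Γ s (q (t - s))‖ ≤ g * (S * Real.exp (α * t)) := by
      refine norm_delay_integral_le hΓi ht.1 (by positivity) fun s hs hst _ => ?_
      have h2 := hb (t - s) ⟨by linarith, by linarith [ht.2]⟩
      have h3 : S * Real.exp (α * (t - s)) ≤ S * Real.exp (α * t) := by
        gcongr
        linarith
      linarith [norm_nonneg (p (t - s))]
    have h4 : ‖-(ω ^ 2 • q t)‖ ≤ ω ^ 2 * (S * Real.exp (α * t)) := by
      rw [norm_neg, norm_smul, Real.norm_eq_abs, abs_of_nonneg (sq_nonneg ω)]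
      gcongr
      linarith [hb t ht, norm_nonneg (p t)]
    have h5 := norm_add₃_le (a := -(ω ^ 2 • q t)) (b := ∫ s in (0 : ℝ)..t, Γ s (q (t - s)))
      (c := F t)
    linarith [hF t ht.1]
  have hp : ∀ t ∈ Icc 0 T, ‖p t‖ ≤ ‖p 0‖ + ((ω ^ 2 + g) * S * Real.exp (α * t) / α + B * t) :=
    image_norm_le_of_norm_deriv_right_le_deriv_boundary H.continuous_p.continuousOn
      (fun t _ => (H.deriv_p t).hasDerivWithinAt)
      (le_add_of_nonneg_right (by positivity))
      (fun t => ((hexp ((ω ^ 2 + g) * S) t).add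
        (by simpa using (hasDerivAt_id t).const_mul B)).const_add _)
      (fun t ht => hP t (Ico_subset_Icc_self ht))
  have h1 := hq t₀ ht₀
  have h2 := hp t₀ ht₀
  set e := Real.exp (α * t₀) with he
  have he1 : t₀ ≤ e := by
    have := Real.add_one_le_exp (α * t₀)
    nlinarith [ht₀.1]
  have he2 : 1 ≤ e := Real.one_le_exp (mul_nonneg hα0.le ht₀.1)
  have h3 : ‖q t₀‖ + ‖p t₀‖ = S * e := by
    rw [hS, he, mul_right_comm, ← Real.exp_add]; simp
  -- The rate α = 2(1 + ω² + g) is chosen so that the terms proportional to S recover exactly half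
  -- of it.
  have h4 : S * e / α + (ω ^ 2 + g) * S * e / α = S * e / 2 := by
    have : 1 + ω ^ 2 + g ≠ 0 := by positivity
    rw [hαeq]
    field_simp
    ring
  have h5 : S * e / 2 ≤ (‖q 0‖ + ‖p 0‖ + B) * e := by
    have h6 : B * t₀ ≤ B * e := by gcongr
    have h7 : ‖q 0‖ + ‖p 0‖ ≤ (‖q 0‖ + ‖p 0‖) * e := le_mul_of_one_le_right (by positivity) he2
    linarith
  have h6 : S ≤ 2 * (‖q 0‖ + ‖p 0‖ + B) := by
    have he0 : 0 < e := by linarith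
    have : S * e ≤ (2 * (‖q 0‖ + ‖p 0‖ + B)) * e := by linarith
    exact le_of_mul_le_mul_right this he0
  refine (hb T ⟨hT, le_rfl⟩).trans ?_
  gcongr

/-- Bound of the second derivative by a bound on the solution in the past. -/
theorem IsDelaySolution.norm_P_le (H : IsDelaySolution ω Γ F q p P)
    (hΓi : Integrable fun t => ‖Γ t‖) {M t : ℝ} (ht : 0 ≤ t) (hM : 0 ≤ M)
    (hq : ∀ s, 0 ≤ s → s ≤ t → Γ s ≠ 0 → ‖q (t - s)‖ ≤ M) (hqt : ‖q t‖ ≤ M) :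
    ‖P t‖ ≤ growthRate ω Γ * M + ‖F t‖ := by
  rw [H.eq t ht]
  have h1 := norm_delay_integral_le hΓi ht hM hq
  have h4 : ‖-(ω ^ 2 • q t)‖ ≤ ω ^ 2 * M := by
    rw [norm_neg, norm_smul, Real.norm_eq_abs, abs_of_nonneg (sq_nonneg ω)]
    gcongr
  have h5 := norm_add₃_le (a := -(ω ^ 2 • q t)) (b := ∫ s in (0 : ℝ)..t, Γ s (q (t - s)))
    (c := F t)
  have h6 : 0 ≤ ∫ s, ‖Γ s‖ := integral_nonneg fun s => norm_nonneg _
  have h7 : (ω ^ 2 + ∫ s, ‖Γ s‖) * M ≤ growthRate ω Γ * M := by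
    refine mul_le_mul_of_nonneg_right ?_ hM
    unfold growthRate
    nlinarith [sq_nonneg ω]
  linarith

/-- Passing to the closure by continuity includes the endpoints 0 and 1 of the cutoff. -/
theorem deriv_eq_zero_of_const {f : ℝ → ℝ} (hf : Continuous (deriv f)) {U : Set ℝ} (hU : IsOpen U)
    {c : ℝ} (h : ∀ t ∈ U, f t = c) {t : ℝ} (ht : t ∈ closure U) : deriv f t = 0 := by
  have hcl : IsClosed {t | deriv f t = 0} := isClosed_eq hf continuous_const
  refine hcl.closure_subset_iff.2 (fun s hs => ?_) ht
  have : f =ᶠ[𝓝 s] fun _ => c := by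
    filter_upwards [hU.mem_nhds hs] with r hr using h r hr
  simp [this.deriv_eq]

/-- A smooth cutoff with its first two derivatives. -/
theorem exists_cutoff : ∃ (χ χ₁ χ₂ : ℝ → ℝ) (m : ℝ), (∀ t, HasDerivAt χ (χ₁ t) t) ∧
    (∀ t, HasDerivAt χ₁ (χ₂ t) t) ∧ Continuous χ₂ ∧
    (∀ t ≤ 0, χ t = 0 ∧ χ₁ t = 0 ∧ χ₂ t = 0) ∧ (∀ t, 1 ≤ t → χ t = 1 ∧ χ₁ t = 0 ∧ χ₂ t = 0) ∧
    1 ≤ m ∧ ∀ t, |χ t| ≤ m ∧ |χ₁ t| ≤ m ∧ |χ₂ t| ≤ m := by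
  have hs : ContDiff ℝ 2 Real.smoothTransition := Real.smoothTransition.contDiff
  have hs1 : ContDiff ℝ 1 (deriv Real.smoothTransition) := by
    have h2 : ContDiff ℝ (1 + 1) Real.smoothTransition := Real.smoothTransition.contDiff
    exact (contDiff_succ_iff_deriv.1 h2).2.2
  have hs2 : Continuous (deriv (deriv Real.smoothTransition)) := hs1.continuous_deriv le_rfl
  have z1 : ∀ t ≤ 0, deriv Real.smoothTransition t = 0 := fun t ht =>
    deriv_eq_zero_of_const hs1.continuous isOpen_Iio
      (fun s hs => Real.smoothTransition.zero_of_nonpos (le_of_lt hs))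
      (by rw [closure_Iio]; exact ht)
  have z2 : ∀ t ≤ 0, deriv (deriv Real.smoothTransition) t = 0 := fun t ht =>
    deriv_eq_zero_of_const hs2 isOpen_Iio (fun s hs => z1 s (le_of_lt hs))
      (by rw [closure_Iio]; exact ht)
  have o1 : ∀ t, 1 ≤ t → deriv Real.smoothTransition t = 0 := fun t ht =>
    deriv_eq_zero_of_const hs1.continuous isOpen_Ioi
      (fun s hs => Real.smoothTransition.one_of_one_le (le_of_lt hs))
      (by rw [closure_Ioi]; exact ht)
  have o2 : ∀ t, 1 ≤ t → deriv (deriv Real.smoothTransition) t = 0 := fun t ht =>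
    deriv_eq_zero_of_const hs2 isOpen_Ioi (fun s hs => o1 s (le_of_lt hs))
      (by rw [closure_Ioi]; exact ht)
  obtain ⟨m₁, hm₁⟩ := hs1.continuous.bounded_above_of_compact_support
    (hasCompactSupport_of_Icc z1 o1)
  obtain ⟨m₂, hm₂⟩ := hs2.bounded_above_of_compact_support (hasCompactSupport_of_Icc z2 o2)
  refine ⟨Real.smoothTransition, deriv Real.smoothTransition,
    deriv (deriv Real.smoothTransition), max 1 (max m₁ m₂),
    fun t => (hs.differentiable (by norm_num) t).hasDerivAt,
    fun t => (hs1.differentiable (by norm_num) t).hasDerivAt, hs2,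
    fun t ht => ⟨Real.smoothTransition.zero_of_nonpos ht, z1 t ht, z2 t ht⟩,
    fun t ht => ⟨Real.smoothTransition.one_of_one_le ht, o1 t ht, o2 t ht⟩, le_max_left _ _,
    fun t => ⟨?_, ?_, ?_⟩⟩
  · rw [abs_of_nonneg (Real.smoothTransition.nonneg t)]
    exact (Real.smoothTransition.le_one t).trans (le_max_left _ _)
  · exact (hm₁ t).trans ((le_max_left _ _).trans (le_max_right _ _))
  · exact (hm₂ t).trans ((le_max_right _ _).trans (le_max_right _ _))

theorem integrable_laplace {f : ℝ → V} (hf : Continuous f) (h0 : ∀ t ≤ 0, f t = 0) {K α : ℝ}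
    (hK : ∀ t, 0 ≤ t → ‖f t‖ ≤ K * Real.exp (α * t)) {z : ℂ} (hz : α < z.re) :
    Integrable fun t : ℝ => Complex.exp (-z * t) • f t := by
  have h1 : IntegrableOn (fun t : ℝ => K * Real.exp (-(z.re - α) * t)) (Ioi 0) :=
    (integrableOn_exp_mul_Ioi (by linarith) 0).const_mul K
  rw [← integrableOn_iff_integrable_of_support_subset (s := Ioi (0 : ℝ))]
  · refine h1.mono' (Continuous.aestronglyMeasurable (by fun_prop)) ?_
    refine (ae_restrict_mem measurableSet_Ioi).mono fun t ht => ?_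
    rw [norm_smul, norm_cexp_neg_mul_ofReal]
    calc _ ≤ Real.exp (-z.re * t) * (K * Real.exp (α * t)) := by
          gcongr; exact hK t (le_of_lt ht)
      _ = K * (Real.exp (-z.re * t) * Real.exp (α * t)) := by ring
      _ = _ := by rw [← Real.exp_add]; congr 2; ring
  · intro t ht
    by_contra hcon
    exact ht (by simp [h0 t (not_lt.1 hcon)])

end Delay

end

/-! ### Forced solutions on the line and Laplace inversion -/

section

open Set Filter

section Delay

variable {V : Type*} [NormedAddCommGroup V] [NormedSpace ℂ V]

/-- Solutions on the whole line, vanishing for `t ≤ 0`, of `u'' = -ω² u + Γ * u + f` with a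
compactly supported force. -/
structure IsForcedSolution (ω : ℝ) (Γ : ℝ → V →L[ℂ] V) (K α T : ℝ) (f u u₁ u₂ : ℝ → V) : Prop where
  deriv_u : ∀ t, HasDerivAt u (u₁ t) t
  deriv_u₁ : ∀ t, HasDerivAt u₁ (u₂ t) t
  continuous_u₂ : Continuous u₂
  continuous_f : Continuous f
  eq : ∀ t, u₂ t = -(ω ^ 2 • u t) + (∫ s, Γ s (u (t - s))) + f t
  past : ∀ t ≤ 0, u t = 0 ∧ u₁ t = 0 ∧ u₂ t = 0 ∧ f t = 0
  future : ∀ t, T ≤ t → f t = 0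
  bound : ∀ t, 0 ≤ t → ‖u t‖ ≤ K * Real.exp (α * t) ∧ ‖u₁ t‖ ≤ K * Real.exp (α * t) ∧
    ‖u₂ t‖ ≤ K * Real.exp (α * t)

variable {ω h K α T : ℝ} {Γ : ℝ → V →L[ℂ] V} {f u u₁ u₂ : ℝ → V}

theorem IsForcedSolution.continuous_u (H : IsForcedSolution ω Γ K α T f u u₁ u₂) : Continuous u :=
  continuous_iff_continuousAt.2 fun t => (H.deriv_u t).continuousAt

theorem IsForcedSolution.continuous_u₁ (H : IsForcedSolution ω Γ K α T f u u₁ u₂) :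
    Continuous u₁ :=
  continuous_iff_continuousAt.2 fun t => (H.deriv_u₁ t).continuousAt

theorem integrable_laplace_of_hasCompactSupport {G : Type*} [NormedAddCommGroup G]
    [NormedSpace ℂ G] {g : ℝ → G} (hg : Continuous g) (hc : HasCompactSupport g) (z : ℂ) :
    Integrable fun t : ℝ => Complex.exp (-z * t) • g t :=
  Continuous.integrable_of_hasCompactSupport (by fun_prop) hc.smul_left

theorem laplaceTransform_convolution [CompleteSpace V] {z : ℂ}
    (iΓ : Integrable fun t : ℝ => Complex.exp (-z * t) • Γ t)
    (iu : Integrable fun t : ℝ => Complex.exp (-z * t) • u t) :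
    laplaceTransform (fun t => ∫ s, Γ s (u (t - s))) z =
      laplaceTransform Γ z (laplaceTransform u z) := by
  have := integral_convolution (ContinuousLinearMap.id ℂ (V →L[ℂ] V)) (μ := volume)
    (ν := volume) iΓ iu
  rw [laplaceTransform, laplaceTransform, laplaceTransform]
  refine Eq.trans ?_ this
  refine integral_congr_ae (Eventually.of_forall fun t => ?_)
  simp only [convolution_def, ContinuousLinearMap.id_apply]
  rw [← integral_smul]
  refine integral_congr_ae (Eventually.of_forall fun s => ?_)
  have h1 : Complex.exp (-z * t) = Complex.exp (-z * s) * Complex.exp (-z * (t - s : ℝ)) := by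
    rw [← Complex.exp_add]
    congr 1
    push_cast
    ring
  simp only [h1]
  rw [smul_apply, map_smul, smul_smul]

/-- The function e^{-zt}(u₂ - z²u) has the integrable primitive e^{-zt}(u₁ + zu), so its integral
over the line is zero and no boundary terms appear. -/
theorem laplaceTransform_second_deriv {z : ℂ} (hu : ∀ t, HasDerivAt u (u₁ t) t)
    (hu₁ : ∀ t, HasDerivAt u₁ (u₂ t) t)
    (iu : Integrable fun t : ℝ => Complex.exp (-z * t) • u t)
    (iu₁ : Integrable fun t : ℝ => Complex.exp (-z * t) • u₁ t)
    (iu₂ : Integrable fun t : ℝ => Complex.exp (-z * t) • u₂ t) :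
    laplaceTransform u₂ z = z ^ 2 • laplaceTransform u z := by
  have iW : Integrable fun t : ℝ => Complex.exp (-z * t) • u₂ t -
      z ^ 2 • Complex.exp (-z * t) • u t := iu₂.sub (iu.smul (z ^ 2))
  have iW' : Integrable fun t : ℝ => Complex.exp (-z * t) • u₁ t +
      z • Complex.exp (-z * t) • u t := iu₁.add (iu.smul z)
  have hW := integral_eq_zero_of_hasDerivAt_of_integrable (fun t => ?_) iW iW'
  · have iz : Integrable fun t : ℝ => z ^ 2 • Complex.exp (-z * t) • u t := iu.smul (z ^ 2)
    rw [integral_sub iu₂ iz, integral_smul] at hW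
    exact sub_eq_zero.1 hW
  · have h1 : HasDerivAt (fun t : ℝ => Complex.exp (-z * t)) (Complex.exp (-z * t) * (-z * 1)) t :=
      ((Complex.ofRealCLM.hasDerivAt (x := t)).const_mul (-z)).cexp
    have h2 := (h1.smul (hu₁ t)).add ((h1.smul (hu t)).const_smul z)
    refine h2.congr_deriv ?_
    module

theorem laplaceTransform_add_smul_sub {z c : ℂ}
    (iu : Integrable fun t : ℝ => Complex.exp (-z * t) • u t)
    (iu₂ : Integrable fun t : ℝ => Complex.exp (-z * t) • u₂ t)
    (hf : Integrable fun t : ℝ => Complex.exp (-z * t) • f t) :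
    laplaceTransform (fun t => u₂ t + c • u t - f t) z =
      laplaceTransform u₂ z + c • laplaceTransform u z - laplaceTransform f z := by
  have i1 : Integrable fun t : ℝ => c • Complex.exp (-z * t) • u t := iu.smul c
  have i2 : Integrable fun t : ℝ => Complex.exp (-z * t) • u₂ t + c • Complex.exp (-z * t) • u t :=
    iu₂.add i1
  simp only [laplaceTransform, smul_sub, smul_add]
  simp only [smul_comm _ c]
  rw [integral_sub i2 hf, integral_add iu₂ i1, integral_smul]

variable [CompleteSpace V]

theorem IsForcedSolution.charOp_laplaceTransform (H : IsForcedSolution ω Γ K α T f u u₁ u₂)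
    (hΓ : Continuous Γ) (hΓc : HasCompactSupport Γ) {z : ℂ} (hz : α < z.re) :
    charOp ω Γ z (laplaceTransform u z) = laplaceTransform f z := by
  have iu := integrable_laplace H.continuous_u (fun t ht => (H.past t ht).1)
    (fun t ht => (H.bound t ht).1) hz
  have iu₁ := integrable_laplace H.continuous_u₁ (fun t ht => (H.past t ht).2.1)
    (fun t ht => (H.bound t ht).2.1) hz
  have iu₂ := integrable_laplace H.continuous_u₂ (fun t ht => (H.past t ht).2.2.1)
    (fun t ht => (H.bound t ht).2.2) hz
  have ifo := integrable_laplace_of_hasCompactSupport H.continuous_f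
    (hasCompactSupport_of_Icc (fun t ht => (H.past t ht).2.2.2) H.future) z
  have hconv := laplaceTransform_convolution
    (integrable_laplace_of_hasCompactSupport hΓ hΓc z) iu
  have hsd := laplaceTransform_second_deriv H.deriv_u H.deriv_u₁ iu iu₁ iu₂
  have hsplit : (fun t => ∫ s, Γ s (u (t - s))) = fun t => u₂ t + ((ω : ℂ) ^ 2) • u t - f t := by
    ext t
    have h3 : ((ω ^ 2 : ℝ)) • u t = ((ω : ℂ) ^ 2) • u t := by
      rw [← Complex.ofReal_pow, Complex.coe_smul]
    rw [H.eq t, h3]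
    abel
  rw [hsplit, laplaceTransform_add_smul_sub iu iu₂ ifo, hsd] at hconv
  rw [charOp, sub_apply, smul_apply, one_apply_eq_self, ← hconv, add_smul]
  abel

open FourierTransform in
/-- Laplace inversion on a vertical line. -/
theorem laplace_inversion (hu : Continuous u) {a : ℝ}
    (hi : Integrable fun t : ℝ => Complex.exp (-(a : ℂ) * t) • u t)
    (hL : Integrable fun y : ℝ => laplaceTransform u (a + y * Complex.I)) (t : ℝ) :
    u t = (2 * Real.pi)⁻¹ • ∫ y : ℝ, Complex.exp ((a + y * Complex.I) * t) •
      laplaceTransform u (a + y * Complex.I) := by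
  have hpi : (2 * Real.pi) ≠ 0 := by positivity
  set g : ℝ → V := fun t => Complex.exp (-(a : ℂ) * t) • u t with hg
  -- Along Re z = a the Laplace transform of u is the Fourier transform of the damped function
  -- e^{-at}u, with y = 2πν; Fourier inversion applies to the latter.
  have hF : 𝓕 g = fun ν => laplaceTransform u (a + ((2 * Real.pi * ν : ℝ) : ℂ) * Complex.I) := by
    ext ν
    rw [Real.fourier_real_eq_integral_exp_smul, laplaceTransform]
    refine integral_congr_ae (Eventually.of_forall fun s => ?_)
    simp only [hg, smul_smul, ← Complex.exp_add]
    congr 2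
    push_cast
    ring
  have hgc : Continuous g := by fun_prop
  have hFi : Integrable (𝓕 g) := by
    rw [hF]
    exact hL.comp_mul_left' hpi
  have hinv := congrFun (hgc.fourierInv_fourier_eq hi hFi) t
  have hsub := Measure.integral_comp_mul_left (fun y : ℝ => Complex.exp ((y * t : ℝ) * Complex.I) •
      laplaceTransform u (a + y * Complex.I)) (2 * Real.pi)
  rw [abs_of_pos (by positivity)] at hsub
  rw [Real.fourierInv_eq', hF] at hinv
  have h2 : u t = Complex.exp ((a : ℂ) * t) • g t := by
    rw [hg, smul_smul, ← Complex.exp_add]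
    simp
  have h3 : (∫ ν : ℝ, Complex.exp (((2 * Real.pi * inner ℝ ν t : ℝ) : ℂ) * Complex.I) •
      laplaceTransform u (a + ((2 * Real.pi * ν : ℝ) : ℂ) * Complex.I)) =
      (2 * Real.pi)⁻¹ • ∫ y : ℝ, Complex.exp ((y * t : ℝ) * Complex.I) •
      laplaceTransform u (a + y * Complex.I) := by
    rw [← hsub]
    refine integral_congr_ae (Eventually.of_forall fun s => ?_)
    simp only [Real.inner_apply, ← mul_assoc]
  rw [h3] at hinv
  rw [h2, ← hinv, smul_comm, ← integral_smul]
  congr 1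
  refine integral_congr_ae (Eventually.of_forall fun s => ?_)
  simp only [smul_smul, ← Complex.exp_add]
  congr 2
  push_cast
  ring

end Delay

end

/-! ### Contour shift for forced solutions, and reduction to them -/

section

open Set Filter

theorem continuous_comp_vertical_line {V : Type*} [TopologicalSpace V] {E : ℂ → V} {c : ℝ}
    (hE : ∀ z : ℂ, z.re = c → ContinuousAt E z) :
    Continuous fun y : ℝ => E (c + y * Complex.I) :=
  continuous_iff_continuousAt.2 fun y =>
    (hE _ (by simp)).comp (f := fun y : ℝ => (c + y * Complex.I : ℂ)) (by fun_prop)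

section Delay

variable {V : Type*} [NormedAddCommGroup V] [NormedSpace ℂ V]
variable {ω h K α T : ℝ} {Γ : ℝ → V →L[ℂ] V} {f u u₁ u₂ F q p P : ℝ → V}

/-- To the right of the growth rate the transform of u equals `charOp`⁻¹ applied to that of f. This
expression is holomorphic and O(1/(1 + y²)) in the whole strip, so the inversion contour moves to Re
z = -δ. The factor 1/2 is (2π)⁻¹ times the integral π of 1/(1 + y²). -/
theorem IsForcedSolution.norm_le [CompleteSpace V] (H : IsForcedSolution ω Γ K α T f u u₁ u₂)
    (hΓ : Continuous Γ) (h0 : ∀ t ≤ 0, Γ t = 0) (hh : ∀ t, h ≤ t → Γ t = 0) {δ a C L : ℝ}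
    (hα : α < a) (hδa : -δ ≤ a) (hδ : δ ≤ 1)
    (hstrip : ∀ z : ℂ, -δ ≤ z.re → z.re ≤ a →
      IsUnit (charOp ω Γ z) ∧ ‖Ring.inverse (charOp ω Γ z)‖ ≤ C / (1 + z.im ^ 2))
    (hL : ∀ z : ℂ, -1 ≤ z.re → ‖laplaceTransform f z‖ ≤ L) {t : ℝ} (ht : 0 ≤ t) :
    ‖u t‖ ≤ C * L / 2 * Real.exp (-δ * t) := by
  have hΓc := hasCompactSupport_of_Icc h0 hh
  have hfc := hasCompactSupport_of_Icc (fun t ht => (H.past t ht).2.2.2) H.future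
  set S : ℂ → V := fun z => Ring.inverse (charOp ω Γ z) (laplaceTransform f z) with hS
  have hSd : ∀ z : ℂ, -δ ≤ z.re → z.re ≤ a → DifferentiableAt ℂ S z := by
    intro z h1 h2
    have h3 : DifferentiableAt ℂ (fun z => Ring.inverse (charOp ω Γ z)) z := by
      obtain ⟨U, hU⟩ := (hstrip z h1 h2).1
      have h4 : DifferentiableAt ℂ Ring.inverse (charOp ω Γ z) := by
        rw [← hU]; exact differentiableAt_inverse U.isUnit
      exact h4.comp z (differentiable_charOp hΓ h0 hh z)
    exact h3.clm_apply (differentiable_laplaceTransform H.continuous_f hfc z)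
  have hSb : ∀ z : ℂ, -δ ≤ z.re → z.re ≤ a → ‖S z‖ ≤ C * L / (1 + z.im ^ 2) := by
    intro z h1 h2
    refine (ContinuousLinearMap.le_opNorm _ _).trans ?_
    rw [mul_div_right_comm]
    have := (hstrip z h1 h2).2
    exact mul_le_mul this (hL z (by linarith)) (norm_nonneg _) ((norm_nonneg _).trans this)
  have hua : ∀ y : ℝ, laplaceTransform u (a + y * Complex.I) = S (a + y * Complex.I) := by
    intro y
    have h1 : (a + y * Complex.I : ℂ).re = a := by simp
    have h2 := H.charOp_laplaceTransform hΓ hΓc (z := a + y * Complex.I) (by rw [h1]; exact hα)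
    have h3 := (hstrip (a + y * Complex.I) (by rw [h1]; exact hδa) (by rw [h1])).1
    rw [hS]
    simp only
    rw [← h2, ← mul_apply_eq_comp, Ring.inverse_mul_cancel _ h3,
      one_apply_eq_self]
  have hint : ∀ c : ℝ, -δ ≤ c → c ≤ a → Integrable fun y : ℝ => S (c + y * Complex.I) := by
    intro c h1 h2
    refine (integrable_inv_one_add_sq.const_mul (C * L)).mono'
      (continuous_comp_vertical_line fun z hz => (hSd z (hz ▸ h1) (hz ▸ h2)).continuousAt
        ).aestronglyMeasurable (Eventually.of_forall fun y => ?_)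
    have := hSb (c + y * Complex.I) (by simpa using h1) (by simpa using h2)
    simpa [div_eq_mul_inv] using this
  have hua' : (fun y : ℝ => laplaceTransform u (a + y * Complex.I)) =
    fun y : ℝ => S (a + y * Complex.I) := funext hua
  have hinv := laplace_inversion H.continuous_u (a := a)
    (integrable_laplace H.continuous_u (fun t ht => (H.past t ht).1)
      (fun t ht => (H.bound t ht).1) (by simpa using hα))
    (by rw [hua']; exact hint a hδa le_rfl) t
  simp only [hua] at hinv
  have hshift := integral_vertical_line_eq (E := fun z : ℂ => Complex.exp (z * t) • S z)
    (a := a) (b := -δ) (C := Real.exp (a * t) * (C * L)) hδa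
    (fun z h1 h2 => by
      have := hSd z h1 h2
      fun_prop)
    (fun z h1 h2 => by
      rw [norm_smul, Complex.norm_exp, mul_div_assoc]
      refine mul_le_mul ?_ (hSb z h1 h2) (norm_nonneg _) (Real.exp_pos _).le
      simp only [Complex.mul_re, Complex.ofReal_re, Complex.ofReal_im, mul_zero, sub_zero]
      gcongr)
  rw [hshift] at hinv
  have hpi := Real.pi_pos
  rw [hinv, norm_smul, Real.norm_of_nonneg (by positivity)]
  have hbd : ‖∫ y : ℝ, Complex.exp (((-δ : ℝ) + y * Complex.I) * t) • S ((-δ : ℝ) + y * Complex.I)‖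
      ≤ Real.exp (-δ * t) * (C * L) * Real.pi := by
    rw [← integral_univ_inv_one_add_sq, ← integral_const_mul]
    refine norm_integral_le_of_norm_le (integrable_inv_one_add_sq.const_mul _)
      (Eventually.of_forall fun y => ?_)
    rw [norm_smul, Complex.norm_exp, mul_assoc]
    have := hSb ((-δ : ℝ) + y * Complex.I) (by simp) (by simpa using hδa)
    refine mul_le_mul (le_of_eq (by simp)) ?_ (norm_nonneg _) (Real.exp_pos _).le
    simpa [div_eq_mul_inv] using this
  calc _ ≤ (2 * Real.pi)⁻¹ * (Real.exp (-δ * t) * (C * L) * Real.pi) := by gcongr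
    _ = C * L / 2 * Real.exp (-δ * t) := by field_simp

/-- Cutting off a solution near `t = 0` produces a forced solution on the line. -/
theorem IsDelaySolution.exists_forced (hΓ : Continuous Γ) (h0 : ∀ t ≤ 0, Γ t = 0)
    (hh : ∀ t, h ≤ t → Γ t = 0) (hT1 : 1 ≤ T) (hTh : 1 + h ≤ T) :
    ∃ K : ℝ, 0 ≤ K ∧ ∀ (F q p P : ℝ → V) (B : ℝ), IsDelaySolution ω Γ F q p P → 0 ≤ B →
      (∀ t, 0 ≤ t → ‖F t‖ ≤ B) → (∀ t, T ≤ t → F t = 0) →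
      ∃ f u u₁ u₂ : ℝ → V, IsForcedSolution ω Γ (K * (‖q 0‖ + ‖p 0‖ + B)) (growthRate ω Γ) T
        f u u₁ u₂ ∧ (∀ t, 1 ≤ t → u t = q t) ∧
        ∫ t, ‖f t‖ ≤ K * (‖q 0‖ + ‖p 0‖ + B) := by
  obtain ⟨χ, χ₁, χ₂, m, hχ, hχ₁, hχ₂, hpast, hfut, hm1, hm⟩ := exists_cutoff
  set α := growthRate ω Γ with hα
  have hα1 : 1 ≤ α := one_le_growthRate ω Γ
  have hΓc := hasCompactSupport_of_Icc h0 hh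
  have hΓi : Integrable fun t => ‖Γ t‖ := (hΓ.integrable_of_hasCompactSupport hΓc).norm
  set g := ∫ s, ‖Γ s‖ with hg
  have hg0 : 0 ≤ g := integral_nonneg fun s => norm_nonneg _
  -- The second derivative of χq contains q and p once, p once more, and P. With X = N e^{αt} these
  -- are bounded by 2X, 2X and (2α + 1)X, each weighted by at most m.
  set K₀ : ℝ := m * (4 + 2 * α + 1) with hK₀
  have hK₀0 : 0 ≤ K₀ := by positivity
  set K₁ : ℝ := K₀ + ω ^ 2 * K₀ + g * K₀ with hK₁
  have hK₁0 : 0 ≤ K₁ := by positivity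
  refine ⟨max K₀ (T * (K₁ * Real.exp (α * T))), le_max_of_le_left hK₀0,
    fun F q p P B H hB hF hFT => ?_⟩
  set N := ‖q 0‖ + ‖p 0‖ + B with hN
  have hN0 : 0 ≤ N := by positivity
  set u : ℝ → V := fun t => χ t • q t with hu
  set u₁ : ℝ → V := fun t => χ₁ t • q t + χ t • p t with hu₁
  set u₂ : ℝ → V := fun t => (χ₂ t • q t + χ₁ t • p t) + (χ₁ t • p t + χ t • P t) with hu₂
  -- The force is defined as the defect of u = χq in the convolution equation. The cutoff removes
  -- the initial values, whose contribution zq(0) + p(0) would spoil integrability of the transform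
  -- along vertical lines.
  set f : ℝ → V := fun t => u₂ t + ω ^ 2 • u t - ∫ s, Γ s (u (t - s)) with hf
  have hqc := H.continuous_q
  have hpc := H.continuous_p
  have hPc := H.continuous_P
  have hχc : Continuous χ := continuous_iff_continuousAt.2 fun t => (hχ t).continuousAt
  have hχ₁c : Continuous χ₁ := continuous_iff_continuousAt.2 fun t => (hχ₁ t).continuousAt
  have huc : Continuous u := by fun_prop
  have hu₂c : Continuous u₂ := by fun_prop
  have du : ∀ t, HasDerivAt u (u₁ t) t := fun t => by
    have := (hχ t).smul (H.deriv_q t)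
    rw [add_comm] at this
    exact this
  have du₁ : ∀ t, HasDerivAt u₁ (u₂ t) t := fun t => by
    have := ((hχ₁ t).smul (H.deriv_q t)).add ((hχ t).smul (H.deriv_p t))
    refine this.congr_deriv ?_
    rw [hu₂]
    simp only
    abel
  have hconvc : Continuous fun t => ∫ s, Γ s (u (t - s)) :=
    hΓc.continuous_convolution_left (ContinuousLinearMap.id ℂ (V →L[ℂ] V)) hΓ
      huc.locallyIntegrable
  have hfc : Continuous f := (hu₂c.add (huc.const_smul _)).sub hconvc
  have upast : ∀ t ≤ 0, u t = 0 := fun t ht => by simp [hu, (hpast t ht).1]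
  have hap : ∀ t, 0 ≤ t → ‖q t‖ + ‖p t‖ ≤ 2 * N * Real.exp (α * t) := fun t ht =>
    H.norm_le_exp hΓi hB hF ht
  have hPb : ∀ t, 0 ≤ t → ‖P t‖ ≤ (2 * α + 1) * (N * Real.exp (α * t)) := by
    intro t ht
    refine (H.norm_P_le hΓi ht (M := 2 * N * Real.exp (α * t)) (by positivity)
      (fun s hs hst _ => ?_) ?_).trans ?_
    · have h1 := hap (t - s) (by linarith)
      have h2 : 2 * N * Real.exp (α * (t - s)) ≤ 2 * N * Real.exp (α * t) := by
        gcongr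
        linarith
      linarith [norm_nonneg (p (t - s))]
    · linarith [hap t ht, norm_nonneg (p t)]
    · have h1 := hF t ht
      have h2 : 1 ≤ Real.exp (α * t) := Real.one_le_exp (by positivity)
      have h3 : B ≤ N := by
        rw [hN]; linarith [norm_nonneg (q 0), norm_nonneg (p 0)]
      have h4 : N ≤ N * Real.exp (α * t) := le_mul_of_one_le_right hN0 h2
      linarith
  have hsm : ∀ (c : ℝ) (v : V), |c| ≤ m → ‖c • v‖ ≤ m * ‖v‖ := fun c v hc => by
    rw [norm_smul]
    exact mul_le_mul_of_nonneg_right hc (norm_nonneg v)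
  have hbound : ∀ t, 0 ≤ t → ‖u t‖ ≤ K₀ * N * Real.exp (α * t) ∧
      ‖u₁ t‖ ≤ K₀ * N * Real.exp (α * t) ∧ ‖u₂ t‖ ≤ K₀ * N * Real.exp (α * t) := by
    intro t ht
    have h1 := hap t ht
    have h2 := hPb t ht
    set X := N * Real.exp (α * t) with hX
    have hX0 : 0 ≤ X := by positivity
    have hKX : K₀ * N * Real.exp (α * t) = m * (4 * X + (2 * α + 1) * X) := by
      rw [hK₀, hX]; ring
    have h1' : ‖q t‖ + ‖p t‖ ≤ 2 * X := by rw [hX]; linarith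
    have hαX : 0 ≤ α * X := by positivity
    have hm0 : 0 ≤ m := by linarith
    rw [hKX]
    have hq0 := norm_nonneg (q t)
    have hp0 := norm_nonneg (p t)
    have hP0 := norm_nonneg (P t)
    refine ⟨(hsm _ _ (hm t).1).trans ?_, ?_, ?_⟩
    · exact mul_le_mul_of_nonneg_left (by linarith) hm0
    · refine (norm_add_le _ _).trans ((add_le_add (hsm _ _ (hm t).2.1)
        (hsm _ _ (hm t).1)).trans ?_)
      rw [← mul_add]
      exact mul_le_mul_of_nonneg_left (by linarith) hm0
    · refine (norm_add_le _ _).trans ((add_le_add ((norm_add_le _ _).trans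
        (add_le_add (hsm _ _ (hm t).2.2) (hsm _ _ (hm t).2.1))) ((norm_add_le _ _).trans
        (add_le_add (hsm _ _ (hm t).2.1) (hsm _ _ (hm t).1)))).trans ?_)
      rw [← mul_add, ← mul_add, ← mul_add]
      exact mul_le_mul_of_nonneg_left (by linarith) hm0
  have hfpast : ∀ t ≤ 0, f t = 0 := by
    intro t ht
    have h1 : ∀ s, Γ s (u (t - s)) = 0 := by
      intro s
      rcases le_total s 0 with h | h
      · simp [h0 s h]
      · simp [upast (t - s) (by linarith)]
    have h2 : u₂ t = 0 := by simp [hu₂, hpast t ht]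
    change u₂ t + ω ^ 2 • u t - ∫ s, Γ s (u (t - s)) = 0
    simp only [h1, h2, upast t ht, integral_zero, smul_zero, add_zero, sub_zero]
  have hffut : ∀ t, T ≤ t → f t = 0 := by
    intro t ht
    have ht1 : 1 ≤ t := by linarith
    have h1 : ∫ s, Γ s (u (t - s)) = ∫ s in (0 : ℝ)..t, Γ s (q (t - s)) := by
      rw [intervalIntegral.integral_of_le (by linarith),
        ← setIntegral_eq_integral_of_forall_compl_eq_zero (s := Ioc 0 t)]
      · refine setIntegral_congr_fun measurableSet_Ioc fun s hs => ?_
        -- Only s < h matters, and then t - s ≥ T - h ≥ 1: the cutoff equals 1 on the whole memory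
        -- window, so u and q agree there.
        rcases le_total h s with h2 | h2
        · simp [hh s h2]
        · simp [hu, (hfut (t - s) (by linarith)).1]
      · intro s hs
        rw [mem_Ioc, not_and_or, not_lt, not_le] at hs
        rcases hs with hs | hs
        · simp [h0 s hs]
        · simp [hh s (by linarith)]
    have h2 := H.eq t (by linarith)
    rw [hFT t ht] at h2
    have h3 : u₂ t = P t := by simp [hu₂, hfut t ht1]
    have h4 : u t = q t := by simp [hu, hfut t ht1]
    change u₂ t + ω ^ 2 • u t - ∫ s, Γ s (u (t - s)) = 0
    rw [h1, h3, h4, h2]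
    abel
  have hfb : ∀ t, 0 ≤ t → ‖f t‖ ≤ K₁ * N * Real.exp (α * t) := by
    intro t ht
    have h1 : ‖∫ s, Γ s (u (t - s))‖ ≤ g * (K₀ * N * Real.exp (α * t)) := by
      rw [hg, ← integral_mul_const]
      refine norm_integral_le_of_norm_le (hΓi.mul_const _) (Eventually.of_forall fun s => ?_)
      refine ((Γ s).le_opNorm _).trans ?_
      rcases le_total s 0 with h | h
      · simp [h0 s h]
      refine mul_le_mul_of_nonneg_left ?_ (norm_nonneg _)
      rcases le_total (t - s) 0 with h' | h'
      · rw [upast _ h', norm_zero]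
        positivity
      · refine (hbound _ h').1.trans ?_
        gcongr
        linarith
    obtain ⟨b1, -, b3⟩ := hbound t ht
    have h2 : ‖ω ^ 2 • u t‖ ≤ ω ^ 2 * (K₀ * N * Real.exp (α * t)) := by
      rw [norm_smul, Real.norm_eq_abs, abs_of_nonneg (sq_nonneg ω)]
      exact mul_le_mul_of_nonneg_left b1 (sq_nonneg ω)
    change ‖u₂ t + ω ^ 2 • u t - ∫ s, Γ s (u (t - s))‖ ≤ _
    refine (norm_sub_le _ _).trans ((add_le_add ((norm_add_le _ _).trans (add_le_add b3 h2))
      h1).trans (le_of_eq ?_))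
    rw [hK₁]
    ring
  refine ⟨f, u, u₁, u₂, ⟨du, du₁, hu₂c, hfc, fun t => ?_, fun t ht => ⟨upast t ht, ?_, ?_, hfpast t ht⟩,
    hffut, fun t ht => ?_⟩, fun t ht => ?_, ?_⟩
  · simp only [hf]; abel
  · simp [hu₁, hpast t ht]
  · simp [hu₂, hpast t ht]
  · obtain ⟨b1, b2, b3⟩ := hbound t ht
    have h1 : K₀ * N * Real.exp (α * t) ≤
        max K₀ (T * (K₁ * Real.exp (α * T))) * N * Real.exp (α * t) := by
      gcongr
      exact le_max_left _ _
    exact ⟨b1.trans h1, b2.trans h1, b3.trans h1⟩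
  · simp [hu, hfut t ht]
  · have h1 : ∫ t, ‖f t‖ = ∫ t in Icc 0 T, ‖f t‖ := by
      rw [setIntegral_eq_integral_of_forall_compl_eq_zero]
      intro s hs
      rw [mem_Icc, not_and_or, not_le, not_le] at hs
      rcases hs with hs | hs
      · simp [hfpast s hs.le]
      · simp [hffut s hs.le]
    have h2 : ∫ t in Icc 0 T, ‖f t‖ ≤ ∫ t in Icc 0 T, K₁ * N * Real.exp (α * T) := by
      refine setIntegral_mono_on (hfc.norm.integrableOn_Icc) continuous_const.integrableOn_Icc measurableSet_Icc
        fun t ht => (hfb t ht.1).trans ?_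
      have := ht.2
      gcongr
    rw [h1]
    refine h2.trans ?_
    rw [setIntegral_const, measureReal_def, Real.volume_Icc, sub_zero, smul_eq_mul,
      ENNReal.toReal_ofReal (by linarith)]
    calc T * (K₁ * N * Real.exp (α * T)) = T * (K₁ * Real.exp (α * T)) * N := by ring
      _ ≤ _ := by
        gcongr
        exact le_max_right _ _

end Delay

end

/-! ### Exponential decay for the delay equation -/

section

open Set Filter

section Delay

variable {V : Type*} [NormedAddCommGroup V] [NormedSpace ℂ V]
variable {ω h : ℝ} {Γ : ℝ → V →L[ℂ] V}

/-- If a function and its second derivative are small then so is its derivative. -/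
theorem norm_deriv_le_of_second_deriv {q p P : ℝ → V} {t M A : ℝ}
    (hq : ∀ t, HasDerivAt q (p t) t) (hp : ∀ t, HasDerivAt p (P t) t) (hM0 : 0 ≤ M)
    (hM : ∀ s ∈ Icc t (t + 1), ‖P s‖ ≤ M) (hA : ∀ s ∈ Icc t (t + 1), ‖q s‖ ≤ A) :
    ‖p t‖ ≤ 2 * A + M := by
  have ht : t ∈ Icc t (t + 1) := by simp
  have ht' : t + 1 ∈ Icc t (t + 1) := by simp
  have h1 : ∀ s ∈ Icc t (t + 1), ‖p s - p t‖ ≤ M := by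
    intro s hs
    have := (convex_Icc t (t + 1)).norm_image_sub_le_of_norm_hasDerivWithin_le
      (fun x _ => (hp x).hasDerivWithinAt) hM ht hs
    refine this.trans ?_
    rw [Real.norm_eq_abs, abs_of_nonneg (by linarith [hs.1])]
    nlinarith [hs.2]
  have h2 := (convex_Icc t (t + 1)).norm_image_sub_le_of_norm_hasDerivWithin_le
    (f := fun s => q s - s • p t) (f' := fun s => p s - (1 : ℝ) • p t)
      (fun x _ => ((hq x).sub ((hasDerivAt_id x).smul_const (p t))).hasDerivWithinAt)
      (C := M) (by simpa using h1) ht ht'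
  -- Taylor's formula on a unit interval: the velocity is the increment of q minus a remainder
  -- controlled by the second derivative.
  have h3 : p t = (q (t + 1) - q t) - ((q (t + 1) - (t + 1) • p t) - (q t - t • p t)) := by
    module
  rw [h3]
  refine (norm_sub_le _ _).trans ?_
  have h4 := norm_sub_le (q (t + 1)) (q t)
  have h5 : ‖t + 1 - t‖ = 1 := by simp
  rw [h5, mul_one] at h2
  linarith [hA _ ht, hA _ ht']

/-- Exponential decay for the delay equation, if `charOp` is invertible on the closed right half
plane and the force has compact support. -/
theorem IsDelaySolution.exists_decay [CompleteSpace V] (hΓ : Continuous Γ)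
    (h0 : ∀ t ≤ 0, Γ t = 0) (hh : ∀ t, h ≤ t → Γ t = 0)
    (hA : ∀ z : ℂ, 0 ≤ z.re → IsUnit (charOp ω Γ z)) :
    ∃ δ : ℝ, 0 < δ ∧ ∀ T₁ : ℝ, ∃ C : ℝ, 0 < C ∧ ∀ (F q p P : ℝ → V) (B : ℝ),
      IsDelaySolution ω Γ F q p P → 0 ≤ B → (∀ t, 0 ≤ t → ‖F t‖ ≤ B) → (∀ t, T₁ ≤ t → F t = 0) →
      ∀ t, 0 ≤ t → ‖q t‖ + ‖p t‖ ≤ C * Real.exp (-δ * t) * (‖q 0‖ + ‖p 0‖ + B) := by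
  set α := growthRate ω Γ with hα
  have hα1 : 1 ≤ α := one_le_growthRate ω Γ
  obtain ⟨δ₀, hδ₀, C₀, hC₀, hstrip₀⟩ := exists_strip_bound hΓ h0 hh hA (α + 1)
  -- The cap at 1 keeps the shifted contour in Re z ≥ -1, where the transform of the force is
  -- bounded.
  set δ := min δ₀ 1 with hδ
  have hδ0 : 0 < δ := lt_min hδ₀ one_pos
  have hδ1 : δ ≤ 1 := min_le_right _ _
  have hstrip : ∀ z : ℂ, -δ ≤ z.re → z.re ≤ α + 1 →
      IsUnit (charOp ω Γ z) ∧ ‖Ring.inverse (charOp ω Γ z)‖ ≤ C₀ / (1 + z.im ^ 2) :=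
    fun z h1 h2 => hstrip₀ z (by linarith [min_le_left δ₀ 1]) h2
  have hΓi : Integrable fun t => ‖Γ t‖ :=
    (hΓ.integrable_of_hasCompactSupport (hasCompactSupport_of_Icc h0 hh)).norm
  refine ⟨δ, hδ0, fun T₁ => ?_⟩
  -- After T the force F is gone, the cutoff equals 1, and the memory no longer reaches the interval
  -- where q was cut off.
  set T := max T₁ (max (1 + h) 1) with hT
  have hT1 : 1 ≤ T := (le_max_right _ _).trans (le_max_right _ _)
  have hTh : 1 + h ≤ T := (le_max_left _ _).trans (le_max_right _ _)
  obtain ⟨K, hK, hcut⟩ := IsDelaySolution.exists_forced (ω := ω) hΓ h0 hh hT1 hTh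
  set K₂ := C₀ * (Real.exp T * K) / 2 with hK₂
  have hK₂0 : 0 ≤ K₂ := by positivity
  set K₃ := K₂ + 2 * Real.exp ((α + δ) * T) with hK₃
  have hK₃0 : 0 < K₃ := by positivity
  -- Looking back over the memory length costs a factor e^{δ|h|} in the decay bound.
  set K₄ := K₃ * Real.exp (δ * |h|) with hK₄
  have hK₄0 : 0 < K₄ := by positivity
  have hK₃₄ : K₃ ≤ K₄ := le_mul_of_one_le_right hK₃0.le (Real.one_le_exp (by positivity))
  refine ⟨3 * K₄ + α * K₄, by positivity, fun F q p P B H hB hF hFT => ?_⟩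
  set N := ‖q 0‖ + ‖p 0‖ + B with hN
  have hN0 : 0 ≤ N := by positivity
  have hsmall : ∀ t, 0 ≤ t → t ≤ T →
      ‖q t‖ + ‖p t‖ ≤ 2 * Real.exp ((α + δ) * T) * N * Real.exp (-δ * t) := by
    intro t ht htT
    have h1 : Real.exp (α * t) ≤ Real.exp ((α + δ) * T) * Real.exp (-δ * t) := by
      rw [← Real.exp_add]
      refine Real.exp_le_exp.2 ?_
      nlinarith
    calc _ ≤ 2 * N * Real.exp (α * t) := H.norm_le_exp hΓi hB hF ht
      _ ≤ 2 * N * (Real.exp ((α + δ) * T) * Real.exp (-δ * t)) := by gcongr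
      _ = _ := by ring
  have hq : ∀ t, 0 ≤ t → ‖q t‖ ≤ K₃ * N * Real.exp (-δ * t) := by
    intro t ht
    have hX : 0 ≤ N * Real.exp (-δ * t) := by positivity
    rcases le_total t T with htT | htT
    · have h1 := hsmall t ht htT
      have h2 : 0 ≤ K₂ * (N * Real.exp (-δ * t)) := by positivity
      rw [hK₃]
      nlinarith [norm_nonneg (p t)]
    · obtain ⟨f, u, u₁, u₂, HF, hu, hfi⟩ := hcut F q p P B H hB hF
        fun t ht => hFT t ((le_max_left _ _).trans ht)
      have h1 := HF.norm_le hΓ h0 hh (δ := δ) (a := α + 1) (C := C₀)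
        (L := Real.exp T * (K * N)) (by linarith) (by linarith) hδ1 hstrip
        (fun z hz => (norm_laplaceTransform_le HF.continuous_f
          (fun t ht => (HF.past t ht).2.2.2) HF.future hz).trans
            (mul_le_mul_of_nonneg_left hfi (Real.exp_pos _).le)) ht
      rw [hu t (by linarith)] at h1
      refine h1.trans ?_
      have h2 : C₀ * (Real.exp T * (K * N)) / 2 * Real.exp (-δ * t) =
        K₂ * (N * Real.exp (-δ * t)) := by rw [hK₂]; ring
      have h3 : 0 ≤ Real.exp ((α + δ) * T) * (N * Real.exp (-δ * t)) := by positivity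
      rw [h2, hK₃]
      nlinarith
  intro t ht
  have hX : 0 ≤ N * Real.exp (-δ * t) := by positivity
  rcases le_total t T with htT | htT
  · refine (hsmall t ht htT).trans ?_
    have h1 : 2 * Real.exp ((α + δ) * T) ≤ 3 * K₄ + α * K₄ := by
      have : 0 ≤ α * K₄ := by positivity
      linarith
    calc _ = 2 * Real.exp ((α + δ) * T) * (N * Real.exp (-δ * t)) := by ring
      _ ≤ (3 * K₄ + α * K₄) * (N * Real.exp (-δ * t)) := by gcongr
      _ = _ := by ring
  have hq4 : ∀ s, 0 ≤ s → t - |h| ≤ s → ‖q s‖ ≤ K₄ * (N * Real.exp (-δ * t)) := by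
    intro s hs hts
    refine (hq s hs).trans ?_
    have : Real.exp (-δ * s) ≤ Real.exp (δ * |h|) * Real.exp (-δ * t) := by
      rw [← Real.exp_add]
      refine Real.exp_le_exp.2 ?_
      nlinarith
    calc _ ≤ K₃ * N * (Real.exp (δ * |h|) * Real.exp (-δ * t)) := by gcongr
      _ = _ := by rw [hK₄]; ring
  have hh0 := abs_nonneg h
  -- The contour shift bounds only q. The equation then bounds q'' by q on the memory window, and
  -- interpolation bounds p.
  have hp := norm_deriv_le_of_second_deriv (t := t) (M := α * (K₄ * (N * Real.exp (-δ * t))))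
    (A := K₄ * (N * Real.exp (-δ * t))) H.deriv_q H.deriv_p (by positivity)
    (fun s hs => by
      have h1 := H.norm_P_le hΓi (t := s) (M := K₄ * (N * Real.exp (-δ * t)))
        (by linarith [hs.1]) (by positivity) (fun r hr hrs hΓr => hq4 _ (by linarith) ?_)
        (hq4 _ (by linarith [hs.1]) (by linarith [hs.1]))
      · rwa [hFT s (((le_max_left _ _).trans htT).trans hs.1), norm_zero, add_zero] at h1
      · have : r < h := by
          by_contra hc
          exact hΓr (hh r (not_lt.1 hc))
        linarith [hs.1, le_abs_self h])
    (fun s hs => hq4 s (by linarith [hs.1]) (by linarith [hs.1]))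
  have := hq4 t ht (by linarith)
  calc _ ≤ 3 * (K₄ * (N * Real.exp (-δ * t))) + α * (K₄ * (N * Real.exp (-δ * t))) := by linarith
    _ = _ := by ring

end Delay

end

/-! ### The dispersion function has no zeros in the closed right half plane -/

section

open Set Filter Real

/-- z² + k² = (z + ik)(z - ik), and both factors have real part Re z. The oscillator denominators
thus stay away from zero uniformly in the frequency k. -/
theorem sq_re_le_norm_sq_add_sq (z : ℂ) (k : ℝ) : z.re ^ 2 ≤ ‖z ^ 2 + (k : ℂ) ^ 2‖ := by
  have h1 : z ^ 2 + (k : ℂ) ^ 2 = (z + k * Complex.I) * (z - k * Complex.I) := by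
    ring_nf
    rw [Complex.I_sq]
    ring
  have h2 := Complex.abs_re_le_norm (z + k * Complex.I)
  have h3 := Complex.abs_re_le_norm (z - k * Complex.I)
  simp only [Complex.add_re, Complex.sub_re, Complex.mul_re, Complex.ofReal_re, Complex.I_re,
    mul_zero, Complex.ofReal_im, Complex.I_im, mul_one, sub_self, add_zero, sub_zero] at h2 h3
  rw [h1, norm_mul, ← sq_abs, sq]
  gcongr

theorem integrableOn_mul_exp_neg_mul {a : ℝ} (ha : 0 < a) :
    IntegrableOn (fun t : ℝ => t * Real.exp (-a * t)) (Ioi 0) := by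
  have := integrableOn_rpow_mul_exp_neg_mul_rpow (s := 1) (p := 1) (by norm_num) one_pos ha
  simpa using this

theorem continuous_uncurry_sinSymbol : Continuous fun p : ℝ × E3 => sinSymbol p.1 p.2 := by
  unfold sinSymbol
  have := continuous_sinc
  fun_prop

theorem norm_cexp_mul_sinSymbol_le {z : ℂ} {t : ℝ} (ht : 0 ≤ t) (ξ : E3) :
    ‖Complex.exp (-z * t) * (sinSymbol t ξ : ℂ)‖ ≤ t * Real.exp (-z.re * t) := by
  rw [norm_mul, norm_cexp_neg_mul_ofReal, Complex.norm_real, Real.norm_eq_abs, mul_comm]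
  gcongr
  simpa [abs_of_nonneg ht] using abs_sinSymbol_le t ξ

/-- With w = z² + (2π|ξ|)², a primitive is -w⁻¹e^{-zt}(z·`sinSymbol` + `cosSymbol`), which tends to
0 at infinity and equals -w⁻¹ at t = 0. Working with `sinSymbol` avoids dividing by |ξ|. -/
theorem integral_cexp_mul_sinSymbol {z : ℂ} (hz : 0 < z.re) (ξ : E3) :
    ∫ t in Ioi (0 : ℝ), Complex.exp (-z * t) * (sinSymbol t ξ : ℂ) =
      (z ^ 2 + ((2 * π * ‖ξ‖ : ℝ) : ℂ) ^ 2)⁻¹ := by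
  set k : ℝ := 2 * π * ‖ξ‖ with hk
  set w : ℂ := z ^ 2 + (k : ℂ) ^ 2 with hw
  have hw0 : w ≠ 0 := by
    have := sq_re_le_norm_sq_add_sq z k
    rw [← hw] at this
    exact norm_pos_iff.1 (lt_of_lt_of_le (by positivity) this)
  have hd : ∀ t : ℝ, HasDerivAt (fun t : ℝ => -w⁻¹ * (Complex.exp (-z * t) *
      (z * (sinSymbol t ξ : ℂ) + (cosSymbol t ξ : ℂ))))
      (Complex.exp (-z * t) * (sinSymbol t ξ : ℂ)) t := by
    intro t
    have h1 : HasDerivAt (fun t : ℝ => Complex.exp (-z * t)) (Complex.exp (-z * t) * (-z * 1)) t :=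
      ((Complex.ofRealCLM.hasDerivAt (x := t)).const_mul (-z)).cexp
    have h2 := (hasDerivAt_sinSymbol ξ t).ofReal_comp
    have h3 := (hasDerivAt_cosSymbol ξ t).ofReal_comp
    refine ((h1.mul ((h2.const_mul z).add h3)).const_mul (-w⁻¹)).congr_deriv ?_
    simp only [Pi.add_apply]
    push_cast
    field_simp
    rw [hw, hk]
    push_cast
    ring
  have hint : IntegrableOn (fun t : ℝ => Complex.exp (-z * t) * (sinSymbol t ξ : ℂ)) (Ioi 0) := by
    refine (integrableOn_mul_exp_neg_mul hz).mono' (Continuous.aestronglyMeasurable ?_)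
      ((ae_restrict_iff' measurableSet_Ioi).2 (Eventually.of_forall fun t ht =>
        norm_cexp_mul_sinSymbol_le (le_of_lt ht) ξ))
    have := continuous_uncurry_sinSymbol.comp (by fun_prop : Continuous fun t : ℝ => (t, ξ))
    simp only [Function.comp_def] at this
    fun_prop
  have hlim : Tendsto (fun t : ℝ => -w⁻¹ * (Complex.exp (-z * t) *
      (z * (sinSymbol t ξ : ℂ) + (cosSymbol t ξ : ℂ)))) atTop (𝓝 0) := by
    rw [← mul_zero (-w⁻¹)]
    refine Tendsto.const_mul _ ?_
    have e1 := tendsto_rpow_mul_exp_neg_mul_atTop_nhds_zero 1 z.re hz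
    have e0 := tendsto_rpow_mul_exp_neg_mul_atTop_nhds_zero 0 z.re hz
    simp only [rpow_one, rpow_zero, one_mul] at e1 e0
    have e2 := (e1.const_mul ‖z‖).add e0
    rw [mul_zero, add_zero] at e2
    refine squeeze_zero_norm' ?_ e2
    filter_upwards [eventually_ge_atTop 0] with t ht
    rw [mul_add]
    refine (norm_add_le _ _).trans (add_le_add ?_ ?_)
    · have := norm_cexp_mul_sinSymbol_le (z := z) ht ξ
      rw [mul_left_comm, norm_mul]
      gcongr
    · rw [norm_mul, norm_cexp_neg_mul_ofReal, Complex.norm_real, Real.norm_eq_abs]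
      exact mul_le_of_le_one_right (Real.exp_pos _).le (abs_cosSymbol_le t ξ)
  rw [integral_Ioi_of_hasDerivAt_of_tendsto' (fun t _ => hd t) hint hlim]
  simp [sinSymbol, cosSymbol]

/-- The Laplace transform of a superposition of oscillators. -/
theorem laplaceTransform_oscillators {h : E3 → ℝ} (hi : Integrable h) {γ : ℝ → ℂ}
    (h0 : ∀ t ≤ 0, γ t = 0) (hγ : ∀ t, 0 < t → γ t = ((∫ ξ, sinSymbol t ξ * h ξ : ℝ) : ℂ))
    {z : ℂ} (hz : 0 < z.re) :
    laplaceTransform γ z = ∫ ξ, (h ξ : ℂ) / (z ^ 2 + ((2 * π * ‖ξ‖ : ℝ) : ℂ) ^ 2) := by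
  have h1 : laplaceTransform γ z = ∫ t in Ioi (0 : ℝ), ∫ ξ,
      Complex.exp (-z * t) * (sinSymbol t ξ : ℂ) * (h ξ : ℂ) := by
    rw [laplaceTransform, ← setIntegral_eq_integral_of_forall_compl_eq_zero (s := Ioi 0)
      fun t ht => by rw [h0 t (not_lt.1 ht), smul_zero]]
    refine setIntegral_congr_fun measurableSet_Ioi fun t ht => ?_
    simp only [hγ t ht, smul_eq_mul, mul_assoc]
    rw [integral_const_mul, ← integral_complex_ofReal]
    simp only [Complex.ofReal_mul]
  rw [h1, integral_integral_swap]
  · refine integral_congr_ae (Eventually.of_forall fun ξ => ?_)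
    simp only
    rw [integral_mul_const, integral_cexp_mul_sinSymbol hz, div_eq_inv_mul]
  · have := (integrableOn_mul_exp_neg_mul hz).mul_prod hi.norm
    refine this.mono' ?_ ?_
    · refine AEStronglyMeasurable.mul (Continuous.aestronglyMeasurable ?_) ?_
      · have := continuous_uncurry_sinSymbol
        fun_prop
      · exact Complex.continuous_ofReal.comp_aestronglyMeasurable hi.1.comp_snd
    · have : ∀ᵐ p : ℝ × E3 ∂((volume.restrict (Ioi 0)).prod volume), 0 < p.1 :=
        Measure.quasiMeasurePreserving_fst.ae
          (p := fun t : ℝ => 0 < t) (ae_restrict_mem measurableSet_Ioi)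
      filter_upwards [this] with p hp
      simp only [Function.uncurry]
      rw [norm_mul, Complex.norm_real]
      exact mul_le_mul_of_nonneg_right (norm_cexp_mul_sinSymbol_le hp.le _) (norm_nonneg _)

theorem integrable_div_oscillator {h : E3 → ℝ} (hc : Continuous h) (hi : Integrable h) {z : ℂ}
    (hz : 0 < z.re) :
    Integrable fun ξ => (h ξ : ℂ) / (z ^ 2 + ((2 * π * ‖ξ‖ : ℝ) : ℂ) ^ 2) := by
  have h0 : ∀ ξ : E3, z.re ^ 2 ≤ ‖z ^ 2 + ((2 * π * ‖ξ‖ : ℝ) : ℂ) ^ 2‖ :=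
    fun ξ => sq_re_le_norm_sq_add_sq z _
  have hz2 : 0 < z.re ^ 2 := by positivity
  refine (hi.norm.div_const (z.re ^ 2)).mono' (Continuous.aestronglyMeasurable ?_)
    (Eventually.of_forall fun ξ => ?_)
  · refine Continuous.div (by fun_prop) (by fun_prop) fun ξ => ?_
    exact norm_pos_iff.1 (hz2.trans_le (h0 ξ))
  · rw [norm_div, Complex.norm_real]
    gcongr
    exact h0 ξ

/-- A lower bound for the mass of `h` in thin spherical shells. -/
theorem exists_le_integral_shell {h : E3 → ℝ} (hc : Continuous h) {θ₀ : E3} (hθ₀ : ‖θ₀‖ = 1)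
    {b : ℝ} (hb : 0 < b) (hpos : 0 < h ((b / (2 * π)) • θ₀)) :
    ∃ c > 0, ∃ a₀ > 0, ∀ a, 0 < a → a ≤ a₀ → ∃ F : E3 → ℝ, (∀ ξ, 0 ≤ F ξ) ∧
      (∀ ξ, F ξ ≠ 0 → F ξ ≤ h ξ ∧ |2 * π * ‖ξ‖ - b| < a) ∧ c * a ≤ ∫ ξ, F ξ := by
  -- The resonant radius; by continuity h exceeds half of its value at r₀θ₀ when radius and
  -- direction are η-close to r₀ and θ₀.
  set r₀ := b / (2 * π) with hr₀
  set m := h (r₀ • θ₀) / 2 with hm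
  have hπ := Real.pi_pos
  have hcont : ContinuousAt (fun p : ℝ × E3 => h (p.1 • p.2)) (r₀, θ₀) := by fun_prop
  obtain ⟨η, hη, hball⟩ := Metric.eventually_nhds_iff.1
    (hcont.eventually_const_lt (show m < h (r₀ • θ₀) by linarith))
  set s := (sphereMeasure {θ | dist θ.1 θ₀ < η}).toReal with hs
  have hopen : IsOpen {θ : Metric.sphere (0 : E3) 1 | dist θ.1 θ₀ < η} :=
    isOpen_lt (by fun_prop) continuous_const
  have hs0 : 0 < s := ENNReal.toReal_pos
    (hopen.measure_pos _ ⟨⟨θ₀, by simp [hθ₀]⟩, by simpa using hη⟩).ne' (measure_ne_top _ _)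
  -- The constant collects the height m, the area s of the cap, the lower bound (b/4π)² for r², and
  -- the shell width a/π. The condition a ≤ b/2 keeps r ≥ b/(4π); a ≤ πη keeps the shell within η of
  -- r₀.
  refine ⟨m * s * ((b / (4 * π)) ^ 2 / π), by positivity, min (b / 2) (π * η), by positivity,
    fun a ha haa => ?_⟩
  have ha1 : a ≤ b / 2 := haa.trans (min_le_left _ _)
  have ha2 : a ≤ π * η := haa.trans (min_le_right _ _)
  set g : E3 → ℝ := fun θ => if dist θ θ₀ < η then m else 0 with hg
  set I : Set ℝ := Ioo ((b - a) / (2 * π)) ((b + a) / (2 * π)) with hI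
  set k : ℝ → ℝ := I.indicator fun _ => 1 with hk
  have hI0 : ∀ r ∈ I, b / (4 * π) ≤ r := by
    intro r hr
    refine le_trans ?_ hr.1.le
    rw [div_le_div_iff₀ (by positivity) (by positivity)]
    nlinarith
  have hImem : ∀ r ∈ I, |2 * π * r - b| < a := by
    intro r hr
    have h1 := (div_lt_iff₀ (by positivity)).1 hr.1
    have h2 := (lt_div_iff₀ (by positivity)).1 hr.2
    rw [abs_lt]
    constructor <;> linarith
  have hm0 : 0 < m := by positivity
  have hg0 : ∀ θ, 0 ≤ g θ := fun θ => by simp only [hg]; split_ifs <;> positivity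
  have hk0 : ∀ r, 0 ≤ k r := fun r => indicator_nonneg (fun _ _ => zero_le_one) r
  -- A minorant of product form, cap times shell, whose polar integral factors.
  refine ⟨fun ξ => g (‖ξ‖⁻¹ • ξ) * k ‖ξ‖, fun ξ => mul_nonneg (hg0 _) (hk0 _), fun ξ hξ => ?_, ?_⟩
  · have h1 : dist (‖ξ‖⁻¹ • ξ) θ₀ < η := by
      by_contra hc
      exact hξ (by simp [hg, hc])
    have h2 : ‖ξ‖ ∈ I := by
      by_contra hc
      exact hξ (by simp [hk, hc])
    have h3 : ‖ξ‖ ≠ 0 := (lt_of_lt_of_le (by positivity) (hI0 _ h2)).ne'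
    have h4 := hImem _ h2
    refine ⟨?_, h4⟩
    have h5 : dist (‖ξ‖, ‖ξ‖⁻¹ • ξ) (r₀, θ₀) < η := by
      rw [Prod.dist_eq, max_lt_iff]
      refine ⟨?_, h1⟩
      have h6 : ‖ξ‖ - r₀ = (2 * π * ‖ξ‖ - b) / (2 * π) := by
        rw [hr₀]; field_simp
      rw [Real.dist_eq, h6, abs_div, abs_of_pos (by positivity : 0 < 2 * π),
        div_lt_iff₀ (by positivity)]
      nlinarith
    have h7 := hball h5
    simp only [smul_smul, mul_inv_cancel₀ h3, one_smul] at h7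
    simp only [hg, hk, h1, if_true, indicator_of_mem h2, mul_one]
    exact h7.le
  · rw [integral_polar_mul _ g k]
    · have h1 : ∫ θ, g θ.1 ∂sphereMeasure = m * s := by
        have : (fun θ : Metric.sphere (0 : E3) 1 => g θ.1) =
          {θ : Metric.sphere (0 : E3) 1 | dist θ.1 θ₀ < η}.indicator fun _ => m := by
          ext θ
          simp [hg, indicator_apply]
        rw [this, integral_indicator hopen.measurableSet, setIntegral_const, smul_eq_mul, mul_comm]
        rfl
      have h2 : ∫ r in Ioi (0 : ℝ), r ^ 2 * k r = ∫ r in I, r ^ 2 := by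
        have : (fun r => r ^ 2 * k r) = I.indicator fun r => r ^ 2 := by
          ext r
          simp [hk, indicator_apply]
        rw [this, integral_indicator measurableSet_Ioo, Measure.restrict_restrict measurableSet_Ioo,
          inter_eq_self_of_subset_left]
        exact fun r hr => lt_of_lt_of_le (by positivity) (hI0 r hr)
      have h3 : ∫ _ in I, (b / (4 * π)) ^ 2 ≤ ∫ r in I, r ^ 2 := by
        refine setIntegral_mono_on (by simp [hI]) ?_ measurableSet_Ioo fun r hr => ?_
        · exact (Continuous.integrableOn_Icc (by fun_prop)).mono_set Ioo_subset_Icc_self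
        · have := hI0 r hr
          gcongr
      rw [setIntegral_const, measureReal_def, Real.volume_Ioo, ENNReal.toReal_ofReal (by
        rw [← sub_div]; apply div_nonneg <;> linarith), smul_eq_mul] at h3
      have h4 : (b + a) / (2 * π) - (b - a) / (2 * π) = a / π := by field_simp; ring
      rw [h4] at h3
      rw [h1, h2]
      calc _ = m * s * (a / π * (b / (4 * π)) ^ 2) := by ring
        _ ≤ _ := by gcongr
    · intro θ r hr
      have : ‖θ.1‖ = 1 := by simp
      simp only [norm_smul, this, mul_one, Real.norm_eq_abs, abs_of_pos hr, smul_smul,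
        inv_mul_cancel₀ hr.ne', one_smul]

/-- Nonvanishing of the dispersion function `z² + ω² - ∫ h / (z² + κ²)` in the closed right half
plane; on the imaginary axis it is understood as a boundary value. -/
theorem dispersion_ne_zero {h : E3 → ℝ} (hc : Continuous h) (hi : Integrable h)
    (h0 : ∀ ξ, 0 ≤ h ξ) {ω N : ℝ} (hN : 0 < N)
    (hi' : Integrable fun ξ => h ξ / (2 * π * ‖ξ‖) ^ 2)
    (hA : ∫ ξ, h ξ / (2 * π * ‖ξ‖) ^ 2 < ω ^ 2 * N)
    (hpos : ∀ r : ℝ, 0 < r → ∃ θ : E3, ‖θ‖ = 1 ∧ 0 < h (r • θ))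
    {Q : ℂ → ℂ} (hQc : Continuous Q)
    (hQ : ∀ z : ℂ, 0 < z.re → Q z = (z ^ 2 + (ω : ℂ) ^ 2) * N -
      ∫ ξ, (h ξ : ℂ) / (z ^ 2 + ((2 * π * ‖ξ‖ : ℝ) : ℂ) ^ 2))
    {z : ℂ} (hz : 0 ≤ z.re) : Q z ≠ 0 := by
  -- On the positive axis each denominator only grows compared with a = 0. The lower bound is
  -- independent of a, hence survives the limit a → 0 and covers z = 0.
  have hre : ∀ a : ℝ, 0 < a →
      ω ^ 2 * N - ∫ ξ, h ξ / (2 * π * ‖ξ‖) ^ 2 ≤ (Q a).re := by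
    intro a ha
    have h1 : ∀ ξ : E3, (h ξ : ℂ) / ((a : ℂ) ^ 2 + ((2 * π * ‖ξ‖ : ℝ) : ℂ) ^ 2) =
        ((h ξ / (a ^ 2 + (2 * π * ‖ξ‖) ^ 2) : ℝ) : ℂ) := fun ξ => by push_cast; rfl
    have h2 : (∫ ξ, h ξ / (a ^ 2 + (2 * π * ‖ξ‖) ^ 2)) ≤ ∫ ξ, h ξ / (2 * π * ‖ξ‖) ^ 2 := by
      refine integral_mono_of_nonneg (Eventually.of_forall fun ξ => ?_) hi' ?_
      · have := h0 ξ
        positivity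
      · filter_upwards [compl_mem_ae_iff.2 (measure_singleton (0 : E3))] with ξ hξ
        have : 0 < ‖ξ‖ := norm_pos_iff.2 hξ
        have := h0 ξ
        gcongr
        nlinarith
    rw [hQ a (by simpa using ha)]
    simp only [h1]
    rw [integral_complex_ofReal]
    have h3 : (((a : ℂ) ^ 2 + (ω : ℂ) ^ 2) * N - ((∫ ξ, h ξ / (a ^ 2 + (2 * π * ‖ξ‖) ^ 2) : ℝ) : ℂ))
      = (((a ^ 2 + ω ^ 2) * N - ∫ ξ, h ξ / (a ^ 2 + (2 * π * ‖ξ‖) ^ 2) : ℝ) : ℂ) := by push_cast; rfl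
    rw [h3, Complex.ofReal_re]
    have : 0 ≤ a ^ 2 * N := by positivity
    linarith
  -- The imaginary part 2 Re z Im z of the denominator does not depend on ξ, so Im z · Im Q is a sum
  -- of two terms of the same sign.
  have him : ∀ z : ℂ, 0 < z.re → (Integrable fun ξ : E3 =>
      h ξ / ‖z ^ 2 + ((2 * π * ‖ξ‖ : ℝ) : ℂ) ^ 2‖ ^ 2) ∧ z.im * (Q z).im = 2 * z.re * z.im ^ 2 *
      (N + ∫ ξ, h ξ / ‖z ^ 2 + ((2 * π * ‖ξ‖ : ℝ) : ℂ) ^ 2‖ ^ 2) := by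
    intro z hz
    have hD : ∀ ξ : E3, (z ^ 2 + ((2 * π * ‖ξ‖ : ℝ) : ℂ) ^ 2).im = 2 * z.re * z.im := by
      intro ξ
      rw [Complex.add_im, ← Complex.ofReal_pow, Complex.ofReal_im, sq, Complex.mul_im]
      ring
    have hD0 : ∀ ξ : E3, z.re ^ 2 ≤ ‖z ^ 2 + ((2 * π * ‖ξ‖ : ℝ) : ℂ) ^ 2‖ :=
      fun ξ => sq_re_le_norm_sq_add_sq z _
    have hz2 : 0 < z.re ^ 2 := by positivity
    have i1 : Integrable fun ξ : E3 => h ξ / ‖z ^ 2 + ((2 * π * ‖ξ‖ : ℝ) : ℂ) ^ 2‖ ^ 2 := by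
      refine (hi.div_const ((z.re ^ 2) ^ 2)).mono' (Continuous.aestronglyMeasurable ?_)
        (Eventually.of_forall fun ξ => ?_)
      · refine Continuous.div (by fun_prop) (by fun_prop) fun ξ => ?_
        exact pow_ne_zero _ (hz2.trans_le (hD0 ξ)).ne'
      · rw [Real.norm_of_nonneg (div_nonneg (h0 ξ) (sq_nonneg _))]
        have := h0 ξ
        have := hD0 ξ
        gcongr
    refine ⟨i1, ?_⟩
    have h1 : (∫ ξ, (h ξ : ℂ) / (z ^ 2 + ((2 * π * ‖ξ‖ : ℝ) : ℂ) ^ 2)).im =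
        ∫ ξ, -(2 * z.re * z.im) * (h ξ / ‖z ^ 2 + ((2 * π * ‖ξ‖ : ℝ) : ℂ) ^ 2‖ ^ 2) := by
      have := Complex.imCLM.integral_comp_comm (integrable_div_oscillator hc hi hz)
      simp only [Complex.imCLM_apply] at this
      rw [← this]
      refine integral_congr_ae (Eventually.of_forall fun ξ => ?_)
      simp only [Complex.div_im, hD, Complex.ofReal_re, Complex.ofReal_im, Complex.normSq_eq_norm_sq]
      ring
    have h2 : ((z ^ 2 + (ω : ℂ) ^ 2) * N).im = 2 * z.re * z.im * N := by
      rw [Complex.im_mul_ofReal, Complex.add_im, ← Complex.ofReal_pow, Complex.ofReal_im, sq,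
        Complex.mul_im]
      ring
    rw [hQ z hz, Complex.sub_im, h1, h2, integral_const_mul]
    ring
  have hlim : ∀ b : ℝ, Tendsto (fun a : ℝ => Q (a + b * Complex.I)) (𝓝[>] 0)
      (𝓝 (Q (b * Complex.I))) := by
    intro b
    have : Continuous fun a : ℝ => Q (a + b * Complex.I) := by fun_prop
    simpa using (this.tendsto 0).mono_left nhdsWithin_le_nhds
  have hev : ∀ᶠ a : ℝ in 𝓝[>] 0, 0 < a := self_mem_nhdsWithin
  intro hQz
  rcases hz.lt_or_eq with hz | hz
  · rcases eq_or_ne z.im 0 with hz0 | hz0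
    · have h1 := hre z.re hz
      have h2 : ((z.re : ℝ) : ℂ) = z := by apply Complex.ext <;> simp [hz0]
      rw [h2, hQz, Complex.zero_re] at h1
      linarith
    · have h1 := (him z hz).2
      rw [hQz, Complex.zero_im, mul_zero] at h1
      have h2 : 0 ≤ ∫ ξ, h ξ / ‖z ^ 2 + ((2 * π * ‖ξ‖ : ℝ) : ℂ) ^ 2‖ ^ 2 :=
        integral_nonneg fun ξ => div_nonneg (h0 ξ) (sq_nonneg _)
      have h3 : 0 < z.im ^ 2 := by positivity
      have : 0 < 2 * z.re * z.im ^ 2 *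
        (N + ∫ ξ, h ξ / ‖z ^ 2 + ((2 * π * ‖ξ‖ : ℝ) : ℂ) ^ 2‖ ^ 2) := by positivity
      linarith
  · have hzI : z = z.im * Complex.I := by apply Complex.ext <;> simp [← hz]
    rcases eq_or_ne z.im 0 with hz0 | hz0
    · have h1 := ge_of_tendsto ((Complex.continuous_re.tendsto _).comp (hlim 0))
        (b := ω ^ 2 * N - ∫ ξ, h ξ / (2 * π * ‖ξ‖) ^ 2)
        (hev.mono fun a ha => by
          have := hre a ha
          rwa [show (a : ℂ) = a + (0 : ℝ) * Complex.I by simp] at this)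
      rw [hz0] at hzI
      rw [← hzI, hQz, Complex.zero_re] at h1
      linarith
    · set b := z.im with hb
      have hb0 : 0 < |b| := abs_pos.2 hz0
      have hπ := Real.pi_pos
      obtain ⟨θ, hθ, hhθ⟩ := hpos (|b| / (2 * π)) (by positivity)
      obtain ⟨c, hc0, a₀, ha₀, hF⟩ := exists_le_integral_shell hc hθ hb0 hhθ
      -- The prefactor 2ab² vanishes as a → 0, but the resonance compensates: in the shell of width
      -- of order a, of mass at least ca, the squared denominator is at most 20a²b², and 2ab² ·
      -- ca/(20a²b²) = c/10.
      have hlow : ∀ᶠ a : ℝ in 𝓝[>] 0, c / 10 ≤ b * (Q (a + b * Complex.I)).im := by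
        filter_upwards [Ioo_mem_nhdsGT (lt_min ha₀ hb0)] with a ha
        have ha0 : 0 < a := ha.1
        have hab : a ≤ |b| := (ha.2.trans_le (min_le_right _ _)).le
        obtain ⟨F, hF0, hF1, hF2⟩ := hF a ha0 (ha.2.trans_le (min_le_left _ _)).le
        have hre' : (a + b * Complex.I : ℂ).re = a := by simp
        have him' : (a + b * Complex.I : ℂ).im = b := by simp
        obtain ⟨i1, e1⟩ := him (a + b * Complex.I) (by rw [hre']; exact ha0)
        rw [hre', him'] at e1
        rw [e1]
        have h2 : ∫ ξ, F ξ / (20 * a ^ 2 * b ^ 2) ≤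
            ∫ ξ, h ξ / ‖(a + b * Complex.I : ℂ) ^ 2 + ((2 * π * ‖ξ‖ : ℝ) : ℂ) ^ 2‖ ^ 2 := by
          refine integral_mono_of_nonneg (Eventually.of_forall fun ξ =>
            div_nonneg (hF0 ξ) (by positivity)) i1 (Eventually.of_forall fun ξ => ?_)
          simp only
          rcases eq_or_ne (F ξ) 0 with h3 | h3
          · rw [h3, zero_div]
            exact div_nonneg (h0 ξ) (sq_nonneg _)
          · obtain ⟨h4, h5⟩ := hF1 ξ h3
            set k : ℝ := 2 * π * ‖ξ‖ with hk
            have hk0 : 0 ≤ k := by positivity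
            have e2 : ‖(a + b * Complex.I : ℂ) ^ 2 + (k : ℂ) ^ 2‖ ^ 2 =
                (a ^ 2 + (k ^ 2 - |b| ^ 2)) ^ 2 + 4 * a ^ 2 * b ^ 2 := by
              have : (a + b * Complex.I : ℂ) ^ 2 + (k : ℂ) ^ 2 =
                  ((a ^ 2 + (k ^ 2 - b ^ 2) : ℝ) : ℂ) + ((2 * a * b : ℝ) : ℂ) * Complex.I := by
                push_cast
                linear_combination (b : ℂ) ^ 2 * Complex.I_sq
              rw [this, ← Complex.normSq_eq_norm_sq, Complex.normSq_add_mul_I, sq_abs]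
              ring
            -- In the shell k + |b| ≤ 3|b|, so |k² - b²| ≤ 3a|b|, and a² ≤ a|b|. Squaring gives
            -- 16a²b², which with the imaginary part 4a²b² makes 20a²b².
            have h6 : |a ^ 2 + (k ^ 2 - |b| ^ 2)| ≤ 4 * a * |b| := by
              have h7 : |k ^ 2 - |b| ^ 2| ≤ a * (3 * |b|) := by
                rw [sq_sub_sq, abs_mul, abs_of_nonneg (by positivity), mul_comm]
                have := (abs_lt.1 h5).2
                gcongr
                linarith
              have h8 : a ^ 2 ≤ a * |b| := by nlinarith
              refine (abs_add_le _ _).trans ?_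
              rw [abs_of_nonneg (sq_nonneg a)]
              linarith
            have h9 : (a ^ 2 + (k ^ 2 - |b| ^ 2)) ^ 2 ≤ 16 * a ^ 2 * b ^ 2 := by
              refine (sq_le_sq' (abs_le.1 h6).1 (abs_le.1 h6).2).trans (le_of_eq ?_)
              rw [mul_pow, sq_abs]
              ring
            have h10 : 0 < 4 * a ^ 2 * b ^ 2 := by positivity
            rw [e2]
            refine div_le_div₀ (h0 ξ) h4 (by positivity) (by linarith)
        rw [integral_div] at h2
        have h3 : c * a / (20 * a ^ 2 * b ^ 2) ≤ (∫ ξ, F ξ) / (20 * a ^ 2 * b ^ 2) := by gcongr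
        calc c / 10 = 2 * a * b ^ 2 * (c * a / (20 * a ^ 2 * b ^ 2)) := by
              field_simp
              norm_num
          _ ≤ _ := by
            gcongr
            linarith
      have h1 := ge_of_tendsto (((Complex.continuous_im.tendsto _).comp (hlim b)).const_mul b) hlow
      rw [← hzI, hQz, Complex.zero_im, mul_zero] at h1
      linarith

end

/-! ### Spectral representation of the memory and invertibility -/

section

open Set Filter Real FourierTransform ComplexConjugate

theorem IsTestFunction.invHat_partialDeriv {f : E3 → ℝ} (hf : IsTestFunction f) (i : Fin 3)
    (ξ : E3) : invHat (FieldParticle.partialDeriv i f) ξ = -(2 * π * Complex.I) * (ξ i * invHat f ξ) := by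
  have h1 : (fun x => (FieldParticle.partialDeriv i f x : ℂ)) =
      (LineDeriv.lineDerivOp (EuclideanSpace.single i (1 : ℝ)) hf.toSchwartz : SchwartzMap E3 ℂ) := by
    ext x
    rw [SchwartzMap.lineDerivOp_apply_eq_fderiv, hf.toSchwartz_coe, partialDeriv_eq_fderiv]
    have := (Complex.ofRealCLM.hasFDerivAt (x := f x)).comp x
      ((hf.1.differentiable (by simp)) x).hasFDerivAt
    have h2 := this.fderiv
    simp only [Function.comp_def, Complex.ofRealCLM_apply] at h2
    rw [h2]
    simp
  rw [invHat, h1, ← SchwartzMap.fourierInv_coe, SchwartzMap.fourierInv_lineDerivOp_eq,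
    hf.invHat_eq]
  have hg : Function.HasTemperateGrowth fun x : E3 => inner ℝ x (EuclideanSpace.single i (1 : ℝ)) :=
    by fun_prop
  rw [smul_apply, SchwartzMap.smulLeftCLM_apply_apply hg, EuclideanSpace.inner_single_right]
  simp

theorem invHat_apply (f : E3 → ℝ) (ξ : E3) :
    invHat f ξ = ∫ x, Complex.exp ((2 * π * inner ℝ x ξ : ℝ) * Complex.I) * f x := by
  rw [invHat, Real.fourierInv_eq']
  rfl

theorem fourier_ofReal_eq_conj (f : E3 → ℝ) (ξ : E3) :
    𝓕 (fun x => (f x : ℂ)) ξ = conj (invHat f ξ) := by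
  rw [invHat_apply, ← integral_conj, Real.fourier_eq']
  refine integral_congr_ae (Eventually.of_forall fun x => ?_)
  simp only [map_mul, ← Complex.exp_conj, Complex.conj_ofReal, Complex.conj_I, smul_eq_mul]
  congr 2
  push_cast
  ring

theorem IsTestFunction.norm_invHat_le {f : E3 → ℝ} (ξ : E3) :
    ‖invHat f ξ‖ ≤ ∫ x, |f x| := by
  rw [invHat_apply]
  refine (norm_integral_le_integral_norm _).trans (le_of_eq ?_)
  refine integral_congr_ae (Eventually.of_forall fun x => ?_)
  simp only [norm_mul, Complex.norm_exp_ofReal_mul_I, one_mul, Complex.norm_real, Real.norm_eq_abs]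

theorem fourierHat_two_pi_smul (f : E3 → ℝ) (ξ : E3) :
    fourierHat f ((2 * π) • ξ) = invHat f ξ := by
  rw [fourierHat, invHat_apply]
  refine integral_congr_ae (Eventually.of_forall fun x => ?_)
  simp only [inner_smul_left, real_inner_comm x ξ]
  congr 2
  simp
  ring

theorem IsTestFunction.integrable_pow_mul_invHat_sq {f : E3 → ℝ} (hf : IsTestFunction f) (n : ℕ) :
    Integrable fun ξ => ‖ξ‖ ^ n * ‖invHat f ξ‖ ^ 2 := by
  have hc := hf.continuous_invHat
  refine ((hf.integrable_pow_mul_invHat n).mul_const (∫ x, |f x|)).mono'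
    (Continuous.aestronglyMeasurable (by fun_prop)) (Eventually.of_forall fun ξ => ?_)
  rw [Real.norm_of_nonneg (by positivity), sq, ← mul_assoc]
  gcongr
  exact IsTestFunction.norm_invHat_le ξ

/-- Spectral representation of the memory kernel. -/
theorem memoryKernel_eq_integral {f g : E3 → ℝ} (hf : IsTestFunction f) (hg : IsTestFunction g)
    (t : ℝ) : (memoryKernel g f t : ℂ) =
      ((∫ ξ, conj (invHat g ξ) * ((sinSymbol t ξ : ℂ) * invHat f ξ)).re : ℂ) := by
  have hgi : Integrable fun x => (g x : ℂ) := hg.integrable.ofReal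
  have hS := (quadraticGrowth_sinSymbol t).integrable hf
  have h1 := VectorFourier.integral_fourierIntegral_smul_eq_flip (μ := (volume : Measure E3))
    (ν := (volume : Measure E3)) (L := innerₗ E3) Real.continuous_fourierChar
    (by simpa using continuous_inner) hgi hS
  rw [flip_innerₗ] at h1
  have h2 : ∫ ξ, conj (invHat g ξ) * ((sinSymbol t ξ : ℂ) * invHat f ξ) =
      ∫ x, (g x : ℂ) * 𝓕 (fun ξ => (sinSymbol t ξ : ℂ) * invHat f ξ) x := by
    simp only [← fourier_ofReal_eq_conj]
    exact h1
  have hW : Continuous (𝓕 (fun ξ => (sinSymbol t ξ : ℂ) * invHat f ξ)) :=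
    (Real.contDiff_fourier (N := 0) fun n _ =>
      (quadraticGrowth_sinSymbol t).integrable_pow hf n).continuous
  have h3 : Integrable fun x => (g x : ℂ) * 𝓕 (fun ξ => (sinSymbol t ξ : ℂ) * invHat f ξ) x :=
    Continuous.integrable_of_hasCompactSupport
      ((Complex.continuous_ofReal.comp hg.continuous).mul hW)
      (HasCompactSupport.mul_right (hg.2.comp_left (g := Complex.ofReal) Complex.ofReal_zero))
  rw [h2]
  have h4 := Complex.reCLM.integral_comp_comm h3
  simp only [Complex.reCLM_apply, Complex.re_ofReal_mul] at h4
  rw [← h4]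
  rfl

theorem memoryKernel_partialDeriv {f : E3 → ℝ} (hf : IsTestFunction f) (i j : Fin 3) (t : ℝ) :
    memoryKernel (partialDeriv j f) (partialDeriv i f) t =
      ∫ ξ, ξ i * ξ j * (sinSymbol t ξ * ((2 * π) ^ 2 * ‖invHat f ξ‖ ^ 2)) := by
  have h := memoryKernel_eq_integral (hf.partialDeriv i) (hf.partialDeriv j) t
  have h1 : ∀ ξ, conj (invHat (partialDeriv j f) ξ) *
      ((sinSymbol t ξ : ℂ) * invHat (partialDeriv i f) ξ) =
      ((ξ i * ξ j * (sinSymbol t ξ * ((2 * π) ^ 2 * ‖invHat f ξ‖ ^ 2)) : ℝ) : ℂ) := by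
    intro ξ
    rw [hf.invHat_partialDeriv, hf.invHat_partialDeriv]
    have := Complex.mul_conj' (invHat f ξ)
    simp only [map_mul, map_neg, Complex.conj_ofReal, Complex.conj_I, map_ofNat]
    push_cast
    linear_combination (4 * π ^ 2 * ξ i * ξ j * sinSymbol t ξ : ℂ) * this -
      (4 * π ^ 2 * ξ i * ξ j * sinSymbol t ξ : ℂ) * invHat f ξ * conj (invHat f ξ) *
        (Complex.I_sq)
  simp only [h1, integral_complex_ofReal, Complex.ofReal_re] at h
  exact_mod_cast h

section Spectral

variable {d : ℕ} {ρ : Fin d → E3 → ℝ}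

/-- The spectral density of the form factor. -/
def spectralWeight (ρ : Fin d → E3 → ℝ) (ξ : E3) : ℝ := ∑ n, (2 * π) ^ 2 * ‖invHat (ρ n) ξ‖ ^ 2

theorem spectralWeight_nonneg (ρ : Fin d → E3 → ℝ) (ξ : E3) : 0 ≤ spectralWeight ρ ξ :=
  Finset.sum_nonneg fun n _ => by positivity

theorem continuous_spectralWeight (hρ : ∀ n, IsTestFunction (ρ n)) :
    Continuous (spectralWeight ρ) := by
  unfold spectralWeight
  refine continuous_finsetSum _ fun n _ => ?_
  have := (hρ n).continuous_invHat
  fun_prop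

theorem integrable_pow_mul_spectralWeight (hρ : ∀ n, IsTestFunction (ρ n)) (k : ℕ) :
    Integrable fun ξ => ‖ξ‖ ^ k * spectralWeight ρ ξ := by
  simp only [spectralWeight, Finset.mul_sum]
  refine integrable_finsetSum _ fun n _ => ?_
  refine (((hρ n).integrable_pow_mul_invHat_sq k).const_mul ((2 * π) ^ 2)).congr
    (Eventually.of_forall fun ξ => ?_)
  simp only
  ring

theorem abs_apply_mul_apply_le (ξ : E3) (i j : Fin 3) : |ξ i * ξ j| ≤ ‖ξ‖ ^ 2 := by
  rw [abs_mul, sq]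
  have h1 : |ξ i| ≤ ‖ξ‖ := PiLp.norm_apply_le ξ i
  have h2 : |ξ j| ≤ ‖ξ‖ := PiLp.norm_apply_le ξ j
  gcongr

/-- The memory matrix. -/
def memoryMatrix (ρ : Fin d → E3 → ℝ) (t : ℝ) : Matrix (Fin 3) (Fin 3) ℝ :=
  Matrix.of fun i j => ∑ n, memoryKernel (partialDeriv j (ρ n)) (partialDeriv i (ρ n)) t

theorem integrable_quadratic_sinSymbol {m : E3 → ℝ} (hm : Continuous m)
    (hi : Integrable fun ξ => ‖ξ‖ ^ 2 * m ξ) (t : ℝ) (i j : Fin 3) :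
    Integrable fun ξ : E3 => ξ i * ξ j * (sinSymbol t ξ * m ξ) := by
  have := continuous_sinSymbol t
  refine (hi.norm.const_mul |t|).mono' (Continuous.aestronglyMeasurable (by fun_prop))
    (Eventually.of_forall fun ξ => ?_)
  simp only [norm_mul, norm_pow, Real.norm_eq_abs, abs_norm]
  have h1 := abs_apply_mul_apply_le ξ i j
  have h2 := abs_sinSymbol_le t ξ
  rw [abs_mul] at h1
  calc _ = |sinSymbol t ξ| * (|ξ i| * |ξ j| * |m ξ|) := by ring
    _ ≤ _ := by gcongr

theorem memoryMatrix_apply (hρ : ∀ n, IsTestFunction (ρ n)) (t : ℝ) (i j : Fin 3) :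
    memoryMatrix ρ t i j = ∫ ξ : E3, ξ i * ξ j * (sinSymbol t ξ * spectralWeight ρ ξ) := by
  simp only [memoryMatrix, Matrix.of_apply, memoryKernel_partialDeriv (hρ _), spectralWeight,
    Finset.mul_sum]
  rw [integral_finsetSum]
  intro n _
  have := (hρ n).continuous_invHat
  refine integrable_quadratic_sinSymbol (by fun_prop) ?_ t i j
  refine (((hρ n).integrable_pow_mul_invHat_sq 2).const_mul ((2 * π) ^ 2)).congr
    (Eventually.of_forall fun ξ => ?_)
  simp only
  ring

theorem integrable_quadratic_div (hρ : ∀ n, IsTestFunction (ρ n)) (i j : Fin 3) :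
    Integrable fun ξ : E3 => ξ i * ξ j * (spectralWeight ρ ξ / (2 * π * ‖ξ‖) ^ 2) := by
  have hc := continuous_spectralWeight hρ
  have h := integrable_pow_mul_spectralWeight hρ 0
  simp only [pow_zero, one_mul] at h
  refine (h.norm.const_mul ((2 * π) ^ 2)⁻¹).mono' (Measurable.aestronglyMeasurable (by fun_prop))
    (Eventually.of_forall fun ξ => ?_)
  have h1 := abs_apply_mul_apply_le ξ i j
  rw [norm_mul, norm_div, Real.norm_eq_abs (ξ i * ξ j), mul_pow, norm_mul, norm_pow (‖ξ‖), norm_norm,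
    Real.norm_of_nonneg (by positivity : 0 ≤ (2 * π) ^ 2)]
  rcases eq_or_ne ξ 0 with rfl | hξ
  · simp
    positivity
  · have : 0 < ‖ξ‖ := norm_pos_iff.2 hξ
    calc |ξ i * ξ j| * (‖spectralWeight ρ ξ‖ / ((2 * π) ^ 2 * ‖ξ‖ ^ 2)) ≤
        ‖ξ‖ ^ 2 * (‖spectralWeight ρ ξ‖ / ((2 * π) ^ 2 * ‖ξ‖ ^ 2)) := by gcongr
      _ = _ := by field_simp

/-- The substitution k = 2πξ absorbs (2π)⁻³. In this form K is the value at z = 0 of the integral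
that represents Γ̂(z), which is how the positivity of ω² - K enters. -/
theorem couplingMatrix_apply (hρ : ∀ n, IsTestFunction (ρ n)) (i j : Fin 3) :
    couplingMatrix ρ i j =
      ∫ ξ : E3, ξ i * ξ j * (spectralWeight ρ ξ / (2 * π * ‖ξ‖) ^ 2) := by
  have h1 : ∀ n, 1 / (2 * π) ^ 3 *
      ∫ k : E3, k i * k j * ‖fourierHat (ρ n) k‖ ^ 2 / ‖k‖ ^ 2 =
      ∫ ξ : E3, ξ i * ξ j * (((2 * π) ^ 2 * ‖invHat (ρ n) ξ‖ ^ 2) / (2 * π * ‖ξ‖) ^ 2) := by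
    intro n
    have h := Measure.integral_comp_smul (volume : Measure E3)
      (fun k : E3 => k i * k j * ‖fourierHat (ρ n) k‖ ^ 2 / ‖k‖ ^ 2) (2 * π)
    have h2 : (0 : ℝ) < 2 * π := by positivity
    rw [finrank_euclideanSpace_fin, abs_of_pos (by positivity), smul_eq_mul] at h
    rw [one_div, ← h]
    refine integral_congr_ae (Eventually.of_forall fun ξ => ?_)
    simp only [fourierHat_two_pi_smul, norm_smul, Real.norm_of_nonneg h2.le, PiLp.smul_apply,
      smul_eq_mul]
    ring
  simp only [couplingMatrix, Matrix.of_apply, h1, spectralWeight, Finset.sum_div, Finset.mul_sum]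
  rw [integral_finsetSum]
  intro n _
  have h3 := integrable_quadratic_div (ρ := fun _ : Fin 1 => ρ n) (fun _ => hρ n) i j
  simpa [spectralWeight] using h3

/-- The quadratic form of a matrix of second moments. -/
theorem sum_conj_mul_integral_mul {m : E3 → ℝ}
    (hm : ∀ i j : Fin 3, Integrable fun ξ : E3 => ξ i * ξ j * m ξ) (v : EuclideanSpace ℂ (Fin 3)) :
    ∑ i, ∑ j, conj (v i) * ((∫ ξ : E3, ξ i * ξ j * m ξ : ℝ) : ℂ) * v j =
      ((∫ ξ : E3, ‖∑ j, (ξ j : ℂ) * v j‖ ^ 2 * m ξ : ℝ) : ℂ) := by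
  have h1 : ∀ i j : Fin 3, conj (v i) * ((∫ ξ : E3, ξ i * ξ j * m ξ : ℝ) : ℂ) * v j =
      ∫ ξ : E3, conj (v i) * ((ξ i * ξ j * m ξ : ℝ) : ℂ) * v j := by
    intro i j
    rw [integral_mul_const, integral_const_mul, integral_complex_ofReal]
  have hi : ∀ i j : Fin 3,
      Integrable fun ξ : E3 => conj (v i) * ((ξ i * ξ j * m ξ : ℝ) : ℂ) * v j :=
    fun i j => ((hm i j).ofReal.const_mul _).mul_const _
  simp only [h1]
  rw [← integral_complex_ofReal]
  simp only [← integral_finsetSum Finset.univ fun j _ => hi _ j]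
  rw [← integral_finsetSum Finset.univ fun i _ => integrable_finsetSum Finset.univ fun j _ => hi i j]
  refine integral_congr_ae (Eventually.of_forall fun ξ => ?_)
  simp only
  push_cast
  rw [← Complex.conj_mul', map_sum, Finset.sum_mul_sum, Finset.sum_mul]
  refine Finset.sum_congr rfl fun i _ => ?_
  rw [Finset.sum_mul]
  refine Finset.sum_congr rfl fun j _ => ?_
  simp only [map_mul, Complex.conj_ofReal]
  ring

/-- `Γ(t)`, acting on complex vectors. -/
def memoryOp (ρ : Fin d → E3 → ℝ) (t : ℝ) : EuclideanSpace ℂ (Fin 3) →L[ℂ] EuclideanSpace ℂ (Fin 3) :=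
  Matrix.toEuclideanCLM (𝕜 := ℂ) ((memoryMatrix ρ (max t 0)).map Complex.ofReal)

theorem memoryOp_apply (ρ : Fin d → E3 → ℝ) (t : ℝ) (v : EuclideanSpace ℂ (Fin 3)) (i : Fin 3) :
    memoryOp ρ t v i = ∑ j, (memoryMatrix ρ (max t 0) i j : ℂ) * v j := by
  rw [memoryOp, Matrix.ofLp_toEuclideanCLM]
  rfl

/-- The kernel vanishes at time 0, so freezing time at `max t 0` extends Γ by zero to the past
without a jump. -/
theorem memoryOp_of_nonpos (ρ : Fin d → E3 → ℝ) {t : ℝ} (ht : t ≤ 0) : memoryOp ρ t = 0 := by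
  ext v i
  simp [memoryOp_apply, max_eq_right ht, memoryMatrix, memoryKernel_zero]

theorem memoryOp_eq_zero (hρ : ∀ n, IsTestFunction (ρ n)) {R : ℝ}
    (hR : ∀ n x, R < ‖x‖ → ρ n x = 0) {t : ℝ} (ht : 2 * |R| + 1 ≤ t) : memoryOp ρ t = 0 := by
  ext v i
  have h0 : 0 ≤ t := by linarith [abs_nonneg R]
  have h1 : ∀ n i j, memoryKernel (partialDeriv j (ρ n)) (partialDeriv i (ρ n)) t = 0 :=
    fun n i j => memoryKernel_eq_zero ((hρ n).partialDeriv i) (partialDeriv_eq_zero (hR n) i)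
      (partialDeriv_eq_zero (hR n) j) (by
        rw [abs_of_nonneg h0]
        linarith [le_abs_self R])
  simp [memoryOp_apply, max_eq_left h0, memoryMatrix, h1]

theorem continuous_memoryOp (hρ : ∀ n, IsTestFunction (ρ n)) {R : ℝ}
    (hR : ∀ n x, R < ‖x‖ → ρ n x = 0) : Continuous (memoryOp ρ) := by
  have h : Continuous fun t => (memoryMatrix ρ (max t 0)).map Complex.ofReal := by
    refine continuous_matrix fun i j => ?_
    simp only [Matrix.map_apply, memoryMatrix, Matrix.of_apply]
    refine Complex.continuous_ofReal.comp (continuous_finsetSum _ fun n _ => ?_)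
    exact (differentiable_memoryKernel ((hρ n).partialDeriv i) (partialDeriv_eq_zero (hR n) i)
      ((hρ n).partialDeriv j)).continuous.comp (by fun_prop)
  exact (LinearMap.continuous_of_finiteDimensional
    (Matrix.toEuclideanCLM (n := Fin 3) (𝕜 := ℂ)).toAlgEquiv.toLinearMap).comp h

theorem inner_memoryOp (hρ : ∀ n, IsTestFunction (ρ n)) {t : ℝ} (ht : 0 < t)
    (v : EuclideanSpace ℂ (Fin 3)) :
    inner ℂ v (memoryOp ρ t v) =
      ((∫ ξ, sinSymbol t ξ * (‖∑ j, (ξ j : ℂ) * v j‖ ^ 2 * spectralWeight ρ ξ) : ℝ) : ℂ) := by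
  have h := sum_conj_mul_integral_mul (fun i j => integrable_quadratic_sinSymbol
    (continuous_spectralWeight hρ) (integrable_pow_mul_spectralWeight hρ 2) t i j) v
  simp only [mul_left_comm _ (sinSymbol t _)] at h ⊢
  rw [← h]
  simp only [PiLp.inner_apply, memoryOp_apply, max_eq_left ht.le, memoryMatrix_apply hρ,
    RCLike.inner_apply, Finset.sum_mul]
  refine Finset.sum_congr rfl fun i _ => Finset.sum_congr rfl fun j _ => ?_
  simp only [mul_left_comm _ (sinSymbol t _)]
  ring

/-- For v = x + iy the real part of the complex quadratic form of a real matrix is the sum of its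
real forms at x and y. At least one of them is nonzero, so positive definiteness over ℝ suffices. -/
theorem integral_quadratic_div_lt (hρ : ∀ n, IsTestFunction (ρ n)) {ω : ℝ}
    (hA : (ω ^ 2 • (1 : Matrix (Fin 3) (Fin 3) ℝ) - couplingMatrix ρ).PosDef)
    {v : EuclideanSpace ℂ (Fin 3)} (hv : v ≠ 0) :
    ∫ ξ : E3, ‖∑ j, (ξ j : ℂ) * v j‖ ^ 2 * spectralWeight ρ ξ / (2 * π * ‖ξ‖) ^ 2 <
      ω ^ 2 * ‖v‖ ^ 2 := by
  have h := sum_conj_mul_integral_mul (integrable_quadratic_div hρ) v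
  have hK := fun i j => (couplingMatrix_apply hρ i j).symm
  simp only [hK] at h
  simp only [← mul_div_assoc] at h
  have h1 := congrArg Complex.re h
  rw [Complex.ofReal_re] at h1
  rw [← h1]
  set x : Fin 3 → ℝ := fun i => (v i).re with hx
  set y : Fin 3 → ℝ := fun i => (v i).im with hy
  set A := ω ^ 2 • (1 : Matrix (Fin 3) (Fin 3) ℝ) - couplingMatrix ρ with hAdef
  have hnn : ∀ w : Fin 3 → ℝ, 0 ≤ w ⬝ᵥ A.mulVec w := fun w => by
    simpa using hA.posSemidef.dotProduct_mulVec_nonneg w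
  have hpp : ∀ w : Fin 3 → ℝ, w ≠ 0 → 0 < w ⬝ᵥ A.mulVec w := fun w hw => by
    simpa using hA.dotProduct_mulVec_pos hw
  have hpos : 0 < x ⬝ᵥ A.mulVec x + y ⬝ᵥ A.mulVec y := by
    rcases eq_or_ne x 0 with hx0 | hx0
    · have hy0 : y ≠ 0 := by
        intro hy0
        apply hv
        ext i
        exact Complex.ext (congrFun hx0 i) (congrFun hy0 i)
      linarith [hnn x, hpp y hy0]
    · linarith [hnn y, hpp x hx0]
  have h2 : x ⬝ᵥ A.mulVec x + y ⬝ᵥ A.mulVec y = ω ^ 2 * ‖v‖ ^ 2 -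
      (∑ i, ∑ j, starRingEnd ℂ (v i) * (couplingMatrix ρ i j : ℂ) * v j).re := by
    rw [EuclideanSpace.norm_sq_eq]
    simp only [← Complex.normSq_eq_norm_sq, Complex.normSq_apply, hAdef, dotProduct, Matrix.mulVec,
      Matrix.sub_apply, Matrix.smul_apply, Matrix.one_apply, Fin.sum_univ_three, hx, hy]
    simp
    ring
  linarith

/-- In finite dimension injectivity suffices. A kernel vector v annihilates the form ⟨v, `charOp`
v⟩, which for Re z > 0 is the scalar dispersion function with density |ξ·v|² times `spectralWeight`,
and `dispersion_ne_zero` excludes this. -/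
theorem isUnit_charOp (hd : 0 < d) (hρ : ∀ n, IsTestFunction (ρ n)) {R : ℝ}
    (hR : ∀ n x, R < ‖x‖ → ρ n x = 0) {ω : ℝ}
    (hA : (ω ^ 2 • (1 : Matrix (Fin 3) (Fin 3) ℝ) - couplingMatrix ρ).PosDef)
    (hhat : ∀ n k, k ≠ 0 → fourierHat (ρ n) k ≠ 0) {z : ℂ} (hz : 0 ≤ z.re) :
    IsUnit (charOp ω (memoryOp ρ) z) := by
  have hcont := continuous_memoryOp hρ hR
  have hsupp : HasCompactSupport (memoryOp ρ) :=
    hasCompactSupport_of_Icc (fun t ht => memoryOp_of_nonpos ρ ht)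
      (fun t ht => memoryOp_eq_zero hρ hR ht)
  rw [ContinuousLinearMap.isUnit_iff_isUnit_toLinearMap, LinearMap.isUnit_iff_ker_eq_bot,
    LinearMap.ker_eq_bot']
  intro v hv
  by_contra hv0
  set h : E3 → ℝ := fun ξ => ‖∑ j, (ξ j : ℂ) * v j‖ ^ 2 * spectralWeight ρ ξ with hh
  have hw := continuous_spectralWeight hρ
  have hc : Continuous h := by fun_prop
  have hle : ∀ ξ : E3, ‖∑ j, (ξ j : ℂ) * v j‖ ^ 2 ≤ ‖ξ‖ ^ 2 * ‖v‖ ^ 2 := by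
    intro ξ
    have h1 : ‖∑ j, (ξ j : ℂ) * v j‖ ≤ ∑ j, |ξ j| * ‖v j‖ :=
      (norm_sum_le _ _).trans (le_of_eq (by simp))
    refine (pow_le_pow_left₀ (norm_nonneg _) h1 2).trans ?_
    rw [EuclideanSpace.norm_sq_eq v, EuclideanSpace.norm_sq_eq ξ]
    exact Finset.sum_mul_sq_le_sq_mul_sq _ _ _
  have hi : Integrable h := by
    refine ((integrable_pow_mul_spectralWeight hρ 2).const_mul (‖v‖ ^ 2)).mono'
      hc.aestronglyMeasurable (Eventually.of_forall fun ξ => ?_)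
    have h1 := spectralWeight_nonneg ρ ξ
    rw [Real.norm_of_nonneg (mul_nonneg (sq_nonneg _) h1)]
    calc _ ≤ ‖ξ‖ ^ 2 * ‖v‖ ^ 2 * spectralWeight ρ ξ := by gcongr; exact hle ξ
      _ = _ := by ring
  have h0 : ∀ ξ, 0 ≤ h ξ := fun ξ => mul_nonneg (sq_nonneg _) (spectralWeight_nonneg ρ ξ)
  have hi' : Integrable fun ξ => h ξ / (2 * π * ‖ξ‖) ^ 2 := by
    have h1 := integrable_pow_mul_spectralWeight hρ 0
    simp only [pow_zero, one_mul] at h1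
    refine (h1.const_mul (‖v‖ ^ 2)).mono' (Measurable.aestronglyMeasurable (by fun_prop))
      (Eventually.of_forall fun ξ => ?_)
    have h2 := spectralWeight_nonneg ρ ξ
    rw [Real.norm_of_nonneg (div_nonneg (h0 ξ) (sq_nonneg _))]
    refine div_le_of_le_mul₀ (sq_nonneg _) (by positivity) ?_
    have h3 : ‖ξ‖ ^ 2 ≤ (2 * π * ‖ξ‖) ^ 2 := by
      have : 1 ≤ 2 * π := by linarith [pi_gt_three]
      gcongr
      exact le_mul_of_one_le_left (norm_nonneg _) this
    calc h ξ ≤ ‖ξ‖ ^ 2 * ‖v‖ ^ 2 * spectralWeight ρ ξ := by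
          simp only [hh]; gcongr; exact hle ξ
      _ ≤ (2 * π * ‖ξ‖) ^ 2 * ‖v‖ ^ 2 * spectralWeight ρ ξ := by gcongr
      _ = _ := by ring
  have hpos : ∀ r : ℝ, 0 < r → ∃ θ : E3, ‖θ‖ = 1 ∧ 0 < h (r • θ) := by
    intro r hr
    obtain ⟨j, hj⟩ : ∃ j, v j ≠ 0 := by
      by_contra! hc
      exact hv0 (by ext i; exact hc i)
    -- Along a coordinate axis with vⱼ ≠ 0 the factor ξ·v does not vanish, and nonvanishing of ρ̂ₙ
    -- makes the spectral weight positive at every radius.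
    refine ⟨EuclideanSpace.single j 1, by simp, ?_⟩
    have h1 : ∑ i, (((r • EuclideanSpace.single j (1 : ℝ) : E3) i : ℝ) : ℂ) * v i = r * v j := by
      rw [Finset.sum_eq_single j] <;> simp +contextual
    have h2 : 0 < spectralWeight ρ (r • EuclideanSpace.single j (1 : ℝ)) := by
      refine Finset.sum_pos (fun n _ => ?_) ⟨⟨0, hd⟩, Finset.mem_univ _⟩
      have h3 := hhat n ((2 * π) • r • EuclideanSpace.single j (1 : ℝ)) (by
        refine smul_ne_zero (by positivity) (smul_ne_zero hr.ne' ?_)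
        simp)
      rw [fourierHat_two_pi_smul] at h3
      have := norm_pos_iff.2 h3
      positivity
    simp only [hh, h1]
    have h3 : (r : ℂ) * v j ≠ 0 := mul_ne_zero (by exact_mod_cast hr.ne') hj
    have := norm_pos_iff.2 h3
    positivity
  have hvn : 0 < ‖v‖ := norm_pos_iff.2 hv0
  have hdiff := differentiable_charOp (ω := ω) hcont (fun t ht => memoryOp_of_nonpos ρ ht)
    (fun t ht => memoryOp_eq_zero hρ hR ht)
  refine dispersion_ne_zero (N := ‖v‖ ^ 2) (ω := ω) hc hi h0 (by positivity) hi'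
    (integral_quadratic_div_lt hρ hA hv0) hpos
    (Q := fun z => inner ℂ v (charOp ω (memoryOp ρ) z v))
    (by
      have := hdiff.continuous
      fun_prop) (fun z hz => ?_) hz ?_
  · rw [← laplaceTransform_oscillators hi (γ := fun t => inner ℂ v (memoryOp ρ t v))
      (fun t ht => by simp [memoryOp_of_nonpos ρ ht]) (fun t ht => inner_memoryOp hρ ht v) hz]
    have h1 := ((innerSL ℂ v).comp (ContinuousLinearMap.apply ℂ _ v)).integral_comp_comm
      (integrable_laplace_of_hasCompactSupport hcont hsupp z)
    simp only [ContinuousLinearMap.comp_apply, ContinuousLinearMap.apply_apply, innerSL_apply_apply,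
      smul_apply, inner_smul_right] at h1
    have h2 : inner ℂ v v = ((‖v‖ ^ 2 : ℝ) : ℂ) := by
      rw [inner_self_eq_norm_sq_to_K]; norm_cast
    simp only [charOp, sub_apply, smul_apply, one_apply_eq_self, inner_sub_right, inner_smul_right,
      h2, laplaceTransform, smul_eq_mul, h1]
  · have : charOp ω (memoryOp ρ) z v = 0 := hv
    simp only [this, inner_zero_right]

end Spectral

end

/-! ### The particle equation as a delay equation -/

section

open Set Filter Real

/-- The support condition leaves the sphere |x| = A uncontrolled while the ball is open; the sphere
is a null set. -/
theorem indicator_ball_ae_eq {f : E3 → ℝ} {A : ℝ} (hsupp : ∀ᵐ x : E3, A < ‖x‖ → f x = 0)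
    (hA : A ≠ 0) : (Metric.ball (0 : E3) A).indicator f =ᵐ[volume] f := by
  have h1 : ∀ᵐ x : E3, x ∉ Metric.sphere (0 : E3) A :=
    measure_eq_zero_iff_ae_notMem.1 (Measure.addHaar_sphere_of_ne_zero _ _ hA)
  filter_upwards [hsupp, h1] with x hx hx1
  rcases lt_trichotomy ‖x‖ A with h | h | h
  · rw [indicator_of_mem (by simpa using h)]
  · exact absurd h (by simpa using hx1)
  · rw [indicator_of_notMem (by simpa using h.le), hx h]

theorem abs_integral_mul_le_of_ae {f g : E3 → ℝ} {A M : ℝ} (hf : IntegrableOn f (Metric.ball 0 A))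
    (hA : A ≠ 0) (hg : ∀ x, |g x| ≤ M) (hsupp : ∀ᵐ x : E3, A < ‖x‖ → f x = 0) :
    |∫ x, f x * g x| ≤ M * ∫ x in Metric.ball 0 A, |f x| := by
  have h0 := indicator_ball_ae_eq hsupp hA
  have h1 : ∫ x, f x * g x = ∫ x, (Metric.ball (0 : E3) A).indicator f x * g x :=
    integral_congr_ae (h0.mono fun x hx => by simp only [hx])
  have h2 : ∫ x in Metric.ball (0 : E3) A, |f x| =
      ∫ x in Metric.ball (0 : E3) A, |(Metric.ball (0 : E3) A).indicator f x| :=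
    integral_congr_ae ((ae_restrict_of_ae h0).mono fun x hx => by simp only [hx])
  rw [h1, h2]
  refine abs_integral_mul_le ?_ hg fun x hx => ?_
  · exact (hf.congr_fun_ae (ae_restrict_of_ae h0.symm))
  · rw [indicator_of_notMem (by simpa using hx), zero_mul]

section Complexify

/-- The inclusion of `ℝ³` into `ℂ³`. -/
def complexify : E3 →ₗᵢ[ℝ] EuclideanSpace ℂ (Fin 3) where
  toFun x := WithLp.toLp 2 fun i => (x i : ℂ)
  map_add' x y := by ext i; simp
  map_smul' c x := by ext i; simp
  norm_map' x := by simp [EuclideanSpace.norm_eq]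

theorem complexify_apply (x : E3) (i : Fin 3) : complexify x i = (x i : ℂ) := rfl

end Complexify

section Force

variable {d : ℕ} {ω : ℝ} {ρ : Fin d → E3 → ℝ} {Y₀ : State d} {Y : ℝ → State d}

/-- The force exerted on the particle at time `t` by the free field with the data of `Y₀`. -/
def freeForce (ρ : Fin d → E3 → ℝ) (Y₀ : State d) (t : ℝ) : E3 :=
  WithLp.toLp 2 fun i => -∑ n, ((∫ x, Y₀.φ n x * waveCos t (partialDeriv i (ρ n)) x) +
    ∫ x, Y₀.π n x * waveSin t (partialDeriv i (ρ n)) x)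

/-- The total force on the particle. -/
def totalForce (ω : ℝ) (ρ : Fin d → E3 → ℝ) (Y : ℝ → State d) (t : ℝ) : E3 :=
  -(ω ^ 2 • (Y t).q) - ∑ n, ∫ x, (Y t).φ n x • gradient (ρ n) x

theorem IsSolution.continuous_q (hY : IsSolution ω ρ Y₀ Y) : Continuous fun t => (Y t).q :=
  continuous_iff_continuousAt.2 fun t => (hY.position t).continuousAt

theorem IsSolution.continuous_totalForce (hY : IsSolution ω ρ Y₀ Y)
    (hρ : ∀ n, IsTestFunction (ρ n)) : Continuous (totalForce ω ρ Y) := by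
  rw [← (PiLp.homeomorph 2 (fun _ : Fin 3 => ℝ)).comp_continuous_iff]
  refine continuous_pi fun i => ?_
  change Continuous fun t => totalForce ω ρ Y t i
  simp only [totalForce, force_apply ω Y hρ i]
  have hq := hY.continuous_q
  refine Continuous.sub (by fun_prop) (continuous_finsetSum _ fun n _ => ?_)
  exact continuous_iff_continuousAt.2 fun t =>
    (hY.field n _ ((hρ n).partialDeriv i) t).continuousAt

/-- Duhamel's formula with f = ∂ᵢρₙ. The minus sign of its source term and that of the coupling
force combine to the plus sign in front of the memory; the substitution s ↦ t - s puts the delay on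
q. -/
theorem IsSolution.totalForce_eq (hY : IsSolution ω ρ Y₀ Y) (hρ : ∀ n, IsTestFunction (ρ n))
    {R : ℝ} (hR : ∀ n x, R < ‖x‖ → ρ n x = 0) {t : ℝ} (ht : 0 ≤ t) :
    complexify (totalForce ω ρ Y t) = -(ω ^ 2 • complexify (Y t).q) +
      (∫ s in (0 : ℝ)..t, memoryOp ρ s (complexify (Y (t - s)).q)) +
      complexify (freeForce ρ Y₀ t) := by
  have hq := hY.continuous_q
  have hΓ := continuous_memoryOp hρ hR
  have hqt : Continuous fun s => complexify (Y (t - s)).q :=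
    complexify.continuous.comp (hq.comp (continuous_const.sub continuous_id))
  have hint : IntervalIntegrable (fun s => memoryOp ρ s (complexify (Y (t - s)).q)) volume 0 t :=
    (hΓ.clm_apply hqt).intervalIntegrable _ _
  have hmk : ∀ n i j,
      Continuous (memoryKernel (partialDeriv j (ρ n)) (partialDeriv i (ρ n))) := fun n i j =>
    (differentiable_memoryKernel ((hρ n).partialDeriv i) (partialDeriv_eq_zero (hR n) i)
      ((hρ n).partialDeriv j)).continuous
  ext i
  have h1 : (∫ s in (0 : ℝ)..t, memoryOp ρ s (complexify (Y (t - s)).q)) i =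
      ((∑ n, ∫ s in (0 : ℝ)..t, ∑ j, (Y s).q j *
        memoryKernel (partialDeriv j (ρ n)) (partialDeriv i (ρ n)) (t - s) : ℝ) : ℂ) := by
    have h2 : ∫ s in (0 : ℝ)..t, memoryOp ρ s (complexify (Y (t - s)).q) i =
        (∫ s in (0 : ℝ)..t, memoryOp ρ s (complexify (Y (t - s)).q)) i :=
      (EuclideanSpace.proj (𝕜 := ℂ) i).intervalIntegral_comp_comm hint
    rw [← h2, ← intervalIntegral.integral_finsetSum]
    · have h3 := intervalIntegral.integral_comp_sub_left (a := 0) (b := t) (fun s => ∑ n, ∑ j,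
        (Y s).q j * memoryKernel (partialDeriv j (ρ n)) (partialDeriv i (ρ n)) (t - s)) t
      rw [sub_self, sub_zero] at h3
      rw [← h3, ← intervalIntegral.integral_ofReal]
      refine intervalIntegral.integral_congr fun s hs => ?_
      rw [uIcc_of_le ht] at hs
      simp only [memoryOp_apply, complexify_apply, max_eq_left hs.1, memoryMatrix, Matrix.of_apply,
        sub_sub_cancel]
      push_cast
      rw [Finset.sum_comm]
      refine Finset.sum_congr rfl fun j _ => ?_
      rw [Finset.sum_mul]
      exact Finset.sum_congr rfl fun n _ => mul_comm _ _
    · intro n _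
      refine Continuous.intervalIntegrable (continuous_finsetSum _ fun j _ => ?_) _ _
      exact ((EuclideanSpace.proj j).continuous.comp hq).mul
        ((hmk n i j).comp (continuous_const.sub continuous_id))
  have h3 : totalForce ω ρ Y t i = -(ω ^ 2 * (Y t).q i) +
      (∑ n, ∫ s in (0 : ℝ)..t, ∑ j, (Y s).q j *
        memoryKernel (partialDeriv j (ρ n)) (partialDeriv i (ρ n)) (t - s)) +
      freeForce ρ Y₀ t i := by
    rw [totalForce, force_apply ω Y hρ i]
    simp only [hY.integral_φ_mul_eq hρ _ ((hρ _).partialDeriv i) (partialDeriv_eq_zero (hR _) i) t,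
      freeForce, Finset.sum_sub_distrib]
    ring
  simp only [PiLp.add_apply, PiLp.neg_apply, PiLp.smul_apply, h1, complexify_apply, h3]
  push_cast
  simp

/-- By duality ρₙ is propagated instead of the data: after time R₁ + |R| its wave has left the ball
of radius R₁ that carries the data. -/
theorem freeForce_eq_zero (hρ : ∀ n, IsTestFunction (ρ n)) {R R₁ : ℝ}
    (hR : ∀ n x, R < ‖x‖ → ρ n x = 0) (hY₀ : Y₀.FieldSupportedIn R₁) {t : ℝ}
    (ht : R₁ + |R| + 1 ≤ t) (ht0 : 0 ≤ t) : freeForce ρ Y₀ t = 0 := by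
  have h0 : ∀ x : E3, ‖x‖ ≤ R₁ → R < |‖x‖ - (|t|)| := by
    intro x hx
    rw [abs_of_nonneg ht0, abs_sub_comm]
    refine lt_of_lt_of_le ?_ (le_abs_self _)
    linarith [le_abs_self R]
  ext i
  simp only [freeForce, PiLp.zero_apply, neg_eq_zero]
  refine Finset.sum_eq_zero fun n _ => ?_
  have hf := (hρ n).partialDeriv i
  have hfR := partialDeriv_eq_zero (hR n) i
  rw [integral_eq_zero_of_ae, integral_eq_zero_of_ae, add_zero]
  · filter_upwards [hY₀ n] with x hx
    rcases le_or_gt ‖x‖ R₁ with h | h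
    · simp [waveSin_eq_zero hf hfR (h0 x h)]
    · simp [(hx h).2]
  · filter_upwards [hY₀ n] with x hx
    rcases le_or_gt ‖x‖ R₁ with h | h
    · simp [waveCos_eq_zero hf hfR (h0 x h)]
    · simp [(hx h).1]

/-- The bound on `waveSin` grows linearly in t, but the force vanishes after T, so the growth costs
only the factor 1 + T. -/
theorem exists_norm_freeForce_le (hρ : ∀ n, IsTestFunction (ρ n)) {R R₁ : ℝ}
    (hR : ∀ n x, R < ‖x‖ → ρ n x = 0) (hR₁ : 0 < R₁) :
    ∃ C, 0 ≤ C ∧ ∀ Y₀ : State d, Y₀.FieldSupportedIn R₁ → ∀ t, 0 ≤ t →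
      ‖freeForce ρ Y₀ t‖ ≤ C * Y₀.seminorm R₁ := by
  set T := R₁ + |R| + 1 with hT
  have hT0 : 0 ≤ T := by positivity
  set V := √(volume.real (Metric.ball (0 : E3) R₁)) with hV
  have hV0 : 0 ≤ V := sqrt_nonneg _
  set m : Fin 3 → Fin d → ℝ := fun i n => ∫ ξ, ‖invHat (partialDeriv i (ρ n)) ξ‖ with hm
  have hm0 : ∀ i n, 0 ≤ m i n := fun i n => integral_nonneg fun _ => norm_nonneg _
  refine ⟨∑ i, ∑ n, (1 + T) * m i n * V, Finset.sum_nonneg fun i _ => Finset.sum_nonneg fun n _ => by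
    have := hm0 i n
    positivity, fun Y₀ hY₀ t ht => ?_⟩
  have hN := Y₀.seminorm_nonneg R₁
  rcases le_or_gt T t with htT | htT
  · rw [freeForce_eq_zero hρ hR hY₀ htT ht, norm_zero]
    refine mul_nonneg (Finset.sum_nonneg fun i _ => Finset.sum_nonneg fun n _ => ?_) hN
    have := hm0 i n
    positivity
  · have h1 : ‖freeForce ρ Y₀ t‖ ≤ ∑ i, |freeForce ρ Y₀ t i| := by
      rw [EuclideanSpace.norm_eq]
      refine Real.sqrt_le_iff.2 ⟨Finset.sum_nonneg fun i _ => abs_nonneg _, ?_⟩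
      simp only [Real.norm_eq_abs]
      exact Finset.sum_sq_le_sq_sum_of_nonneg fun i _ => abs_nonneg _
    refine h1.trans ?_
    rw [Finset.sum_mul]
    refine Finset.sum_le_sum fun i _ => ?_
    simp only [freeForce, abs_neg]
    rw [Finset.sum_mul]
    refine (Finset.abs_sum_le_sum_abs _ _).trans (Finset.sum_le_sum fun n _ => ?_)
    have hf := (hρ n).partialDeriv i
    have e1 := abs_integral_mul_le_of_ae ((Y₀.φ_mem n).integrableOn_ball R₁) hR₁.ne'
      (abs_waveCos_le hf t) ((hY₀ n).mono fun x hx h => (hx h).1)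
    have e2 := abs_integral_mul_le_of_ae ((Y₀.π_mem n).integrableOn_ball R₁) hR₁.ne'
      (abs_waveSin_le hf t) ((hY₀ n).mono fun x hx h => (hx h).2)
    have e3 := mul_le_mul_of_nonneg_left (Y₀.integral_abs_φ_le hR₁ n) (hm0 i n)
    have e4 := mul_le_mul_of_nonneg_left (Y₀.integral_abs_π_le hR₁ n)
      (mul_nonneg (abs_nonneg t) (hm0 i n))
    have e5 : |t| * m i n * (V * Y₀.seminorm R₁) ≤ T * m i n * (V * Y₀.seminorm R₁) := by
      rw [abs_of_nonneg ht]
      have := hm0 i n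
      gcongr
    refine (abs_add_le _ _).trans ?_
    calc _ ≤ m i n * (V * Y₀.seminorm R₁) + T * m i n * (V * Y₀.seminorm R₁) := by linarith
      _ = _ := by ring

theorem IsSolution.isDelaySolution (hY : IsSolution ω ρ Y₀ Y) (hρ : ∀ n, IsTestFunction (ρ n))
    {R : ℝ} (hR : ∀ n x, R < ‖x‖ → ρ n x = 0) :
    IsDelaySolution ω (memoryOp ρ) (fun t => complexify (freeForce ρ Y₀ t))
      (fun t => complexify (Y t).q) (fun t => complexify (Y t).p)
      (fun t => complexify (totalForce ω ρ Y t)) where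
  deriv_q t := complexify.toContinuousLinearMap.hasFDerivAt.comp_hasDerivAt t (hY.position t)
  deriv_p t := complexify.toContinuousLinearMap.hasFDerivAt.comp_hasDerivAt t (hY.force t)
  continuous_P := complexify.continuous.comp (hY.continuous_totalForce hρ)
  eq _ ht := hY.totalForce_eq hρ hR ht

end Force

end

end FieldParticle

end

theorem theorem4p2 (d : ℕ) (hd : 0 < d) (ω : ℝ) (hω : 0 < ω)
    (ρ : Fin d → FieldParticle.E3 → ℝ) (Rρ : ℝ)
    (hA1 : (ω ^ 2 • (1 : Matrix (Fin 3) (Fin 3) ℝ) - FieldParticle.couplingMatrix ρ).PosDef)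
    (hA2_smooth : ∀ n, ContDiff ℝ ((⊤ : ℕ∞) : WithTop ℕ∞) (ρ n))
    (hA2_even : ∀ n x, ρ n (-x) = ρ n x)
    (hA2_supp : ∀ n x, Rρ ≤ ‖x‖ → ρ n x = 0)
    (hA3 : ∀ n k, k ≠ 0 → FieldParticle.fourierHat (ρ n) k ≠ 0) :
    ∃ δ : ℝ, 0 < δ ∧ ∀ R₁ : ℝ, 0 < R₁ → ∃ C : ℝ, 0 < C ∧
      ∀ (Y₀ : FieldParticle.State d) (Y : ℝ → FieldParticle.State d),
        Y₀.FieldSupportedIn R₁ →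
        FieldParticle.IsSolution ω ρ Y₀ Y →
        ∀ t : ℝ, 0 ≤ t →
          ‖(Y t).q‖ + ‖(Y t).p‖ ≤ C * Real.exp (-δ * t) * Y₀.seminorm R₁ := by
  have hR : ∀ n x, Rρ < ‖x‖ → ρ n x = 0 := fun n x hx => hA2_supp n x hx.le
  have hρ : ∀ n, FieldParticle.IsTestFunction (ρ n) := fun n =>
    ⟨hA2_smooth n, FieldParticle.hasCompactSupport_of_forall_norm (hR n)⟩
  obtain ⟨δ, hδ, hdecay⟩ := FieldParticle.IsDelaySolution.exists_decay (ω := ω)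
    (FieldParticle.continuous_memoryOp hρ hR) (fun t ht => FieldParticle.memoryOp_of_nonpos ρ ht)
    (fun t ht => FieldParticle.memoryOp_eq_zero hρ hR ht)
    (fun z hz => FieldParticle.isUnit_charOp hd hρ hR hA1 hA3 hz)
  refine ⟨δ, hδ, fun R₁ hR₁ => ?_⟩
  -- The extinction time of the free force. It depends on R₁ and affects only the constant, since δ
  -- is already fixed.
  obtain ⟨C, hC, hdec⟩ := hdecay (R₁ + |Rρ| + 1)
  obtain ⟨C', hC', hforce⟩ := FieldParticle.exists_norm_freeForce_le hρ hR hR₁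
  -- One seminorm each for the initial position and momentum, and C' of them for the free force.
  refine ⟨C * (2 + C'), by positivity, fun Y₀ Y hY₀ hY t ht => ?_⟩
  have hN := Y₀.seminorm_nonneg R₁
  have h := hdec _ _ _ _ (C' * Y₀.seminorm R₁) (hY.isDelaySolution hρ hR) (by positivity)
    (fun t ht => by
      rw [LinearIsometry.norm_map]
      exact hforce Y₀ hY₀ t ht)
    (fun t ht => by
      rw [FieldParticle.freeForce_eq_zero hρ hR hY₀ ht
        (le_trans (by positivity) ht), map_zero]) t ht
  simp only [LinearIsometry.norm_map, hY.initial] at h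
  refine h.trans ?_
  calc C * Real.exp (-δ * t) * (‖Y₀.q‖ + ‖Y₀.p‖ + C' * Y₀.seminorm R₁) ≤
      C * Real.exp (-δ * t) * (Y₀.seminorm R₁ + Y₀.seminorm R₁ + C' * Y₀.seminorm R₁) := by
        gcongr
        · exact Y₀.norm_q_le R₁
        · exact Y₀.norm_p_le R₁
    _ = _ := by ring
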